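/- Let $N\ge 1$ be an integer, $s\in(0,1)$, $\alpha\in(0,N)$, $\theta\in(0,\alpha)$ with $2s<N<2s+\alpha$, and let $\varepsilon>0$. Let $V:\mathbb R^N\to\mathbb R$ be continuous with $$0<V_0:=\min_{\mathbb R^N}V<V_\infty:=\liminf_{|x|\to\infty}V(x)\in(V_0,+\infty].$$ Let $f:\mathbb R\to\mathbb R$ be of class $C^1$ with $f(t)=0$ for $t\le 0$, put $F(t)=\int_0^t f(\tau)\,d\tau$, and assume: $\lim_{t\to0}f(t)/t=0$; there is $q_0\in(2,2_s^*-1)$, where $2_s^*=2N/(N-2s)$, such that $\lim_{t\to\infty}f(t)/t^{q_0}=0$; there is $K>4$ such that $0<KF(t)\le tf(t)$ for all $t>0$; and $t\mapsto f(t)/t^3$ is strictly increasing on $(0,\infty)$. Functions are real-valued. Let $(-\Delta)^{s/2}$ be the operator with Fourier symbol $|\xi|^{s}$ and $H^s(\mathbb R^N)=\{u\in L^2(\mathbb R^N):(-\Delta)^{s/2}u\in L^2(\mathbb R^N)\}$. Let $$W_\varepsilon=\Big\{u\in H^s(\mathbb R^N):\int_{\mathbb R^N}V(\varepsilon x)u^2\,dx<\infty\Big\},\qquad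 (u,v)_\varepsilon=\int_{\mathbb R^N}(-\Delta)^{s/2}u\,(-\Delta)^{s/2}v\,dx+\int_{\mathbb R^N}V(\varepsilon x)uv\,dx,$$ with the norm of this scalar product. For $u\in W_\varepsilon$ let $$\phi_{\varepsilon,u}(x)=\varepsilon^{\alpha-\theta}\int_{\mathbb R^N}\frac{u(y)^2}{|x-y|^{N-\alpha}}\,dy,$$ which is the weak solution in $\dot H^{\alpha/2}(\mathbb R^N)$ of $(-\Delta)^{\alpha/2}\phi=\varepsilon^{\alpha-\theta}\gamma_\alpha u^2$, $\gamma_\alpha=\pi^{N/2}2^\alpha\Gamma(\alpha/2)/\Gamma(N/2-\alpha/2)$, and let $$I_\varepsilon(u)=\frac12\int_{\mathbb R^N}|(-\Delta)^{s/2}u|^2+\frac12\int_{\mathbb R^N}V(\varepsilon x)u^2+\frac14\int_{\mathbb R^N}\phi_{\varepsilon,u}u^2-\int_{\mathbb R^N}F(u).$$ For $\mu>0$ let $E_\mu(u)=\frac12\int|(-\Delta)^{s/2}u|^2+\frac\mu2\int u^2-\int F(u)$ on $H^s(\mathbb R^N)$ and $$m^\infty_\mu=\inf\Big\{E_\mu(u):u\in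 H^s(\mathbb R^N)\setminus\{0\},\ \int_{\mathbb R^N}|(-\Delta)^{s/2}u|^2+\mu\int_{\mathbb R^N}u^2=\int_{\mathbb R^N}f(u)u\Big\}.$$ A functional $J$ on a normed space $X$ satisfies the Palais–Smale condition at level $c\in\mathbb R$ if $J$ is of class $C^1$ and every sequence $(u_n)$ in $X$ with $J(u_n)\to c$ and $J'(u_n)\to0$ in $X'$ has a subsequence that converges in $X$. Proposition 3.4. The functional $I_\varepsilon$ on $W_\varepsilon$ satisfies the Palais–Smale condition 1. at every level $c<m^\infty_{V_\infty}$, if $V_\infty<\infty$; 2. at every level $c\in\mathbb R$, if $V_\infty=\infty$. -/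

import Mathlib

open Real Set Filter Topology MeasureTheory
open scoped ENNReal FourierTransform

noncomputable section

namespace FracSchrodingerPoisson

/-- The Euclidean space `ℝ^N`. -/
abbrev RN (N : ℕ) : Type := EuclideanSpace ℝ (Fin N)

/-- Real-valued `L²(ℝ^N)`. -/
abbrev L2 (N : ℕ) : Type := Lp ℝ 2 (volume : Measure (RN N))

/-- A real `L²` function seen as a complex one. -/
def complexify (N : ℕ) : L2 N →L[ℝ] Lp ℂ 2 (volume : Measure (RN N)) :=
  Complex.ofRealCLM.compLpL 2 volume

/-- `IsFracLap β u g` says that `(-Δ)^β u = g`, where `u` and `g` are in `L²(ℝ^N)`: the Fourier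
transform of `g` is `|·|^{2β}` times that of `u`. Mathlib's Fourier transform has the kernel
`exp (-2πi⟨x, ξ⟩)`, so that the symbol `|·|^{2β}` of the usual frequency variable reads
`(2π‖ξ‖)^{2β}`. -/
def IsFracLap {N : ℕ} (β : ℝ) (u g : L2 N) : Prop :=
  (𝓕 (complexify N g) : Lp ℂ 2 (volume : Measure (RN N))) =ᵐ[volume]
    fun ξ => (((2 * π * ‖ξ‖) ^ (2 * β) : ℝ) : ℂ) *
      (𝓕 (complexify N u) : Lp ℂ 2 (volume : Measure (RN N))) ξ

theorem complexify_injective (N : ℕ) : Function.Injective (complexify N) := by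
  intro u v h
  apply Lp.ext
  have h1 := Complex.ofRealCLM.coeFn_compLpL (p := 2) (μ := (volume : Measure (RN N))) u
  have h2 := Complex.ofRealCLM.coeFn_compLpL (p := 2) (μ := (volume : Measure (RN N))) v
  have h3 : Complex.ofRealCLM.compLpL 2 volume u = Complex.ofRealCLM.compLpL 2 volume v := h
  rw [h3] at h1
  filter_upwards [h1, h2] with x hx1 hx2
  have := hx1.symm.trans hx2
  simpa using this

theorem IsFracLap.unique {N : ℕ} {β : ℝ} {u g h : L2 N} (hg : IsFracLap β u g)
    (hh : IsFracLap β u h) : g = h := by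
  apply complexify_injective N
  apply (Lp.fourierTransformₗᵢ (RN N) ℂ).injective
  exact Lp.ext (hg.trans hh.symm)

theorem IsFracLap.zero {N : ℕ} {β : ℝ} : IsFracLap β (0 : L2 N) 0 := by
  have h0 : (𝓕 (complexify N 0) : Lp ℂ 2 (volume : Measure (RN N))) = 0 := by
    rw [map_zero]
    exact (Lp.fourierTransformₗᵢ (RN N) ℂ).map_zero
  unfold IsFracLap
  rw [h0]
  filter_upwards [Lp.coeFn_zero ℂ 2 (volume : Measure (RN N))] with x hx
  simp

theorem IsFracLap.add {N : ℕ} {β : ℝ} {u v g h : L2 N} (hu : IsFracLap β u g)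
    (hv : IsFracLap β v h) : IsFracLap β (u + v) (g + h) := by
  have hadd : ∀ a b : L2 N, (𝓕 (complexify N (a + b)) : Lp ℂ 2 (volume : Measure (RN N))) =
      𝓕 (complexify N a) + 𝓕 (complexify N b) := by
    intro a b
    rw [map_add]
    exact (Lp.fourierTransformₗᵢ (RN N) ℂ).map_add _ _
  unfold IsFracLap at *
  rw [hadd, hadd]
  filter_upwards [hu, hv, Lp.coeFn_add (𝓕 (complexify N g)) (𝓕 (complexify N h)),
    Lp.coeFn_add (𝓕 (complexify N u)) (𝓕 (complexify N v))] with x h1 h2 h3 h4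
  rw [h3, h4, Pi.add_apply, Pi.add_apply, h1, h2, mul_add]

theorem IsFracLap.smul {N : ℕ} {β : ℝ} {u g : L2 N} (c : ℝ) (hu : IsFracLap β u g) :
    IsFracLap β (c • u) (c • g) := by
  have hsmul : ∀ a : L2 N, (𝓕 (complexify N (c • a)) : Lp ℂ 2 (volume : Measure (RN N))) =
      (c : ℂ) • 𝓕 (complexify N a) := by
    intro a
    have h1 : c • complexify N a = (c : ℂ) • complexify N a := by
      apply Lp.ext
      filter_upwards [Lp.coeFn_smul c (complexify N a), Lp.coeFn_smul (c : ℂ) (complexify N a)]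
        with x hx hx'
      rw [hx, hx', Pi.smul_apply, Pi.smul_apply, Complex.coe_smul]
    rw [map_smul, h1]
    exact (Lp.fourierTransformₗᵢ (RN N) ℂ).map_smul _ _
  unfold IsFracLap at *
  rw [hsmul, hsmul]
  filter_upwards [hu, Lp.coeFn_smul (c : ℂ) (𝓕 (complexify N g)),
    Lp.coeFn_smul (c : ℂ) (𝓕 (complexify N u))] with x h1 h3 h4
  rw [h3, h4, Pi.smul_apply, Pi.smul_apply, h1, smul_eq_mul, smul_eq_mul]
  ring

/-- `H^s(ℝ^N)`: the `u ∈ L²(ℝ^N)` with `(-Δ)^{s/2} u ∈ L²(ℝ^N)`. -/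
def Hs (N : ℕ) (s : ℝ) : Submodule ℝ (L2 N) where
  carrier := {u | ∃ g : L2 N, IsFracLap (s / 2) u g}
  zero_mem' := ⟨0, IsFracLap.zero⟩
  add_mem' := by
    rintro u v ⟨g, hg⟩ ⟨h, hh⟩
    exact ⟨g + h, hg.add hh⟩
  smul_mem' := by
    rintro c u ⟨g, hg⟩
    exact ⟨c • g, hg.smul c⟩

/-- The operator `(-Δ)^{s/2} : H^s(ℝ^N) → L²(ℝ^N)`. -/
def fracLap {N : ℕ} (s : ℝ) : Hs N s →ₗ[ℝ] L2 N where
  toFun u := u.2.choose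
  map_add' u v := IsFracLap.unique (u + v).2.choose_spec (u.2.choose_spec.add v.2.choose_spec)
  map_smul' c u := IsFracLap.unique (c • u).2.choose_spec (u.2.choose_spec.smul c)

theorem fracLap_spec {N : ℕ} {s : ℝ} (u : Hs N s) : IsFracLap (s / 2) (u : L2 N) (fracLap s u) :=
  u.2.choose_spec

/-- A continuous positive potential on `ℝ^N`. -/
structure Potential (N : ℕ) where
  toFun : RN N → ℝ
  continuous : Continuous toFun
  pos : ∀ x, 0 < toFun x

instance (N : ℕ) : CoeFun (Potential N) (fun _ => RN N → ℝ) := ⟨Potential.toFun⟩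

theorem Potential.aesm {N : ℕ} (V : Potential N) (ε : ℝ) :
    AEStronglyMeasurable (fun x : RN N => V (ε • x)) volume :=
  (V.continuous.comp (continuous_const_smul ε)).aestronglyMeasurable

theorem integrable_mul_of_sq {N : ℕ} (V : Potential N) (ε : ℝ) (u v : L2 N)
    (hu : Integrable (fun x => V (ε • x) * u x ^ 2) volume)
    (hv : Integrable (fun x => V (ε • x) * v x ^ 2) volume) :
    Integrable (fun x => V (ε • x) * (u x * v x)) volume := by
  refine (hu.add hv).mono'
    ((V.aesm ε).mul ((Lp.aestronglyMeasurable u).mul (Lp.aestronglyMeasurable v))) ?_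
  refine Eventually.of_forall fun x => ?_
  have hV := V.pos (ε • x)
  rw [Real.norm_eq_abs, abs_mul, abs_of_pos hV, Pi.add_apply, ← mul_add]
  refine mul_le_mul_of_nonneg_left ?_ hV.le
  rw [abs_le]
  constructor <;> nlinarith [sq_nonneg (u x + v x), sq_nonneg (u x - v x), sq_nonneg (u x),
    sq_nonneg (v x)]

/-- The set `{u ∈ H^s(ℝ^N) : ∫ V(εx) u² < ∞}`, as a linear subspace of `H^s(ℝ^N)`. -/
def WSubmodule {N : ℕ} (s : ℝ) (V : Potential N) (ε : ℝ) : Submodule ℝ (Hs N s) where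
  carrier := {u | Integrable (fun x => V (ε • x) * (u : L2 N) x ^ 2) volume}
  zero_mem' := by
    refine (integrable_zero (RN N) ℝ volume).congr ?_
    filter_upwards [Lp.coeFn_zero ℝ 2 (volume : Measure (RN N))] with x hx
    simp
  add_mem' := by
    intro u v hu hv
    refine ((hu.add ((integrable_mul_of_sq V ε u v hu hv).const_mul 2)).add hv).congr ?_
    filter_upwards [Lp.coeFn_add (u : L2 N) (v : L2 N)] with x hx
    simp only [Submodule.coe_add, Pi.add_apply, hx]
    ring
  smul_mem' := by
    intro c u hu
    refine (Integrable.const_mul hu (c ^ 2)).congr ?_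
    filter_upwards [Lp.coeFn_smul c (u : L2 N)] with x hx
    simp only [Submodule.coe_smul, Pi.smul_apply, hx, smul_eq_mul]
    ring

/-- The space `W_ε`. It is a type of its own because it carries the scalar product
`(·,·)_ε` below and not the one of `L²`. -/
def W {N : ℕ} (s : ℝ) (V : Potential N) (ε : ℝ) : Type := ↥(WSubmodule s V ε)

section WSpace

variable {N : ℕ} {s : ℝ} {V : Potential N} {ε : ℝ}

instance : AddCommGroup (W s V ε) := inferInstanceAs (AddCommGroup ↥(WSubmodule s V ε))

instance : Module ℝ (W s V ε) := inferInstanceAs (Module ℝ ↥(WSubmodule s V ε))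

/-- The inclusion of `W_ε` in `H^s(ℝ^N)`. -/
def W.toHs : W s V ε →ₗ[ℝ] Hs N s := (WSubmodule s V ε).subtype

/-- The function `ℝ^N → ℝ` (defined up to null sets) underlying an element of `W_ε`. -/
def W.fn (u : W s V ε) : RN N → ℝ := ((W.toHs u : L2 N) : RN N → ℝ)

/-- The scalar product `(u,v)_ε = ∫ (-Δ)^{s/2}u (-Δ)^{s/2}v + ∫ V(εx) u v`. -/
def W.scalar (u v : W s V ε) : ℝ :=
  (∫ x, fracLap s (W.toHs u) x * fracLap s (W.toHs v) x) + ∫ x, V (ε • x) * (u.fn x * v.fn x)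

theorem W.integrable_sq (u : W s V ε) :
    Integrable (fun x => V (ε • x) * u.fn x ^ 2) volume := u.2

theorem W.integrable_mul (u v : W s V ε) :
    Integrable (fun x => V (ε • x) * (u.fn x * v.fn x)) volume :=
  integrable_mul_of_sq V ε _ _ u.2 v.2

theorem W.fn_add (u v : W s V ε) : (u + v).fn =ᵐ[volume] fun x => u.fn x + v.fn x := by
  exact Lp.coeFn_add (W.toHs u : L2 N) (W.toHs v : L2 N)

theorem W.fn_smul (c : ℝ) (u : W s V ε) : (c • u).fn =ᵐ[volume] fun x => c * u.fn x := by
  exact Lp.coeFn_smul c (W.toHs u : L2 N)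

theorem integral_mul_eq_inner (f g : L2 N) : ∫ x, f x * g x = inner ℝ g f := by
  rw [L2.inner_def]
  rfl

theorem W.scalar_eq (u v : W s V ε) : W.scalar u v =
    inner ℝ (fracLap s (W.toHs v)) (fracLap s (W.toHs u)) +
      ∫ x, V (ε • x) * (u.fn x * v.fn x) := by
  rw [W.scalar, integral_mul_eq_inner]

theorem W.scalar_comm (u v : W s V ε) : W.scalar u v = W.scalar v u := by
  rw [W.scalar_eq, W.scalar_eq, real_inner_comm]
  simp only [mul_comm (u.fn _)]

theorem W.scalar_self_nonneg (u : W s V ε) : 0 ≤ W.scalar u u :=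
  add_nonneg (integral_nonneg fun _ => mul_self_nonneg _)
    (integral_nonneg fun _ => mul_nonneg (V.pos _).le (mul_self_nonneg _))

theorem W.scalar_add_left (u v w : W s V ε) :
    W.scalar (u + v) w = W.scalar u w + W.scalar v w := by
  have h1 : ∫ x, V (ε • x) * ((u + v).fn x * w.fn x) =
      (∫ x, V (ε • x) * (u.fn x * w.fn x)) + ∫ x, V (ε • x) * (v.fn x * w.fn x) := by
    rw [← integral_add (W.integrable_mul u w) (W.integrable_mul v w)]
    refine integral_congr_ae ?_
    filter_upwards [W.fn_add u v] with x hx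
    rw [hx]
    ring
  rw [W.scalar_eq, W.scalar_eq, W.scalar_eq, h1, map_add, map_add, inner_add_right]
  ring

theorem W.scalar_smul_left (c : ℝ) (u v : W s V ε) :
    W.scalar (c • u) v = c * W.scalar u v := by
  have h1 : ∫ x, V (ε • x) * ((c • u).fn x * v.fn x) =
      c * ∫ x, V (ε • x) * (u.fn x * v.fn x) := by
    rw [← integral_const_mul]
    refine integral_congr_ae ?_
    filter_upwards [W.fn_smul c u] with x hx
    rw [hx]
    ring
  rw [W.scalar_eq, W.scalar_eq, h1, map_smul, map_smul, real_inner_smul_right]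
  ring

theorem W.eq_zero_of_scalar_self (u : W s V ε) (hu : W.scalar u u = 0) : u = 0 := by
  have h1 : 0 ≤ ∫ x, fracLap s (W.toHs u) x * fracLap s (W.toHs u) x :=
    integral_nonneg fun _ => mul_self_nonneg _
  have h2 : 0 ≤ fun x => V (ε • x) * (u.fn x * u.fn x) :=
    fun x => mul_nonneg (V.pos _).le (mul_self_nonneg _)
  have h3 : ∫ x, V (ε • x) * (u.fn x * u.fn x) = 0 := by
    have h4 := integral_nonneg (μ := (volume : Measure (RN N))) h2
    rw [W.scalar] at hu
    linarith
  rw [integral_eq_zero_iff_of_nonneg h2 (W.integrable_mul u u)] at h3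
  have h6 : (W.toHs u : L2 N) = 0 := by
    apply Lp.ext
    filter_upwards [h3, Lp.coeFn_zero ℝ 2 (volume : Measure (RN N))] with x hx h0
    rw [h0]
    have hV := (V.pos (ε • x)).ne'
    rw [Pi.zero_apply] at hx ⊢
    exact mul_self_eq_zero.mp ((mul_eq_zero.mp hx).resolve_left hV)
  exact Subtype.ext (Subtype.ext h6)

/-- `(·,·)_ε` is a scalar product. -/
@[reducible] def W.core : InnerProductSpace.Core ℝ (W s V ε) where
  inner u v := W.scalar u v
  conj_inner_symm u v := W.scalar_comm v u
  re_inner_nonneg u := W.scalar_self_nonneg u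
  add_left u v w := W.scalar_add_left u v w
  smul_left u v c := W.scalar_smul_left c u v
  definite u hu := W.eq_zero_of_scalar_self u hu

instance : NormedAddCommGroup (W s V ε) := W.core.toNormedAddCommGroup

instance : InnerProductSpace ℝ (W s V ε) := InnerProductSpace.ofCore W.core.toCore

theorem W.inner_eq (u v : W s V ε) : inner ℝ u v = W.scalar u v := rfl

end WSpace

/-- The primitive `F(t) = ∫₀ᵗ f(τ) dτ`. -/
def primitive (f : ℝ → ℝ) (t : ℝ) : ℝ := ∫ τ in (0 : ℝ)..t, f τ

/-- `φ_{ε,u} = ε^{α-θ} |·|^{α-N} ⋆ u²`, the solution in the homogeneous Sobolev space of order `α/2`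
of `(-Δ)^{α/2} φ = ε^{α-θ} γ_α u²`, by its Riesz kernel. -/
def poissonPotential {N : ℕ} (α θ ε : ℝ) (u : RN N → ℝ) (x : RN N) : ℝ :=
  ε ^ (α - θ) * ∫ y, u y ^ 2 / ‖x - y‖ ^ ((N : ℝ) - α)

/-- The functional `I_ε` on `W_ε`. -/
def energy {N : ℕ} {s : ℝ} {V : Potential N} {ε : ℝ} (α θ : ℝ) (f : ℝ → ℝ) (u : W s V ε) : ℝ :=
  1 / 2 * (∫ x, fracLap s (W.toHs u) x ^ 2) + 1 / 2 * (∫ x, V (ε • x) * u.fn x ^ 2)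
    + 1 / 4 * (∫ x, poissonPotential α θ ε u.fn x * u.fn x ^ 2) - ∫ x, primitive f (u.fn x)

/-- The functional `E_μ` on `H^s(ℝ^N)` of the autonomous problem `(-Δ)^s u + μ u = f(u)`. -/
def limitEnergy {N : ℕ} {s : ℝ} (f : ℝ → ℝ) (μ : ℝ) (u : Hs N s) : ℝ :=
  1 / 2 * (∫ x, fracLap s u x ^ 2) + μ / 2 * (∫ x, (u : L2 N) x ^ 2)
    - ∫ x, primitive f ((u : L2 N) x)

/-- The Nehari manifold `M_μ` of `E_μ`. -/
def limitNehari (N : ℕ) (s : ℝ) (f : ℝ → ℝ) (μ : ℝ) : Set (Hs N s) :=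
  {u | u ≠ 0 ∧ (∫ x, fracLap s u x ^ 2) + μ * (∫ x, (u : L2 N) x ^ 2) =
    ∫ x, f ((u : L2 N) x) * (u : L2 N) x}

/-- The ground state level `m^∞_μ = inf_{M_μ} E_μ`, as an infimum in the extended reals. -/
def limitGroundLevel (N : ℕ) (s : ℝ) (f : ℝ → ℝ) (μ : ℝ) : EReal :=
  ⨅ u ∈ limitNehari N s f μ, ((limitEnergy f μ u : ℝ) : EReal)

/-- `J` is a `C¹` functional that satisfies the Palais–Smale condition at the level `c`. -/
def PalaisSmaleAt {X : Type*} [NormedAddCommGroup X] [NormedSpace ℝ X] (J : X → ℝ) (c : ℝ) :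
    Prop :=
  ContDiff ℝ 1 J ∧
    ∀ u : ℕ → X, Tendsto (fun n => J (u n)) atTop (𝓝 c) →
      Tendsto (fun n => fderiv ℝ J (u n)) atTop (𝓝 0) →
      ∃ (w : X) (k : ℕ → ℕ), StrictMono k ∧ Tendsto (fun n => u (k n)) atTop (𝓝 w)

end FracSchrodingerPoisson

end

/-! Write a Palais–Smale sequence as `y n = v n + w`, with `w` a weak limit. The proof neither shows
that `w` is critical nor uses an exact Brezis–Lieb splitting: two one-sided inequalities for `v n`
suffice, and positivity discards everything that involves `w`.

Boundedness. The nonlocal term is quartic, so it cancels in `I(u) - I'(u)u/4`, which equals `‖u‖²/4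
+ ∫ gap f u`, with `gap f t = f(t)t/4 - F(t) ≥ 0` because `K > 4` (`W.energy_sub_fderiv`). Hence the
sequence is bounded, a subsequence converges weakly, and `v n` tends to zero in `L²` of every ball
(`W.tendsto_setIntegral_ball_sq`).

The two inequalities (`W.palaisSmaleAt_of_null`). Testing `I'(y n)` with `v n` gives `‖v n‖² ≤ ∫ f(v
n) v n + o(1)`: mixed terms containing the fixed `w` vanish, and the surviving nonlocal term is a
square of the right sign. The identity for `I - I'/4` gives `‖v n‖²/4 + ∫ gap f (v n) ≤ c + o(1)`.
It remains to deduce `v n → 0`.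

If `V` tends to infinity, the weight makes `v n` small in `L²` outside large balls, so `v n → 0` in
`L²`, then `∫ f(v n) v n → 0` and `‖v n‖ → 0`. If the limit inferior is a finite `μ`, then `μ ∫ (v
n)² ≤ ∫ V(εx) (v n)² + o(1)`. Were `‖v n‖` not to tend to zero, some `(1 + τ) v n` with small `τ`
would lie on or inside the Nehari manifold of `E_μ`, since the left side of the Nehari identity
scales like the square and `∫ f(u)u` at least like the fourth power. Shrinking it onto the manifold
only lowers the quantity `Q/4 + ∫ gap f`, `Q` being the quadratic form of `E_μ`; so `m^∞_μ` would be
at most `c` plus an error below the available room, a contradiction (`W.limitGroundLevel_le`,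
`W.tendsto_zero_of_lt_limitGroundLevel`).

The analytic tools come from cutting frequencies at a level `Λ`: the low part is a bounded
functional at each point, the high part is `O(Λ^{-s})` in `L²`. This yields both the subcritical
Sobolev embedding and the Rellich theorem. The nonlocal energy is the squared norm of a bounded
bilinear map into `L²(ℝ^N × ℝ^N)`; its bound needs only the `L²` and `L⁴` norms, and `L⁴` is
subcritical because the monotonicity of `f(t)/t³` forces `q > 3`. -/

namespace FracSchrodingerPoisson

/-! ### Functions of intermediate growth and their increments. -/

/-- `h` is continuous, `o(|t|^a)` at zero and `o(|t|^b)` at infinity. -/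
structure IsIntermediate (a b : ℝ) (h : ℝ → ℝ) : Prop where
  continuous : Continuous h
  zero : ∀ η > 0, ∃ δ > 0, ∀ t, |t| ≤ δ → |h t| ≤ η * |t| ^ a
  infty : ∀ η > 0, ∃ A, ∀ t, A ≤ |t| → |h t| ≤ η * |t| ^ b

theorem rpow_abs_add_le {a : ℝ} (ha : 0 ≤ a) (x y : ℝ) :
    |x + y| ^ a ≤ 2 ^ a * (|x| ^ a + |y| ^ a) := by
  have hx := rpow_nonneg (abs_nonneg x) a
  have hy := rpow_nonneg (abs_nonneg y) a
  have h2 : (0 : ℝ) ≤ 2 ^ a := rpow_nonneg zero_le_two a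
  have key : |x + y| ≤ 2 * max |x| |y| := by
    have := abs_add_le x y
    have := le_max_left |x| |y|
    have := le_max_right |x| |y|
    linarith
  calc |x + y| ^ a ≤ (2 * max |x| |y|) ^ a := rpow_le_rpow (abs_nonneg _) key ha
    _ = 2 ^ a * (max |x| |y|) ^ a := mul_rpow zero_le_two (le_max_of_le_left (abs_nonneg _))
    _ ≤ 2 ^ a * (|x| ^ a + |y| ^ a) := by
      refine mul_le_mul_of_nonneg_left ?_ h2
      rcases max_cases |x| |y| with ⟨h, _⟩ | ⟨h, _⟩ <;> rw [h] <;> linarith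

namespace IsIntermediate

variable {a b : ℝ} {h : ℝ → ℝ}

/-- Away from zero `|t|^b` is bounded below, so a large constant absorbs the compact middle range;
only the behaviour at zero decides the small coefficient of `|t|^a`. -/
theorem bound (hh : IsIntermediate a b h) (hb : 0 ≤ b) {η : ℝ} (hη : 0 < η) :
    ∃ C, 0 ≤ C ∧ ∀ t, |h t| ≤ η * |t| ^ a + C * |t| ^ b := by
  obtain ⟨δ, hδ, h0⟩ := hh.zero η hη
  obtain ⟨A, hA⟩ := hh.infty η hη
  obtain ⟨B, hB⟩ := (isCompact_Icc (a := -A) (b := A)).exists_bound_of_continuousOn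
    hh.continuous.continuousOn
  have hδb : 0 < δ ^ b := rpow_pos_of_pos hδ b
  refine ⟨max η (|B| / δ ^ b), le_max_of_le_left hη.le, fun t => ?_⟩
  have hta := rpow_nonneg (abs_nonneg t) a
  have htb := rpow_nonneg (abs_nonneg t) b
  have hC1 : η ≤ max η (|B| / δ ^ b) := le_max_left _ _
  have hC2 : |B| / δ ^ b ≤ max η (|B| / δ ^ b) := le_max_right _ _
  rcases le_total |t| δ with h1 | h1
  · have := h0 t h1
    have : 0 ≤ max η (|B| / δ ^ b) * |t| ^ b := mul_nonneg (hη.le.trans hC1) htb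
    linarith
  · rcases le_total A |t| with h2 | h2
    · have := hA t h2
      have := mul_le_mul_of_nonneg_right hC1 htb
      have : 0 ≤ η * |t| ^ a := by positivity
      linarith
    · have h3 := hB t (abs_le.mp h2)
      rw [Real.norm_eq_abs] at h3
      have h4 : δ ^ b ≤ |t| ^ b := rpow_le_rpow hδ.le h1 hb
      have h5 : |B| ≤ |B| / δ ^ b * |t| ^ b := by
        rw [div_mul_eq_mul_div, le_div_iff₀ hδb]
        exact mul_le_mul_of_nonneg_left h4 (abs_nonneg B)
      have := mul_le_mul_of_nonneg_right hC2 htb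
      have : 0 ≤ η * |t| ^ a := by positivity
      have := le_abs_self B
      linarith

/-- Uniform control of the increments of `h` by a small multiple of the size of the base point
and a large multiple of the size of the increment. -/
theorem increment (hh : IsIntermediate a b h) (ha : 0 ≤ a) (hb : 0 ≤ b) {η : ℝ} (hη : 0 < η) :
    ∃ C, 0 ≤ C ∧ ∀ x y, |h (x + y) - h x| ≤
      η * (|x| ^ a + |x| ^ b) + C * (|y| ^ a + |y| ^ b) := by
  set ω : ℝ → ℝ := fun t => |t| ^ a + |t| ^ b with hω
  have hω0 : ∀ t, 0 ≤ ω t := fun t => by positivity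
  set c : ℝ := 2 ^ a + 2 ^ b with hc
  have hc0 : 0 < c := by positivity
  have hωadd : ∀ x y, ω (x + y) ≤ c * (ω x + ω y) := fun x y => by
    have h1 := rpow_abs_add_le ha x y
    have h2 := rpow_abs_add_le hb x y
    have h3 : (0 : ℝ) ≤ 2 ^ a * (|x| ^ b + |y| ^ b) := by positivity
    have h4 : (0 : ℝ) ≤ 2 ^ b * (|x| ^ a + |y| ^ a) := by positivity
    simp only [hω, hc]
    linarith
  have hωmono : ∀ {r t : ℝ}, 0 ≤ r → r ≤ |t| → ω r ≤ ω t := fun {r t} hr hrt => by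
    simp only [hω, abs_of_nonneg hr]
    exact add_le_add (rpow_le_rpow hr hrt ha) (rpow_le_rpow hr hrt hb)
  have hωpos : ∀ {r : ℝ}, 0 < r → 0 < ω r := fun {r} hr => by
    have : 0 < |r| := abs_pos.mpr hr.ne'
    positivity
  -- The two terms `h (x + y)` and `h x` together cost `η' * (c + 1)` times `ω x`, with `c` the
  -- quasi-additivity constant of `ω`.
  set η' : ℝ := η / (c + 1) with hη'
  have hη'0 : 0 < η' := by positivity
  have hη'e : η' * (c + 1) = η := by rw [hη']; field_simp
  obtain ⟨δ, hδ, h0⟩ := hh.zero η' hη'0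
  obtain ⟨A₀, hA₀⟩ := hh.infty η' hη'0
  set A := max A₀ 0 with hA
  have hgood : ∀ t, (|t| ≤ δ ∨ A ≤ |t|) → |h t| ≤ η' * ω t := by
    rintro t (ht | ht)
    · refine (h0 t ht).trans (mul_le_mul_of_nonneg_left ?_ hη'0.le)
      have : 0 ≤ |t| ^ b := by positivity
      simp only [hω]; linarith
    · refine (hA₀ t ((le_max_left _ _).trans ht)).trans (mul_le_mul_of_nonneg_left ?_ hη'0.le)
      have : 0 ≤ |t| ^ a := by positivity
      simp only [hω]; linarith
  obtain ⟨B, hB⟩ := (isCompact_Icc (a := -A) (b := A)).exists_bound_of_continuousOn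
    hh.continuous.continuousOn
  have hB0 : ∀ t, |h t| ≤ η' * ω t + |B| := fun t => by
    by_cases ht : |t| ≤ δ ∨ A ≤ |t|
    · have := hgood t ht
      have := abs_nonneg B
      linarith
    · push Not at ht
      have h3 := hB t (abs_le.mp ht.2.le)
      rw [Real.norm_eq_abs] at h3
      have := le_abs_self B
      have := mul_nonneg hη'0.le (hω0 t)
      linarith
  have huc := (isCompact_Icc (a := -(A + 1)) (b := A + 1)).uniformContinuousOn_of_continuous
    hh.continuous.continuousOn
  rw [Metric.uniformContinuousOn_iff] at huc
  obtain ⟨τ₀, hτ₀, hτ⟩ := huc (η * ω (δ / 2)) (mul_pos hη (hωpos (half_pos hδ)))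
  set τ := min τ₀ (min (δ / 2) 1) with hτdef
  have hτpos : 0 < τ := lt_min hτ₀ (lt_min (half_pos hδ) one_pos)
  have hωτ := hωpos hτpos
  refine ⟨η + 2 * |B| / ω τ, by positivity, fun x y => ?_⟩
  have htri : |h (x + y) - h x| ≤ |h (x + y)| + |h x| := abs_sub _ _
  have hωy : 0 ≤ 2 * |B| / ω τ * ω y := by have := hω0 y; positivity
  have hcomb : η' * ω (x + y) + η' * ω x ≤ η * ω x + η * ω y := by
    have h1 := mul_le_mul_of_nonneg_left (hωadd x y) hη'0.le
    have h2 := mul_nonneg hη'0.le (hω0 y)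
    rw [← hη'e]
    nlinarith
  change |h (x + y) - h x| ≤ η * ω x + (η + 2 * |B| / ω τ) * ω y
  -- For small `y`, either both points lie where `h` is already controlled by `ω`, or `δ / 2 ≤ |x|`
  -- and both lie in a fixed compact interval, where uniform continuity gives an increment below `η
  -- * ω (δ / 2) ≤ η * ω x`. For `τ ≤ |y|` the crude bound `2 * |B|` is paid by `ω y ≥ ω τ`.
  by_cases hy : |y| < τ
  · by_cases hx : (|x| ≤ δ ∨ A ≤ |x|) ∧ (|x + y| ≤ δ ∨ A ≤ |x + y|)
    · have h1 := hgood _ hx.1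
      have h2 := hgood _ hx.2
      linarith
    · have hy1 : |y| < τ₀ := hy.trans_le (min_le_left _ _)
      have hy2 : |y| < δ / 2 := hy.trans_le ((min_le_right _ _).trans (min_le_left _ _))
      have hy3 : |y| < 1 := hy.trans_le ((min_le_right _ _).trans (min_le_right _ _))
      have t1 : |x + y| ≤ |x| + |y| := abs_add_le x y
      have t2 : |x| ≤ |x + y| + |y| := by
        have := abs_sub (x + y) y
        rwa [add_sub_cancel_right] at this
      have hmem : |x| ≤ A + 1 ∧ |x + y| ≤ A + 1 ∧ δ / 2 ≤ |x| := by
        by_cases h1 : |x| ≤ δ ∨ A ≤ |x|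
        · have h2 : ¬ (|x + y| ≤ δ ∨ A ≤ |x + y|) := fun h2 => hx ⟨h1, h2⟩
          push Not at h2
          refine ⟨?_, ?_, ?_⟩ <;> linarith [h2.1, h2.2]
        · push Not at h1
          refine ⟨?_, ?_, ?_⟩ <;> linarith [h1.1, h1.2]
      have h3 := hτ (x + y) (abs_le.mp hmem.2.1) x (abs_le.mp hmem.1) (by
        rw [Real.dist_eq, add_sub_cancel_left]; exact hy1)
      rw [Real.dist_eq] at h3
      have h4 : η * ω (δ / 2) ≤ η * ω x :=
        mul_le_mul_of_nonneg_left (hωmono (half_pos hδ).le hmem.2.2) hη.le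
      have h5 := mul_nonneg hη.le (hω0 y)
      linarith
  · push Not at hy
    have h1 := hB0 x
    have h2 := hB0 (x + y)
    have h3 : 2 * |B| ≤ 2 * |B| / ω τ * ω y := by
      rw [div_mul_eq_mul_div, le_div_iff₀ hωτ]
      exact mul_le_mul_of_nonneg_left (hωmono hτpos.le hy) (by positivity)
    linarith

theorem of_abs_le {g : ℝ → ℝ} (hh : IsIntermediate a b h) (hg : Continuous g)
    (hle : ∀ t, |g t| ≤ |h t|) : IsIntermediate a b g where
  continuous := hg
  zero η hη := by
    obtain ⟨δ, hδ, h0⟩ := hh.zero η hη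
    exact ⟨δ, hδ, fun t ht => (hle t).trans (h0 t ht)⟩
  infty η hη := by
    obtain ⟨A, h0⟩ := hh.infty η hη
    exact ⟨A, fun t ht => (hle t).trans (h0 t ht)⟩

theorem mul_id (hh : IsIntermediate a b h) (ha : 0 ≤ a) (hb : 0 ≤ b) :
    IsIntermediate (a + 1) (b + 1) (fun t => h t * t) where
  continuous := hh.continuous.mul continuous_id
  zero η hη := by
    obtain ⟨δ, hδ, h0⟩ := hh.zero η hη
    refine ⟨δ, hδ, fun t ht => ?_⟩
    rw [abs_mul, rpow_add_of_nonneg (abs_nonneg t) ha zero_le_one, rpow_one, ← mul_assoc]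
    exact mul_le_mul_of_nonneg_right (h0 t ht) (abs_nonneg t)
  infty η hη := by
    obtain ⟨A, h0⟩ := hh.infty η hη
    refine ⟨A, fun t ht => ?_⟩
    rw [abs_mul, rpow_add_of_nonneg (abs_nonneg t) hb zero_le_one, rpow_one, ← mul_assoc]
    exact mul_le_mul_of_nonneg_right (h0 t ht) (abs_nonneg t)

end IsIntermediate

/-! ### Consequences of the hypotheses on the nonlinearity. -/

/-- The properties of the nonlinearity `f` that are used below, with growth exponent `q`. -/
structure IsAdmissible (f : ℝ → ℝ) (q : ℝ) : Prop where
  intermediate : IsIntermediate 1 q f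
  eq_zero : ∀ t ≤ 0, f t = 0
  primitive_nonneg : ∀ t, 0 ≤ primitive f t
  primitive_le : ∀ t, primitive f t ≤ f t * t / 4
  mono : ∀ r t, 0 < r → r ≤ t → f r * t ^ 3 ≤ f t * r ^ 3

theorem primitive_of_nonpos {f : ℝ → ℝ} (hf : ∀ t ≤ 0, f t = 0) {t : ℝ} (ht : t ≤ 0) :
    primitive f t = 0 := by
  rw [primitive, intervalIntegral.integral_symm, neg_eq_zero]
  refine (intervalIntegral.integral_congr (g := fun _ => (0 : ℝ)) fun x hx => ?_).trans (by simp)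
  rw [uIcc_of_le ht] at hx
  exact hf x hx.2

theorem hasDerivAt_primitive {f : ℝ → ℝ} (hf : Continuous f) (t : ℝ) :
    HasDerivAt (primitive f) (f t) t :=
  intervalIntegral.integral_hasDerivAt_right (hf.intervalIntegrable _ _)
    hf.stronglyMeasurable.stronglyMeasurableAtFilter hf.continuousAt

/-- The bound on the primitive comes from `K > 4` and positivity. For `3 < q`: monotonicity gives `f
t ≥ f 1 * t ^ 3` for `t ≥ 1`, which is incompatible with `f t = o(t ^ q)` when `q ≤ 3`. -/
theorem isAdmissible_of_hypotheses {f : ℝ → ℝ} {q : ℝ} (hf1 : ContDiff ℝ 1 f)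
    (hf1' : ∀ t ≤ 0, f t = 0) (hf2 : Tendsto (fun t => f t / t) (𝓝[≠] 0) (𝓝 0))
    (hf3 : Tendsto (fun t : ℝ => f t / t ^ q) atTop (𝓝 0))
    (hf4 : ∃ K > (4 : ℝ), ∀ t > 0, 0 < K * primitive f t ∧ K * primitive f t ≤ t * f t)
    (hf5 : StrictMonoOn (fun t => f t / t ^ 3) (Ioi 0)) : IsAdmissible f q ∧ 3 < q := by
  obtain ⟨K, hK, hf4⟩ := hf4
  have hpos : ∀ t > 0, 0 < f t := fun t ht =>
    pos_of_mul_pos_right ((hf4 t ht).1.trans_le (hf4 t ht).2) ht.le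
  have hprim : ∀ t, 0 ≤ primitive f t ∧ primitive f t ≤ f t * t / 4 := fun t => by
    rcases le_or_gt t 0 with h | h
    · rw [primitive_of_nonpos hf1' h, hf1' t h]; simp
    · obtain ⟨h1, h2⟩ := hf4 t h
      have h3 : 0 < primitive f t := pos_of_mul_pos_right h1 (by linarith)
      refine ⟨h3.le, ?_⟩
      nlinarith
  have hmono : ∀ r t, 0 < r → r ≤ t → f r * t ^ 3 ≤ f t * r ^ 3 := fun r t hr hrt => by
    have ht := hr.trans_le hrt
    have := hf5.monotoneOn (mem_Ioi.mpr hr) (mem_Ioi.mpr ht) hrt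
    rwa [div_le_div_iff₀ (by positivity) (by positivity)] at this
  refine ⟨⟨⟨hf1.continuous, fun η hη => ?_, fun η hη => ?_⟩, hf1',
    fun t => (hprim t).1, fun t => (hprim t).2, hmono⟩, ?_⟩
  · have := Metric.tendsto_nhdsWithin_nhds.mp hf2 η hη
    obtain ⟨δ, hδ, h⟩ := this
    refine ⟨δ / 2, half_pos hδ, fun t ht => ?_⟩
    rw [rpow_one]
    rcases eq_or_ne t 0 with rfl | ht0
    · simp [hf1' 0 le_rfl]
    · have h1 := h (x := t) ht0 (by rw [Real.dist_eq, sub_zero]; linarith)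
      rw [Real.dist_eq, sub_zero, abs_div, div_lt_iff₀ (abs_pos.mpr ht0)] at h1
      exact h1.le
  · have h1 := Metric.tendsto_nhds.mp hf3 η hη
    obtain ⟨A, hA⟩ := eventually_atTop.mp (h1.and (eventually_gt_atTop 0))
    refine ⟨A, fun t ht => ?_⟩
    rcases le_or_gt t 0 with h | h
    · rw [hf1' t h, abs_zero]; positivity
    · rw [abs_of_pos h] at ht ⊢
      have h2 := (hA t ht).1
      rw [Real.dist_eq, sub_zero, abs_div, abs_of_pos (rpow_pos_of_pos h q),
        div_lt_iff₀ (rpow_pos_of_pos h q)] at h2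
      exact h2.le
  · by_contra hq3
    push Not at hq3
    have h1 := hf3.eventually (gt_mem_nhds (hpos 1 one_pos))
    obtain ⟨t, ht, ht1⟩ := (h1.and (eventually_ge_atTop 1)).exists
    have ht0 : 0 < t := by linarith
    rw [div_lt_iff₀ (rpow_pos_of_pos ht0 q)] at ht
    have h2 := hmono 1 t one_pos ht1
    have h3 : t ^ q ≤ t ^ (3 : ℝ) := rpow_le_rpow_of_exponent_le ht1 hq3
    rw [show (3 : ℝ) = ((3 : ℕ) : ℝ) by norm_num, rpow_natCast] at h3
    have := mul_le_mul_of_nonneg_left h3 (hpos 1 one_pos).le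
    linarith

/-- The function `f(t) t / 4 - F(t)`. -/
noncomputable def gap (f : ℝ → ℝ) (t : ℝ) : ℝ := f t * t / 4 - primitive f t

namespace IsAdmissible

variable {f : ℝ → ℝ} {q : ℝ}

theorem continuous_primitive (hf : IsAdmissible f q) : Continuous (primitive f) :=
  continuous_iff_continuousAt.mpr fun t =>
    (hasDerivAt_primitive hf.intermediate.continuous t).continuousAt

theorem mul_nonneg (hf : IsAdmissible f q) (t : ℝ) : 0 ≤ f t * t := by
  have := hf.primitive_nonneg t
  have := hf.primitive_le t
  linarith

theorem gap_nonneg (hf : IsAdmissible f q) (t : ℝ) : 0 ≤ gap f t := by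
  have := hf.primitive_le t
  rw [gap]; linarith

theorem gap_le (hf : IsAdmissible f q) (t : ℝ) : gap f t ≤ f t * t := by
  have := hf.primitive_nonneg t
  have := hf.mul_nonneg t
  rw [gap]; linarith

theorem intermediate_mul (hf : IsAdmissible f q) (hq : 0 ≤ q) :
    IsIntermediate 2 (q + 1) (fun t => f t * t) := by
  have := hf.intermediate.mul_id zero_le_one hq
  rwa [show (1 : ℝ) + 1 = 2 by norm_num] at this

theorem intermediate_primitive (hf : IsAdmissible f q) (hq : 0 ≤ q) :
    IsIntermediate 2 (q + 1) (primitive f) := by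
  refine (hf.intermediate_mul hq).of_abs_le hf.continuous_primitive fun t => ?_
  have h1 := hf.primitive_nonneg t
  have h2 := hf.primitive_le t
  have h3 := hf.mul_nonneg t
  rw [abs_of_nonneg h1, abs_of_nonneg h3]
  linarith

theorem intermediate_gap (hf : IsAdmissible f q) (hq : 0 ≤ q) :
    IsIntermediate 2 (q + 1) (gap f) := by
  refine (hf.intermediate_mul hq).of_abs_le ?_ fun t => ?_
  · exact ((hf.intermediate.continuous.mul continuous_id).div_const 4).sub hf.continuous_primitive
  · rw [abs_of_nonneg (hf.gap_nonneg t), abs_of_nonneg (hf.mul_nonneg t)]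
    exact hf.gap_le t

/-- Formally `4 * gap' = f' t - 3 f ≥ 0`, which is the monotonicity of `f(t)/t³`. Without
derivatives: compare `f` on `[ρ, t]` with the cubic through the value at `t`, whose own gap vanishes
identically. -/
theorem gap_mul_le (hf : IsAdmissible f q) {r : ℝ} (hr0 : 0 < r) (hr1 : r ≤ 1) (t : ℝ) :
    gap f (r * t) ≤ gap f t := by
  rcases le_or_gt t 0 with ht | ht
  · have h1 : r * t ≤ 0 := mul_nonpos_of_nonneg_of_nonpos hr0.le ht
    simp [gap, primitive_of_nonpos hf.eq_zero h1, primitive_of_nonpos hf.eq_zero ht,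
      hf.eq_zero _ h1, hf.eq_zero _ ht]
  · set ρ := r * t with hρ
    have hρ0 : 0 < ρ := by positivity
    have hρt : ρ ≤ t := by nlinarith
    have hcont := hf.intermediate.continuous
    have h1 : primitive f t = primitive f ρ + ∫ τ in ρ..t, f τ :=
      (intervalIntegral.integral_add_adjacent_intervals (hcont.intervalIntegrable _ _)
        (hcont.intervalIntegrable _ _)).symm
    have h2 : ∫ τ in ρ..t, f τ ≤ ∫ τ in ρ..t, f t / t ^ 3 * τ ^ 3 := by
      refine intervalIntegral.integral_mono_on hρt (hcont.intervalIntegrable _ _)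
        (Continuous.intervalIntegrable (by fun_prop) _ _) fun x hx => ?_
      have := hf.mono x t (hρ0.trans_le hx.1) hx.2
      rw [div_mul_eq_mul_div, le_div_iff₀ (by positivity)]
      exact this
    rw [intervalIntegral.integral_const_mul, integral_pow] at h2
    have h3 := hf.mono ρ t hρ0 hρt
    have h4 : f ρ * ρ ≤ f t / t ^ 3 * ρ ^ 4 := by
      rw [div_mul_eq_mul_div, le_div_iff₀ (by positivity)]
      nlinarith
    have h5 : f t / t ^ 3 * t ^ 4 = f t * t := by field_simp
    simp only [gap]
    norm_num at h2
    nlinarith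

/-- Fourth-power growth beats the quadratic growth of the norm, so that a slight dilation turns an
approximate Nehari inequality into an exact one. -/
theorem mul_four_le (hf : IsAdmissible f q) {r : ℝ} (hr : 1 ≤ r) (t : ℝ) :
    r ^ 4 * (f t * t) ≤ f (r * t) * (r * t) := by
  rcases le_or_gt t 0 with ht | ht
  · rw [hf.eq_zero t ht, hf.eq_zero _ (mul_nonpos_of_nonneg_of_nonpos (by linarith) ht)]
    simp
  · have h1 := hf.mono t (r * t) ht (by nlinarith)
    have h2 : (f t * r ^ 3) * t ^ 3 ≤ f (r * t) * t ^ 3 := by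
      calc _ = f t * (r * t) ^ 3 := by ring
        _ ≤ _ := h1
    have h3 := le_of_mul_le_mul_right h2 (by positivity)
    have : 0 ≤ r * t := by positivity
    nlinarith [mul_le_mul_of_nonneg_right h3 this]

end IsAdmissible

/-! ### Fourier analysis in `L²` and the frequency cut-off. -/

/-- Complex-valued `L²(ℝ^N)`. -/
abbrev CL2 (N : ℕ) : Type := Lp ℂ 2 (volume : Measure (RN N))

/-- On `L¹ ∩ L²` the inverse Fourier transform is given by the integral formula. -/
theorem fourierInv_coeFn_of_integrable {N : ℕ} (h : CL2 N) (hi : Integrable h volume) :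
    (𝓕⁻ h : CL2 N) =ᵐ[volume] 𝓕⁻ (h : RN N → ℂ) := by
  have hint : ∀ x, 𝓕⁻ (h : RN N → ℂ) x = ∫ v, Real.fourierChar (inner ℝ v x) • h v :=
    fun x => Real.fourierInv_eq _ _
  have hcont : Continuous (𝓕⁻ (h : RN N → ℂ)) := by
    have : 𝓕⁻ (h : RN N → ℂ) = (𝓕 (h : RN N → ℂ)) ∘ fun x => -x := by
      ext x; rw [Real.fourierInv_eq_fourier_neg]; rfl
    rw [this]
    exact (VectorFourier.fourierIntegral_continuous Real.continuous_fourierChar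
      continuous_inner hi).comp continuous_neg
  -- Both sides are compared on smooth compactly supported test functions: the `L²` transform is
  -- known there as a tempered distribution, the integral formula by Fubini.
  apply ae_eq_of_integral_contDiff_smul_eq ((Lp.memLp _).locallyIntegrable (by norm_num))
    hcont.locallyIntegrable
  intro g g_smooth g_cpt
  have hg₁ : HasCompactSupport (Complex.ofRealCLM ∘ g) := g_cpt.comp_left rfl
  have hg₂ : ContDiff ℝ ((⊤ : ℕ∞) : WithTop ℕ∞) (Complex.ofRealCLM ∘ g) := by fun_prop
  set G : SchwartzMap (RN N) ℂ := hg₁.toSchwartzMap hg₂ with hG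
  have hGi : Integrable (G : RN N → ℂ) volume := G.integrable
  have h1 : (Lp.toTemperedDistribution (𝓕⁻ h : CL2 N)) G = ∫ x, g x • (𝓕⁻ h : CL2 N) x := by
    rw [Lp.toTemperedDistribution_apply]
    simp [hG]
  have h2 : (Lp.toTemperedDistribution (𝓕⁻ h : CL2 N)) G = ∫ x, (𝓕⁻ G) x • h x := by
    rw [← Lp.fourierInv_toTemperedDistribution_eq, TemperedDistribution.fourierInv_apply,
      Lp.toTemperedDistribution_apply]
  rw [← h1, h2]
  have h3 := VectorFourier.integral_fourierIntegral_smul_eq_flip (L := -innerₗ (RN N))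
      (μ := volume) (ν := volume) (f := (G : RN N → ℂ)) (g := (h : RN N → ℂ))
      Real.continuous_fourierChar (by exact continuous_inner.neg) hGi hi
  have h4 : ∀ x, (𝓕⁻ G) x = VectorFourier.fourierIntegral Real.fourierChar volume
      (-innerₗ (RN N)) (G : RN N → ℂ) x := fun x => by
    rw [SchwartzMap.fourierInv_coe, Real.fourierInv_eq]
    simp [VectorFourier.fourierIntegral]
  have h5 : ∀ x, 𝓕⁻ (h : RN N → ℂ) x = VectorFourier.fourierIntegral Real.fourierChar volume
      (-innerₗ (RN N)).flip (h : RN N → ℂ) x := fun x => by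
    rw [Real.fourierInv_eq]
    simp [VectorFourier.fourierIntegral, real_inner_comm]
  simp only [h4, h5]
  rw [h3]
  simp [hG]

theorem nontrivial_RN {N : ℕ} (hN : 0 < N) : Nontrivial (RN N) := by
  have : Nonempty (Fin N) := ⟨⟨0, hN⟩⟩
  infer_instance

theorem integrableOn_ball_norm_rpow {N : ℕ} (hN : 0 < N) {β : ℝ} (hβ : β < N) (R : ℝ) :
    IntegrableOn (fun x : RN N => ‖x‖ ^ (-β)) (Metric.ball 0 R) volume := by
  have := nontrivial_RN hN
  rw [integrableOn_fun_norm_addHaar volume (f := fun y : ℝ => y ^ (-β))]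
  rcases le_or_gt R 0 with hR | hR
  · simp [Ioo_eq_empty (not_lt.mpr hR)]
  have h1 : IntegrableOn (fun y : ℝ => y ^ ((N : ℝ) - 1 - β)) (Ioo 0 R) :=
    (intervalIntegral.integrableOn_Ioo_rpow_iff hR).mpr (by linarith)
  refine h1.congr_fun (fun y hy => ?_) measurableSet_Ioo
  have hdim : Module.finrank ℝ (RN N) = N := by simp
  simp only [hdim, smul_eq_mul]
  rw [← rpow_natCast, ← rpow_add hy.1, Nat.cast_sub hN]
  congr 1
  push_cast
  ring

/-- Polar coordinates. The exact power of `R` produces the factor `Λ ^ ((N - 2 * s) / 2)` in the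
bound of the low frequencies. -/
theorem exists_integral_ball_norm_rpow {N : ℕ} (hN : 0 < N) {β : ℝ} (hβ : β < N) :
    ∃ C, 0 ≤ C ∧ ∀ R > 0, ∫ x in Metric.ball (0 : RN N) R, ‖x‖ ^ (-β) = C * R ^ (N - β) := by
  have := nontrivial_RN hN
  have hNβ : 0 < (N : ℝ) - β := by linarith
  refine ⟨N * (volume.real (Metric.ball (0 : RN N) 1) / (N - β)), by positivity, fun R hR => ?_⟩
  have h := integral_fun_norm_addHaar (volume : Measure (RN N))
    (fun y : ℝ => (Iio R).indicator (fun y : ℝ => y ^ (-β)) y)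
  have hdim : Module.finrank ℝ (RN N) = N := by simp
  have h1 : ∫ x : RN N, (Iio R).indicator (fun y : ℝ => y ^ (-β)) ‖x‖ =
      ∫ x in Metric.ball (0 : RN N) R, ‖x‖ ^ (-β) := by
    rw [← integral_indicator measurableSet_ball]
    refine integral_congr_ae (Eventually.of_forall fun x => ?_)
    simp [indicator]
  have h2 : ∫ y in Ioi (0 : ℝ), y ^ (N - 1) • (Iio R).indicator (fun y : ℝ => y ^ (-β)) y =
      R ^ (N - β) / (N - β) := by
    have h3 : ∀ y ∈ Ioi (0 : ℝ), y ^ (N - 1) • (Iio R).indicator (fun y : ℝ => y ^ (-β)) y =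
        (Iio R).indicator (fun y : ℝ => y ^ ((N : ℝ) - 1 - β)) y := fun y hy => by
      by_cases hyR : y < R
      · simp only [indicator, mem_Iio, hyR, if_true, smul_eq_mul]
        rw [← rpow_natCast, ← rpow_add hy, Nat.cast_sub hN]
        congr 1
        push_cast
        ring
      · simp [indicator, hyR]
    rw [setIntegral_congr_fun measurableSet_Ioi h3, setIntegral_indicator measurableSet_Iio,
      Ioi_inter_Iio, ← integral_Ioc_eq_integral_Ioo, ← intervalIntegral.integral_of_le hR.le,
      integral_rpow (Or.inl (by linarith)), sub_add_eq_add_sub, sub_add_cancel,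
      zero_rpow hNβ.ne', sub_zero]
  rw [h1, hdim, h2] at h
  rw [h]
  simp only [smul_eq_mul, nsmul_eq_mul]
  ring

theorem CL2.norm_sq {N : ℕ} (h : CL2 N) : ‖h‖ ^ 2 = ∫ x, ‖h x‖ ^ 2 := by
  have h1 : ((‖h‖ ^ 2 : ℝ) : ℂ) = inner ℂ h h := by
    rw [inner_self_eq_norm_sq_to_K (𝕜 := ℂ) h]; simp
  have h2 : inner ℂ h h = ((∫ x, ‖h x‖ ^ 2 : ℝ) : ℂ) := by
    rw [L2.inner_def, ← integral_complex_ofReal]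
    refine integral_congr_ae (Eventually.of_forall fun x => ?_)
    simp [inner_self_eq_norm_sq_to_K]
  exact_mod_cast h1.trans h2

theorem L2.norm_sq {N : ℕ} (h : L2 N) : ‖h‖ ^ 2 = ∫ x, h x ^ 2 := by
  rw [← real_inner_self_eq_norm_sq, ← integral_mul_eq_inner]
  simp only [sq]

theorem CL2.integrable_norm_sq {N : ℕ} (h : CL2 N) : Integrable (fun x => ‖h x‖ ^ 2) volume :=
  (memLp_two_iff_integrable_sq_norm (Lp.aestronglyMeasurable h)).mp (Lp.memLp h)

theorem L2.integrable_sq {N : ℕ} (h : L2 N) : Integrable (fun x => h x ^ 2) volume :=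
  (memLp_two_iff_integrable_sq (Lp.aestronglyMeasurable h)).mp (Lp.memLp h)

theorem coeFn_complexify {N : ℕ} (u : L2 N) :
    complexify N u =ᵐ[volume] fun x => ((u x : ℝ) : ℂ) :=
  Complex.ofRealCLM.coeFn_compLpL (p := 2) (μ := (volume : Measure (RN N))) u

theorem norm_complexify {N : ℕ} (u : L2 N) : ‖complexify N u‖ = ‖u‖ := by
  refine le_antisymm ?_ ?_ <;> refine Lp.norm_le_norm_of_ae_le ?_ <;>
  · filter_upwards [coeFn_complexify u] with x hx
    rw [hx, Complex.norm_real]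

/-- The Fourier transform of a real `L²` function. -/
noncomputable def fourierReal {N : ℕ} (u : L2 N) : CL2 N := 𝓕 (complexify N u)

theorem norm_fourierReal {N : ℕ} (u : L2 N) : ‖fourierReal u‖ = ‖u‖ := by
  rw [fourierReal, Lp.norm_fourier_eq, norm_complexify]

theorem fourierReal_fracLap {N : ℕ} {s : ℝ} (u : Hs N s) :
    fourierReal (fracLap s u) =ᵐ[volume]
      fun ξ => (((2 * π * ‖ξ‖) ^ s : ℝ) : ℂ) * fourierReal (u : L2 N) ξ := by
  have := fracLap_spec u
  rwa [IsFracLap, mul_div_cancel₀ s two_ne_zero] at this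

/-- The function `ξ ↦ exp (-2πi⟨ξ,x⟩) w(ξ)` on the ball of radius `Λ`. -/
noncomputable def lowKernelFun {N : ℕ} (w : RN N → ℝ) (Λ : ℝ) (x : RN N) : RN N → ℂ :=
  (Metric.ball 0 Λ).indicator fun ξ => (Real.fourierChar (-inner ℝ ξ x) : ℂ) * (w ξ : ℂ)

theorem norm_lowKernelFun {N : ℕ} (w : RN N → ℝ) (Λ : ℝ) (x ξ : RN N) :
    ‖lowKernelFun w Λ x ξ‖ = (Metric.ball 0 Λ).indicator (fun ξ => |w ξ|) ξ := by
  by_cases h : ξ ∈ Metric.ball (0 : RN N) Λ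
  · simp only [lowKernelFun, indicator_of_mem h, norm_mul, Complex.norm_real, Real.norm_eq_abs]
    rw [Circle.norm_coe, one_mul]
  · simp [lowKernelFun, h]

theorem memLp_lowKernelFun {N : ℕ} {w : RN N → ℝ} (hw : Measurable w) {Λ : ℝ}
    (hi : IntegrableOn (fun ξ => w ξ ^ 2) (Metric.ball 0 Λ) volume) (x : RN N) :
    MemLp (lowKernelFun w Λ x) 2 volume := by
  have hm : Measurable (lowKernelFun w Λ x) := by
    refine Measurable.indicator (Measurable.mul ?_ ?_) measurableSet_ball
    · exact (Continuous.subtype_val (Real.continuous_fourierChar.comp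
        (by fun_prop))).measurable
    · exact Complex.measurable_ofReal.comp hw
  rw [memLp_two_iff_integrable_sq_norm hm.aestronglyMeasurable]
  refine (hi.integrable_indicator measurableSet_ball).congr (Eventually.of_forall fun ξ => ?_)
  simp only [norm_lowKernelFun]
  by_cases h : ξ ∈ Metric.ball (0 : RN N) Λ <;> simp [h]

theorem norm_sq_toLp_lowKernelFun {N : ℕ} {w : RN N → ℝ} (hw : Measurable w) {Λ : ℝ}
    (hi : IntegrableOn (fun ξ => w ξ ^ 2) (Metric.ball 0 Λ) volume) (x : RN N) :
    ‖(memLp_lowKernelFun hw hi x).toLp‖ ^ 2 = ∫ ξ in Metric.ball 0 Λ, w ξ ^ 2 := by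
  rw [CL2.norm_sq, ← integral_indicator measurableSet_ball]
  refine integral_congr_ae ?_
  filter_upwards [(memLp_lowKernelFun hw hi x).coeFn_toLp] with ξ hξ
  rw [hξ, norm_lowKernelFun]
  by_cases h : ξ ∈ Metric.ball (0 : RN N) Λ <;> simp [h]

theorem integrableOn_ball_one {N : ℕ} (Λ : ℝ) :
    IntegrableOn (fun _ : RN N => (1 : ℝ) ^ 2) (Metric.ball 0 Λ) volume := by
  rw [one_pow]
  exact integrableOn_const (measure_ball_lt_top.ne) (by simp)

/-- The kernel `ξ ↦ exp (-2πi⟨ξ,x⟩)` on the ball of radius `Λ`. -/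
noncomputable def lowKernel {N : ℕ} (Λ : ℝ) (x : RN N) : CL2 N :=
  (memLp_lowKernelFun (w := fun _ => 1) measurable_const (integrableOn_ball_one Λ) x).toLp

/-- The part of `u` of frequency below `Λ`, at the point `x`. -/
noncomputable def lowPart {N : ℕ} (Λ : ℝ) (u : L2 N) (x : RN N) : ℂ :=
  inner ℂ (lowKernel Λ x) (fourierReal u)

theorem norm_lowKernel {N : ℕ} (Λ : ℝ) (x : RN N) :
    ‖lowKernel Λ x‖ = ‖lowKernel Λ (0 : RN N)‖ := by
  have h1 : ‖lowKernel Λ x‖ ^ 2 = ‖lowKernel Λ (0 : RN N)‖ ^ 2 := by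
    rw [lowKernel, lowKernel, norm_sq_toLp_lowKernelFun measurable_const (integrableOn_ball_one Λ),
      norm_sq_toLp_lowKernelFun measurable_const (integrableOn_ball_one Λ)]
  exact (sq_eq_sq₀ (norm_nonneg _) (norm_nonneg _)).mp h1

theorem norm_lowPart_le {N : ℕ} (Λ : ℝ) (u : L2 N) (x : RN N) :
    ‖lowPart Λ u x‖ ≤ ‖lowKernel Λ (0 : RN N)‖ * ‖u‖ := by
  rw [← norm_fourierReal u, ← norm_lowKernel Λ x]
  exact norm_inner_le_norm _ _

/-- Cauchy–Schwarz after moving the factor `(2π‖ξ‖)^s` onto `u`; the remaining kernel `(2π‖ξ‖)^(-s)`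
is square integrable on balls because `2 * s < N`. -/
theorem exists_norm_lowPart_le {N : ℕ} (hN : 0 < N) {s : ℝ} (hs : 2 * s < N) :
    ∃ C, 0 ≤ C ∧ ∀ Λ > 0, ∀ (u : Hs N s) (x : RN N),
      ‖lowPart Λ (u : L2 N) x‖ ≤ C * Λ ^ (((N : ℝ) - 2 * s) / 2) * ‖fracLap s u‖ := by
  obtain ⟨C, hC, h⟩ := exists_integral_ball_norm_rpow hN hs
  have hπ : (0 : ℝ) < (2 * π) ^ (-(2 * s)) := by positivity
  refine ⟨√((2 * π) ^ (-(2 * s)) * C), by positivity, fun Λ hΛ u x => ?_⟩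
  set w : RN N → ℝ := fun ξ => (2 * π * ‖ξ‖) ^ (-s) with hw
  have hwm : Measurable w := by
    exact (measurable_norm.const_mul (2 * π)).pow_const (-s)
  have hw2 : ∀ ξ, w ξ ^ 2 = (2 * π) ^ (-(2 * s)) * ‖ξ‖ ^ (-(2 * s)) := fun ξ => by
    rw [hw, ← mul_rpow (by positivity) (norm_nonneg _), ← rpow_natCast,
      ← rpow_mul (by positivity)]
    congr 1
    push_cast
    ring
  have hwi : IntegrableOn (fun ξ => w ξ ^ 2) (Metric.ball 0 Λ) volume := by
    simp only [hw2]
    exact (integrableOn_ball_norm_rpow hN hs Λ).const_mul _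
  set K : CL2 N := (memLp_lowKernelFun hwm hwi x).toLp with hK
  have hKn : ‖K‖ ^ 2 = (2 * π) ^ (-(2 * s)) * C * Λ ^ ((N : ℝ) - 2 * s) := by
    rw [hK, norm_sq_toLp_lowKernelFun hwm hwi]
    simp only [hw2]
    rw [integral_const_mul, h Λ hΛ, mul_assoc]
  have hKn' : ‖K‖ = √((2 * π) ^ (-(2 * s)) * C) * Λ ^ (((N : ℝ) - 2 * s) / 2) := by
    rw [← sqrt_sq (norm_nonneg K), hKn, sqrt_mul (by positivity), sqrt_eq_rpow (Λ ^ _),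
      ← rpow_mul hΛ.le]
    congr 2
    ring
  have := nontrivial_RN hN
  -- The weights `(2π‖ξ‖)^s` and `(2π‖ξ‖)^(-s)` cancel only off the origin, a null set since `N >
  -- 0`.
  have hne : ∀ᵐ ξ : RN N, ξ ≠ 0 := by
    rw [ae_iff]; simp
  have heq : lowPart Λ (u : L2 N) x = inner ℂ K (fourierReal (fracLap s u)) := by
    rw [lowPart, L2.inner_def, L2.inner_def]
    refine integral_congr_ae ?_
    filter_upwards [hne, fourierReal_fracLap u, (memLp_lowKernelFun hwm hwi x).coeFn_toLp,
      (memLp_lowKernelFun (w := fun _ => 1) measurable_const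
        (integrableOn_ball_one Λ) x).coeFn_toLp] with ξ h0 h1 h2 h3
    rw [lowKernel, h1, hK, h2, h3]
    by_cases hξ : ξ ∈ Metric.ball (0 : RN N) Λ
    · have hpos : 0 < 2 * π * ‖ξ‖ := by positivity
      have h4 : (((2 * π * ‖ξ‖) ^ s : ℝ) : ℂ) * (((2 * π * ‖ξ‖) ^ (-s) : ℝ) : ℂ) = 1 := by
        rw [← Complex.ofReal_mul, ← rpow_add hpos]
        simp
      simp only [lowKernelFun, indicator_of_mem hξ, RCLike.inner_apply, map_mul, hw,
        Complex.conj_ofReal]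
      calc _ = (fourierReal (u : L2 N) ξ * (starRingEnd ℂ) (Real.fourierChar (-inner ℝ ξ x) : ℂ)) *
            1 := by simp
        _ = _ := by rw [← h4]; ring
    · simp [lowKernelFun, indicator_of_notMem hξ]
  rw [heq, ← norm_fourierReal (fracLap s u), ← hKn']
  exact norm_inner_le_norm _ _

/-- Decomposition of `u` in a low and a high frequency part. -/
theorem exists_eq_lowPart_add {N : ℕ} {s : ℝ} (hs : 0 ≤ s) {Λ : ℝ} (hΛ : 0 < Λ) (u : Hs N s) :
    ∃ r : CL2 N, ‖r‖ ≤ Λ ^ (-s) * ‖fracLap s u‖ ∧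
      ∀ᵐ x, (((u : L2 N) x : ℝ) : ℂ) = lowPart Λ (u : L2 N) x + r x := by
  set U := fourierReal (u : L2 N) with hU
  have hmem : MemLp ((Metric.ball (0 : RN N) Λ).indicator U) 2 volume :=
    (Lp.memLp U).indicator measurableSet_ball
  set Ul : CL2 N := hmem.toLp with hUl
  -- An `L²` function on a set of finite measure is integrable; this gives the low part a pointwise
  -- formula.
  have hUli : Integrable Ul volume := by
    refine Integrable.congr ?_ hmem.coeFn_toLp.symm
    rw [integrable_indicator_iff measurableSet_ball]
    have : IsFiniteMeasure (volume.restrict (Metric.ball (0 : RN N) Λ)) :=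
      ⟨by rw [Measure.restrict_apply_univ]; exact measure_ball_lt_top⟩
    exact ((Lp.memLp U).restrict _).integrable (by norm_num)
  refine ⟨𝓕⁻ (U - Ul), ?_, ?_⟩
  · have h1 : ‖(𝓕⁻ (U - Ul) : CL2 N)‖ = ‖U - Ul‖ := by
      rw [← Lp.norm_fourier_eq (𝓕⁻ (U - Ul) : CL2 N), FourierTransform.fourier_fourierInv_eq]
    rw [h1, ← norm_fourierReal (fracLap s u), ← abs_of_nonneg (rpow_nonneg hΛ.le (-s)),
      ← Real.norm_eq_abs, ← norm_smul]
    refine Lp.norm_le_norm_of_ae_le ?_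
    filter_upwards [Lp.coeFn_sub U Ul, hmem.coeFn_toLp, fourierReal_fracLap u,
      Lp.coeFn_smul (Λ ^ (-s)) (fourierReal (fracLap s u))] with ξ h1 h2 h3 h4
    rw [h1, h4, Pi.sub_apply, Pi.smul_apply, h2, h3, norm_smul, norm_mul, Complex.norm_real,
      ← mul_assoc]
    by_cases hξ : ξ ∈ Metric.ball (0 : RN N) Λ
    · rw [indicator_of_mem hξ]; simp; positivity
    · rw [indicator_of_notMem hξ, sub_zero]
      -- Off the ball `2π‖ξ‖ ≥ Λ`, so the multiplier `Λ ^ (-s) * (2π‖ξ‖) ^ s` is at least one.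
      refine le_mul_of_one_le_left (norm_nonneg _) ?_
      have hξ' : Λ ≤ ‖ξ‖ := by simpa using hξ
      have hξ2 : Λ ≤ 2 * π * ‖ξ‖ := by nlinarith [Real.pi_gt_three]
      rw [Real.norm_of_nonneg (by positivity), Real.norm_of_nonneg (by positivity),
        rpow_neg hΛ.le, inv_mul_eq_div, one_le_div (by positivity)]
      exact rpow_le_rpow hΛ.le hξ2 hs
  · have h1 : complexify N (u : L2 N) = 𝓕⁻ Ul + 𝓕⁻ (U - Ul) := by
      rw [← FourierTransform.fourierInv_add, add_sub_cancel, hU, fourierReal,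
        FourierTransform.fourierInv_fourier_eq]
    filter_upwards [coeFn_complexify (u : L2 N), Lp.coeFn_add (𝓕⁻ Ul : CL2 N) (𝓕⁻ (U - Ul)),
      fourierInv_coeFn_of_integrable Ul hUli] with x h2 h3 h4
    rw [← h2, h1, h3, Pi.add_apply, h4, Real.fourierInv_eq]
    congr 1
    rw [lowPart, L2.inner_def]
    refine integral_congr_ae ?_
    filter_upwards [hmem.coeFn_toLp, (memLp_lowKernelFun (w := fun _ => 1) measurable_const
        (integrableOn_ball_one Λ) x).coeFn_toLp] with ξ h5 h6
    rw [lowKernel, h6, hUl, h5]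
    by_cases hξ : ξ ∈ Metric.ball (0 : RN N) Λ
    · simp only [lowKernelFun, indicator_of_mem hξ, RCLike.inner_apply, Circle.smul_def,
        smul_eq_mul, Complex.ofReal_one, mul_one]
      rw [AddChar.map_neg_eq_inv, Circle.coe_inv_eq_conj, Complex.conj_conj, mul_comm]
    · simp [lowKernelFun, indicator_of_notMem hξ]

/-! ### The subcritical Sobolev embedding. -/

/-- At each level `t`, choose `Λ` so that the low frequencies stay below `t / 2`. Then `|u| > t`
forces the high part above `t / 2`, and Chebyshev with `‖r‖² ≤ Λ ^ (-2s)` gives the critical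
exponent. -/
theorem exists_weak_type_bound {N : ℕ} (hN : 0 < N) {s : ℝ} (hs0 : 0 < s) (hs : 2 * s < N) :
    ∃ C, 0 ≤ C ∧ ∀ u : Hs N s, ‖fracLap s u‖ ≤ 1 → ∀ t > 0,
      volume {x | t < |(u : L2 N) x|} ≤ ENNReal.ofReal (C * t ^ (-(2 * N / (N - 2 * s)))) := by
  obtain ⟨C, hC, hlow⟩ := exists_norm_lowPart_le hN hs
  have hd : 0 < (N : ℝ) - 2 * s := by linarith
  -- With `Λ ^ ((N - 2 * s) / 2) = t / B` the low part is at most `C * (t / B) ≤ t / 2`; the added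
  -- one keeps `B` positive.
  set B : ℝ := 2 * (C + 1) with hB
  have hB0 : 0 < B := by positivity
  set e : ℝ := 2 / (N - 2 * s) with he
  refine ⟨4 * B ^ (2 * s * e), by positivity, fun u hu t ht => ?_⟩
  set Λ : ℝ := (t / B) ^ e with hΛ
  have hΛ0 : 0 < Λ := by positivity
  obtain ⟨r, hr, hur⟩ := exists_eq_lowPart_add hs0.le hΛ0 u
  have hΛpow : Λ ^ (((N : ℝ) - 2 * s) / 2) = t / B := by
    rw [hΛ, ← rpow_mul (by positivity), he, div_mul_div_comm, mul_comm 2, div_self (by positivity),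
      rpow_one]
  have hl : ∀ x, ‖lowPart Λ (u : L2 N) x‖ ≤ t / 2 := fun x => by
    refine (hlow Λ hΛ0 u x).trans ?_
    rw [hΛpow]
    have h1 : C * (t / B) * ‖fracLap s u‖ ≤ C * (t / B) * 1 :=
      mul_le_mul_of_nonneg_left hu (by positivity)
    have h2 : (C + 1) * (t / B) = t / 2 := by rw [hB]; field_simp
    have h3 : 0 < t / B := by positivity
    nlinarith
  have hr2 : ‖r‖ ^ 2 ≤ Λ ^ (-(2 * s)) := by
    have h1 : ‖r‖ ≤ Λ ^ (-s) :=
      hr.trans (mul_le_of_le_one_right (by positivity) hu)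
    calc ‖r‖ ^ 2 ≤ (Λ ^ (-s)) ^ 2 := pow_le_pow_left₀ (norm_nonneg _) h1 2
      _ = Λ ^ (-(2 * s)) := by
        rw [← rpow_natCast, ← rpow_mul hΛ0.le]; congr 1; push_cast; ring
  have hcheb := mul_meas_ge_le_lintegral₀ (μ := (volume : Measure (RN N)))
    (f := fun x => ENNReal.ofReal (‖r x‖ ^ 2))
    (CL2.integrable_norm_sq r).aestronglyMeasurable.aemeasurable.ennreal_ofReal
    (ENNReal.ofReal (t ^ 2 / 4))
  rw [← ofReal_integral_eq_lintegral_ofReal (CL2.integrable_norm_sq r)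
    (Eventually.of_forall fun x => by positivity), ← CL2.norm_sq] at hcheb
  have hsub : volume {x | t < |(u : L2 N) x|} ≤
      volume {x | ENNReal.ofReal (t ^ 2 / 4) ≤ ENNReal.ofReal (‖r x‖ ^ 2)} := by
    refine measure_mono_ae ?_
    filter_upwards [hur] with x hx hxt
    have h1 : |(u : L2 N) x| ≤ ‖lowPart Λ (u : L2 N) x‖ + ‖r x‖ := by
      rw [← Real.norm_eq_abs, ← Complex.norm_real, hx]
      exact norm_add_le _ _
    have h2 := hl x
    have h3 : t < |(u : L2 N) x| := hxt
    have h4 : t / 2 ≤ ‖r x‖ := by linarith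
    refine ENNReal.ofReal_le_ofReal ?_
    nlinarith
  have ht4 : 0 < t ^ 2 / 4 := by positivity
  have h5 : volume {x | t < |(u : L2 N) x|} ≤ ENNReal.ofReal (Λ ^ (-(2 * s)) / (t ^ 2 / 4)) := by
    rw [ENNReal.ofReal_div_of_pos ht4, ENNReal.le_div_iff_mul_le
      (Or.inl (ENNReal.ofReal_pos.mpr ht4).ne') (Or.inl ENNReal.ofReal_ne_top), mul_comm]
    exact (mul_le_mul_right hsub _).trans (hcheb.trans (ENNReal.ofReal_le_ofReal hr2))
  refine h5.trans_eq (congrArg _ ?_)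
  have h6 : t ^ (-(2 * (N : ℝ) / (N - 2 * s))) = t ^ (-(2 * s * e)) * (t ^ 2)⁻¹ := by
    rw [← rpow_natCast, ← rpow_neg ht.le, ← rpow_add ht, he]
    congr 1
    field_simp
    push_cast
    ring
  rw [h6, hΛ, ← rpow_mul (by positivity), div_rpow ht.le hB0.le,
    show e * -(2 * s) = -(2 * s * e) by ring, rpow_neg hB0.le]
  field_simp

/-- Layer cake formula: levels below one are dominated by the `L²` norm, as `2 ≤ r`; levels above
one by the weak-type bound, whose integral converges as `r` is subcritical. -/
theorem exists_lintegral_rpow_le {N : ℕ} (hN : 0 < N) {s : ℝ} (hs0 : 0 < s) (hs : 2 * s < N)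
    {r : ℝ} (hr2 : 2 ≤ r) (hr : r < 2 * N / (N - 2 * s)) :
    ∃ C, 0 ≤ C ∧ ∀ u : Hs N s, ‖(u : L2 N)‖ ≤ 1 → ‖fracLap s u‖ ≤ 1 →
      ∫⁻ x, ENNReal.ofReal (|(u : L2 N) x| ^ r) ≤ ENNReal.ofReal C := by
  obtain ⟨C, hC, hw⟩ := exists_weak_type_bound hN hs0 hs
  set p : ℝ := 2 * N / (N - 2 * s) with hp
  have hIoi : IntegrableOn (fun t : ℝ => C * t ^ (-p) * t ^ (r - 1)) (Ioi 1) := by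
    have h1 : IntegrableOn (fun t : ℝ => C * t ^ (r - 1 - p)) (Ioi 1) :=
      (integrableOn_Ioi_rpow_of_lt (by linarith) one_pos).const_mul C
    refine h1.congr_fun (fun t ht => ?_) measurableSet_Ioi
    have ht0 : (0 : ℝ) < t := one_pos.trans ht
    simp only
    rw [mul_assoc, ← rpow_add ht0]
    congr 2
    ring
  set I : ℝ := ∫ t in Ioi (1 : ℝ), C * t ^ (-p) * t ^ (r - 1) with hI
  have hI0 : 0 ≤ I := setIntegral_nonneg measurableSet_Ioi fun t ht => by
    have : (0 : ℝ) < t := one_pos.trans ht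
    positivity
  refine ⟨r * (1 + I), by positivity, fun u hu hDu => ?_⟩
  have hm : AEMeasurable (fun x => |(u : L2 N) x|) volume :=
    (Lp.aestronglyMeasurable (u : L2 N)).aemeasurable.norm
  have h0 : 0 ≤ᵐ[volume] fun x => |(u : L2 N) x| := Eventually.of_forall fun x => abs_nonneg _
  have hlc := lintegral_rpow_eq_lintegral_meas_lt_mul volume h0 hm (p := r) (by linarith)
  have hlc2 := lintegral_rpow_eq_lintegral_meas_lt_mul volume h0 hm (p := 2) (by norm_num)
  have hL2 : ∫⁻ x, ENNReal.ofReal (|(u : L2 N) x| ^ (2 : ℝ)) ≤ 1 := by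
    have h1 : ∀ x, |(u : L2 N) x| ^ (2 : ℝ) = (u : L2 N) x ^ 2 := fun x => by
      rw [rpow_two, sq_abs]
    simp only [h1]
    rw [← ofReal_integral_eq_lintegral_ofReal (L2.integrable_sq _)
      (Eventually.of_forall fun x => by positivity), ← L2.norm_sq, ← ENNReal.ofReal_one]
    exact ENNReal.ofReal_le_ofReal (pow_le_one₀ (norm_nonneg _) hu)
  rw [hlc, ENNReal.ofReal_mul (by linarith)]
  refine mul_le_mul_right ?_ _
  rw [← Ioc_union_Ioi_eq_Ioi (zero_le_one (α := ℝ)),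
    lintegral_union measurableSet_Ioi (Ioc_disjoint_Ioi le_rfl),
    ENNReal.ofReal_add zero_le_one hI0]
  refine add_le_add ?_ ?_
  · rw [ENNReal.ofReal_one]
    refine le_trans ?_ hL2
    rw [hlc2]
    have h2 : ∫⁻ t in Ioc (0 : ℝ) 1, volume {x | t < |(u : L2 N) x|} * ENNReal.ofReal (t ^ (r - 1))
        ≤ ∫⁻ t in Ioi (0 : ℝ), volume {x | t < |(u : L2 N) x|} *
          ENNReal.ofReal (t ^ ((2 : ℝ) - 1)) := by
      refine (setLIntegral_mono' measurableSet_Ioc fun t ht => ?_).trans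
        (lintegral_mono_set Ioc_subset_Ioi_self)
      exact mul_le_mul_right (ENNReal.ofReal_le_ofReal
        (rpow_le_rpow_of_exponent_ge ht.1 ht.2 (by linarith))) _
    refine h2.trans ?_
    refine le_mul_of_one_le_left zero_le ?_
    rw [← ENNReal.ofReal_one]
    exact ENNReal.ofReal_le_ofReal (by norm_num)
  · rw [hI, ofReal_integral_eq_lintegral_ofReal hIoi]
    · refine setLIntegral_mono' measurableSet_Ioi fun t ht => ?_
      have ht0 : (0 : ℝ) < t := one_pos.trans ht
      rw [ENNReal.ofReal_mul (by positivity)]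
      exact mul_le_mul_left (hw u hDu t ht0) _
    · filter_upwards [self_mem_ae_restrict measurableSet_Ioi] with t ht
      have ht0 : (0 : ℝ) < t := one_pos.trans ht
      simp only [Pi.zero_apply]
      positivity

/-- The subcritical Sobolev embedding. -/
theorem exists_sobolev_bound {N : ℕ} (hN : 0 < N) {s : ℝ} (hs0 : 0 < s) (hs : 2 * s < N)
    {r : ℝ} (hr2 : 2 ≤ r) (hr : r < 2 * N / (N - 2 * s)) :
    ∃ C, 0 ≤ C ∧ ∀ u : Hs N s, Integrable (fun x => |(u : L2 N) x| ^ r) volume ∧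
      ∫ x, |(u : L2 N) x| ^ r ≤ C * (‖(u : L2 N)‖ + ‖fracLap s u‖) ^ r := by
  obtain ⟨C, hC, h⟩ := exists_lintegral_rpow_le hN hs0 hs hr2 hr
  refine ⟨C, hC, fun u => ?_⟩
  have hm : AEStronglyMeasurable (fun x => |(u : L2 N) x| ^ r) volume :=
    ((Lp.aestronglyMeasurable (u : L2 N)).aemeasurable.norm.pow_const r).aestronglyMeasurable
  rcases eq_or_ne (u : L2 N) 0 with hu0 | hu0
  · have h1 : (fun x => |(u : L2 N) x| ^ r) =ᵐ[volume] fun _ => (0 : ℝ) := by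
      rw [hu0]
      filter_upwards [Lp.coeFn_zero ℝ 2 (volume : Measure (RN N))] with x hx
      rw [hx, Pi.zero_apply, abs_zero, zero_rpow (by linarith)]
    refine ⟨(integrable_zero _ _ _).congr h1.symm, ?_⟩
    rw [integral_congr_ae h1, integral_zero]
    positivity
  set M : ℝ := ‖(u : L2 N)‖ + ‖fracLap s u‖ with hM
  have hM0 : 0 < M := by
    have := norm_pos_iff.mpr hu0
    positivity
  have hv1 : ‖((M⁻¹ • u : Hs N s) : L2 N)‖ ≤ 1 := by
    rw [Submodule.coe_smul, norm_smul, Real.norm_of_nonneg (by positivity), inv_mul_le_one₀ hM0]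
    have := norm_nonneg (fracLap s u)
    linarith
  have hv2 : ‖fracLap s (M⁻¹ • u)‖ ≤ 1 := by
    rw [map_smul, norm_smul, Real.norm_of_nonneg (by positivity), inv_mul_le_one₀ hM0]
    have := norm_nonneg (u : L2 N)
    linarith
  have h2 := h _ hv1 hv2
  have h3 : ∫⁻ x, ENNReal.ofReal (|(u : L2 N) x| ^ r) =
      ENNReal.ofReal (M ^ r) * ∫⁻ x, ENNReal.ofReal (|((M⁻¹ • u : Hs N s) : L2 N) x| ^ r) := by
    rw [← lintegral_const_mul' _ _ ENNReal.ofReal_ne_top]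
    refine lintegral_congr_ae ?_
    filter_upwards [Lp.coeFn_smul M⁻¹ (u : L2 N)] with x hx
    rw [Submodule.coe_smul, hx, Pi.smul_apply, smul_eq_mul, ← ENNReal.ofReal_mul (by positivity),
      abs_mul, abs_of_pos (inv_pos.mpr hM0), ← mul_rpow hM0.le (by positivity),
      mul_inv_cancel_left₀ hM0.ne']
  have h4 : ∫⁻ x, ENNReal.ofReal (|(u : L2 N) x| ^ r) ≤ ENNReal.ofReal (C * M ^ r) := by
    rw [h3, mul_comm C, ENNReal.ofReal_mul (by positivity)]
    exact mul_le_mul_right h2 _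
  have hint : Integrable (fun x => |(u : L2 N) x| ^ r) volume := by
    refine ⟨hm, ?_⟩
    rw [hasFiniteIntegral_iff_ofReal (Eventually.of_forall fun x => by positivity)]
    exact h4.trans_lt ENNReal.ofReal_lt_top
  refine ⟨hint, ?_⟩
  rw [← ofReal_integral_eq_lintegral_ofReal hint (Eventually.of_forall fun x => by positivity)]
    at h4
  exact (ENNReal.ofReal_le_ofReal_iff (by positivity)).mp h4

/-! ### Weak compactness and closed multiplication operators. -/

/-- Weak convergence of a sequence in a normed space. -/
def WeaklyTendsto {X : Type*} [NormedAddCommGroup X] [NormedSpace ℝ X] (u : ℕ → X) (w : X) :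
    Prop :=
  ∀ ℓ : X →L[ℝ] ℝ, Tendsto (fun n => ℓ (u n)) atTop (𝓝 (ℓ w))

/-- Sequential Banach–Alaoglu in the dual, carried over by the Riesz isomorphism. -/
theorem exists_weaklyTendsto_subseq {X : Type*} [NormedAddCommGroup X] [InnerProductSpace ℝ X]
    [CompleteSpace X] [TopologicalSpace.SeparableSpace X] (u : ℕ → X) {M : ℝ}
    (hu : ∀ n, ‖u n‖ ≤ M) :
    ∃ (w : X) (k : ℕ → ℕ), StrictMono k ∧ WeaklyTendsto (fun n => u (k n)) w := by
  obtain ⟨L, -, k, hk, hL⟩ := WeakDual.isSeqCompact_closedBall (𝕜 := ℝ) (E := X)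
    (x' := 0) (r := M) (x := fun n => StrongDual.toWeakDual (InnerProductSpace.toDual ℝ X (u n)))
    (fun n => by simpa using hu n)
  set w : X := (InnerProductSpace.toDual ℝ X).symm (WeakDual.toStrongDual L) with hw
  refine ⟨w, k, hk, fun ℓ => ?_⟩
  set z : X := (InnerProductSpace.toDual ℝ X).symm ℓ with hz
  have h1 : ∀ x, ℓ x = inner ℝ x z := fun x => by
    rw [real_inner_comm, hz, InnerProductSpace.toDual_symm_apply]
  have h2 : Tendsto (fun n => inner ℝ (u (k n)) z) atTop (𝓝 (L z)) :=
    tendsto_iff_forall_eval_tendsto_topDualPairing.mp hL z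
  have h3 : inner ℝ w z = L z := by
    rw [hw, InnerProductSpace.toDual_symm_apply]; rfl
  simpa only [h1, h3] using h2

/-- Multiplication by an unbounded `m` is closed: pass to subsequences converging almost everywhere.
It serves both the symbol of the fractional Laplacian and the weight `√V`. -/
theorem ae_eq_mul_of_tendsto {N : ℕ} {𝕜 : Type*} [RCLike 𝕜]
    {f g : ℕ → Lp 𝕜 2 (volume : Measure (RN N))} {f' g' : Lp 𝕜 2 (volume : Measure (RN N))}
    (m : RN N → 𝕜) (hf : Tendsto f atTop (𝓝 f')) (hg : Tendsto g atTop (𝓝 g'))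
    (h : ∀ n, g n =ᵐ[volume] fun x => m x * f n x) : g' =ᵐ[volume] fun x => m x * f' x := by
  obtain ⟨a, ha, hfa⟩ := (tendstoInMeasure_of_tendsto_Lp hf).exists_seq_tendsto_ae
  obtain ⟨b, hb, hgb⟩ :=
    (tendstoInMeasure_of_tendsto_Lp (hg.comp ha.tendsto_atTop)).exists_seq_tendsto_ae
  filter_upwards [hfa, hgb, ae_all_iff.mpr h] with x h1 h2 h3
  refine tendsto_nhds_unique h2 ?_
  simp only [Function.comp_apply, h3]
  exact (h1.comp hb.tendsto_atTop).const_mul (m x)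

/-- `fourierReal` as a continuous linear map. -/
noncomputable def fourierRealCLM (N : ℕ) : L2 N →L[ℝ] CL2 N :=
  ((Lp.fourierTransformₗᵢ (RN N) ℂ).toContinuousLinearEquiv :
    CL2 N →L[ℂ] CL2 N).restrictScalars ℝ ∘L complexify N

theorem IsFracLap.of_tendsto {N : ℕ} {β : ℝ} {u g : ℕ → L2 N} {u' g' : L2 N}
    (hu : Tendsto u atTop (𝓝 u')) (hg : Tendsto g atTop (𝓝 g'))
    (h : ∀ n, IsFracLap β (u n) (g n)) : IsFracLap β u' g' :=
  ae_eq_mul_of_tendsto (𝕜 := ℂ) (fun ξ => (((2 * π * ‖ξ‖) ^ (2 * β) : ℝ) : ℂ))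
    (((fourierRealCLM N).continuous.tendsto u').comp hu)
    (((fourierRealCLM N).continuous.tendsto g').comp hg) h

/-! ### `W_ε` as a separable Hilbert space; the Rellich theorem. -/

section WSpace

variable {N : ℕ} {s : ℝ} {V : Potential N} {ε : ℝ}

theorem W.memLp_weighted (u : W s V ε) :
    MemLp (fun x => √(V (ε • x)) * u.fn x) 2 volume := by
  have hm : AEStronglyMeasurable (fun x => √(V (ε • x)) * u.fn x) volume :=
    (V.aesm ε).aemeasurable.sqrt.aestronglyMeasurable.mul (Lp.aestronglyMeasurable _)
  rw [memLp_two_iff_integrable_sq hm]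
  refine u.integrable_sq.congr (Eventually.of_forall fun x => ?_)
  simp only
  rw [mul_pow, sq_sqrt (V.pos _).le]

/-- The function `x ↦ V(εx)^{1/2} u(x)` as an element of `L²`. -/
noncomputable def W.weighted (u : W s V ε) : L2 N := (W.memLp_weighted u).toLp

theorem W.coeFn_weighted (u : W s V ε) :
    W.weighted u =ᵐ[volume] fun x => √(V (ε • x)) * u.fn x :=
  (W.memLp_weighted u).coeFn_toLp

theorem W.norm_sq_weighted (u : W s V ε) :
    ‖W.weighted u‖ ^ 2 = ∫ x, V (ε • x) * u.fn x ^ 2 := by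
  rw [L2.norm_sq]
  refine integral_congr_ae ?_
  filter_upwards [W.coeFn_weighted u] with x hx
  rw [hx, mul_pow, sq_sqrt (V.pos _).le]

theorem W.norm_sq (u : W s V ε) :
    ‖u‖ ^ 2 = ‖fracLap s (W.toHs u)‖ ^ 2 + ∫ x, V (ε • x) * u.fn x ^ 2 := by
  rw [← real_inner_self_eq_norm_sq, W.inner_eq, W.scalar, L2.norm_sq]
  simp only [sq]

theorem W.norm_sq' (u : W s V ε) :
    ‖u‖ ^ 2 = ‖fracLap s (W.toHs u)‖ ^ 2 + ‖W.weighted u‖ ^ 2 := by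
  rw [W.norm_sq, W.norm_sq_weighted]

theorem W.weighted_add (u v : W s V ε) : W.weighted (u + v) = W.weighted u + W.weighted v := by
  apply Lp.ext
  filter_upwards [W.coeFn_weighted (u + v), W.coeFn_weighted u, W.coeFn_weighted v,
    Lp.coeFn_add (W.weighted u) (W.weighted v), W.fn_add u v] with x h1 h2 h3 h4 h5
  rw [h1, h4, Pi.add_apply, h2, h3, h5, mul_add]

theorem W.weighted_smul (c : ℝ) (u : W s V ε) : W.weighted (c • u) = c • W.weighted u := by
  apply Lp.ext
  filter_upwards [W.coeFn_weighted (c • u), W.coeFn_weighted u,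
    Lp.coeFn_smul c (W.weighted u), W.fn_smul c u] with x h1 h2 h4 h5
  rw [h1, h4, Pi.smul_apply, h2, h5, smul_eq_mul]
  ring

/-- The isometric embedding `u ↦ ((-Δ)^{s/2} u, V(ε·)^{1/2} u)` of `W_ε`. -/
noncomputable def W.embedding : W s V ε →ₗᵢ[ℝ] WithLp 2 (L2 N × L2 N) where
  toFun u := WithLp.toLp 2 (fracLap s (W.toHs u), W.weighted u)
  map_add' u v := by
    rw [map_add, map_add, W.weighted_add]; rfl
  map_smul' c u := by
    rw [map_smul, map_smul, W.weighted_smul]; rfl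
  norm_map' u := by
    refine (sq_eq_sq₀ (norm_nonneg _) (norm_nonneg _)).mp ?_
    rw [W.norm_sq', WithLp.prod_norm_sq_eq_of_L2]
    rfl

/-- Second countability passes to subspaces, so the isometric embedding in `L² × L²` suffices. -/
instance : TopologicalSpace.SeparableSpace (W s V ε) := by
  have : Fact ((2 : ℝ≥0∞) ≠ ⊤) := ⟨by norm_num⟩
  have : SecondCountableTopology (WithLp 2 (L2 N × L2 N)) :=
    WithLp.secondCountableTopology 2 (L2 N) (L2 N)
  have : SecondCountableTopology (W s V ε) :=
    (W.embedding (s := s) (V := V) (ε := ε)).isometry.isEmbedding.secondCountableTopology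
  infer_instance

theorem W.norm_fracLap_le (u : W s V ε) : ‖fracLap s (W.toHs u)‖ ≤ ‖u‖ := by
  have h := W.norm_sq' u
  exact (sq_le_sq₀ (norm_nonneg _) (norm_nonneg _)).mp (by nlinarith [sq_nonneg ‖W.weighted u‖])

theorem W.norm_weighted_le (u : W s V ε) : ‖W.weighted u‖ ≤ ‖u‖ := by
  have h := W.norm_sq' u
  exact (sq_le_sq₀ (norm_nonneg _) (norm_nonneg _)).mp
    (by nlinarith [sq_nonneg ‖fracLap s (W.toHs u)‖])

variable {V₀ : ℝ}

theorem W.mul_norm_sq_le (hV : ∀ x, V₀ ≤ V x) (u : W s V ε) :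
    V₀ * ‖(W.toHs u : L2 N)‖ ^ 2 ≤ ‖W.weighted u‖ ^ 2 := by
  rw [W.norm_sq_weighted, L2.norm_sq, ← integral_const_mul]
  exact integral_mono ((L2.integrable_sq _).const_mul _) u.integrable_sq fun x =>
    mul_le_mul_of_nonneg_right (hV _) (sq_nonneg _)

theorem W.norm_toHs_le (hV₀ : 0 < V₀) (hV : ∀ x, V₀ ≤ V x) (u : W s V ε) :
    ‖(W.toHs u : L2 N)‖ ≤ (√V₀)⁻¹ * ‖u‖ := by
  rw [inv_mul_eq_div, le_div_iff₀ (sqrt_pos.mpr hV₀)]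
  refine (sq_le_sq₀ (by positivity) (norm_nonneg _)).mp ?_
  rw [mul_pow, sq_sqrt hV₀.le, mul_comm]
  exact (W.mul_norm_sq_le hV u).trans
    (pow_le_pow_left₀ (norm_nonneg _) (W.norm_weighted_le u) 2)

/-- The inclusion of `W_ε` in `L²`. -/
noncomputable def W.toL2 (hV₀ : 0 < V₀) (hV : ∀ x, V₀ ≤ V x) : W s V ε →L[ℝ] L2 N :=
  LinearMap.mkContinuous ((Hs N s).subtype ∘ₗ W.toHs) ((√V₀)⁻¹) (W.norm_toHs_le hV₀ hV)

/-- The components `(-Δ)^{s/2} u` and `√V u` of a Cauchy sequence converge in `L²`, and so does `u`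
itself because `V ≥ V₀ > 0`; closedness of both operators identifies the limits. -/
theorem W.completeSpace (hV₀ : 0 < V₀) (hV : ∀ x, V₀ ≤ V x) : CompleteSpace (W s V ε) := by
  refine Metric.complete_of_cauchySeq_tendsto fun u hu => ?_
  have hD : ∀ a b : W s V ε, fracLap s (W.toHs a) - fracLap s (W.toHs b) =
      fracLap s (W.toHs (a - b)) := fun a b => by rw [map_sub, map_sub]
  have hWt : ∀ a b : W s V ε, W.weighted a - W.weighted b = W.weighted (a - b) := fun a b => by
    rw [sub_eq_add_neg a b, ← neg_one_smul ℝ b, W.weighted_add, W.weighted_smul,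
      neg_one_smul, ← sub_eq_add_neg]
  have h1 : CauchySeq fun n => fracLap s (W.toHs (u n)) := by
    have : LipschitzWith 1 fun a : W s V ε => fracLap s (W.toHs a) :=
      LipschitzWith.of_dist_le_mul fun a b => by
        rw [dist_eq_norm, dist_eq_norm, hD, NNReal.coe_one, one_mul]
        exact W.norm_fracLap_le _
    exact this.uniformContinuous.comp_cauchySeq hu
  have h2 : CauchySeq fun n => W.weighted (u n) := by
    have : LipschitzWith 1 fun a : W s V ε => W.weighted a :=
      LipschitzWith.of_dist_le_mul fun a b => by
        rw [dist_eq_norm, dist_eq_norm, hWt, NNReal.coe_one, one_mul]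
        exact W.norm_weighted_le _
    exact this.uniformContinuous.comp_cauchySeq hu
  have h3 : CauchySeq fun n => W.toL2 hV₀ hV (u n) :=
    (W.toL2 hV₀ hV).uniformContinuous.comp_cauchySeq hu
  obtain ⟨g, hg⟩ := cauchySeq_tendsto_of_complete h1
  obtain ⟨h, hh⟩ := cauchySeq_tendsto_of_complete h2
  obtain ⟨w, hw⟩ := cauchySeq_tendsto_of_complete h3
  have hgw : IsFracLap (s / 2) w g := IsFracLap.of_tendsto hw hg fun n => fracLap_spec _
  have hhw : h =ᵐ[volume] fun x => √(V (ε • x)) * w x :=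
    ae_eq_mul_of_tendsto _ hw hh fun n => W.coeFn_weighted (u n)
  set w' : Hs N s := ⟨w, g, hgw⟩ with hw'
  have hint : Integrable (fun x => V (ε • x) * (w' : L2 N) x ^ 2) volume := by
    refine (L2.integrable_sq h).congr ?_
    filter_upwards [hhw] with x hx
    rw [hx, mul_pow, sq_sqrt (V.pos _).le]
  set z : W s V ε := ⟨w', hint⟩ with hz
  have hDz : fracLap s (W.toHs z) = g := (fracLap_spec (W.toHs z)).unique hgw
  have hWz : W.weighted z = h := by
    apply Lp.ext
    filter_upwards [hhw, W.coeFn_weighted z] with x hx hx'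
    rw [hx, hx']
    rfl
  refine ⟨z, ?_⟩
  rw [tendsto_iff_norm_sub_tendsto_zero]
  have h5 : ∀ n, ‖u n - z‖ = √(‖fracLap s (W.toHs (u n)) - g‖ ^ 2 + ‖W.weighted (u n) - h‖ ^ 2) :=
    fun n => by
      rw [← hDz, ← hWz, hD, hWt, ← W.norm_sq', sqrt_sq (norm_nonneg _)]
  simp only [h5]
  have h6 := (tendsto_iff_norm_sub_tendsto_zero.mp hg).pow 2
  have h7 := (tendsto_iff_norm_sub_tendsto_zero.mp hh).pow 2
  have h8 := (h6.add h7).sqrt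
  simpa using h8

/-- The Rellich theorem: weak convergence to zero in `W_ε` gives convergence to zero in `L²` of
bounded sets. -/
theorem W.tendsto_setIntegral_ball_sq (hs : 0 < s) (hV₀ : 0 < V₀) (hV : ∀ x, V₀ ≤ V x)
    {v : ℕ → W s V ε} {M : ℝ} (hM : ∀ n, ‖v n‖ ≤ M) (hv : WeaklyTendsto v 0) (R : ℝ) :
    Tendsto (fun n => ∫ x in Metric.ball 0 R, (v n).fn x ^ 2) atTop (𝓝 0) := by
  have hM0 : 0 ≤ M := (norm_nonneg _).trans (hM 0)
  rw [Metric.tendsto_atTop]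
  intro η hη
  -- The high frequencies are made small in `L²`, uniformly in `n`, before the limit in `n` is
  -- taken.
  obtain ⟨Λ, hΛ, hΛη⟩ : ∃ Λ > 0, 2 * (Λ ^ (-s) * M) ^ 2 < η / 2 := by
    have h1 : Tendsto (fun Λ : ℝ => 2 * (Λ ^ (-s) * M) ^ 2) atTop (𝓝 (2 * (0 * M) ^ 2)) :=
      (((tendsto_rpow_neg_atTop hs).mul_const M).pow 2).const_mul 2
    have h2 := (h1.eventually_lt_const (u := η / 2) (by simpa using hη)).and
      (eventually_gt_atTop 0)
    obtain ⟨Λ, h3, h4⟩ := h2.exists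
    exact ⟨Λ, h4, h3⟩
  choose r hr hur using fun n => exists_eq_lowPart_add hs.le hΛ (W.toHs (v n))
  -- For fixed `x` the low part is a continuous linear form, so weak convergence is pointwise
  -- convergence; with the uniform bound `B`, dominated convergence applies on the ball.
  set ℓ : ∀ x : RN N, W s V ε →L[ℝ] ℂ := fun x =>
    (innerSL ℂ (lowKernel Λ x)).restrictScalars ℝ ∘L fourierRealCLM N ∘L W.toL2 hV₀ hV with hℓ
  have hℓv : ∀ x n, ℓ x (v n) = lowPart Λ (W.toHs (v n) : L2 N) x := fun x n => rfl
  have hpt : ∀ x, Tendsto (fun n => ‖ℓ x (v n)‖ ^ 2) atTop (𝓝 0) := fun x => by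
    have h1 := hv (Complex.reCLM ∘L ℓ x)
    have h2 := hv (Complex.imCLM ∘L ℓ x)
    have h3 : Tendsto (fun n => (ℓ x (v n)).re ^ 2 + (ℓ x (v n)).im ^ 2) atTop
        (𝓝 (0 ^ 2 + 0 ^ 2)) := by
      refine (Tendsto.pow ?_ 2).add (Tendsto.pow ?_ 2)
      · simpa using h1
      · simpa using h2
    refine (h3.congr fun n => ?_).trans_eq (by simp)
    rw [← Complex.normSq_eq_norm_sq, Complex.normSq_apply]
    ring
  have hlm : ∀ n, AEStronglyMeasurable (fun x => ℓ x (v n)) volume := fun n => by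
    refine ((Complex.continuous_ofReal.comp_aestronglyMeasurable
      (Lp.aestronglyMeasurable (W.toHs (v n) : L2 N))).sub
      (Lp.aestronglyMeasurable (r n))).congr ?_
    filter_upwards [hur n] with x hx
    rw [Pi.sub_apply, hx, hℓv, add_sub_cancel_right]
  set B : ℝ := (‖lowKernel Λ (0 : RN N)‖ * ((√V₀)⁻¹ * M)) ^ 2 with hB
  have hbd : ∀ n x, ‖ℓ x (v n)‖ ^ 2 ≤ B := fun n x => by
    rw [hℓv, hB]
    refine pow_le_pow_left₀ (norm_nonneg _) ((norm_lowPart_le _ _ _).trans ?_) 2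
    refine mul_le_mul_of_nonneg_left ((W.norm_toHs_le hV₀ hV _).trans ?_) (norm_nonneg _)
    exact mul_le_mul_of_nonneg_left (hM n) (by positivity)
  have hBi : IntegrableOn (fun _ : RN N => B) (Metric.ball 0 R) volume :=
    integrableOn_const measure_ball_lt_top.ne (by simp)
  have hli : ∀ n, IntegrableOn (fun x => ‖ℓ x (v n)‖ ^ 2) (Metric.ball 0 R) volume := fun n =>
    hBi.mono' ((hlm n).norm.pow 2).restrict (Eventually.of_forall fun x => by
      rw [Real.norm_of_nonneg (by positivity)]; exact hbd n x)
  have hlow : Tendsto (fun n => ∫ x in Metric.ball 0 R, ‖ℓ x (v n)‖ ^ 2) atTop (𝓝 0) := by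
    have := tendsto_integral_of_dominated_convergence
      (μ := volume.restrict (Metric.ball (0 : RN N) R)) (F := fun n x => ‖ℓ x (v n)‖ ^ 2)
      (f := fun _ => 0) (fun _ => B)
      (fun n => ((hlm n).norm.pow 2).restrict) hBi
      (fun n => Eventually.of_forall fun x => by
        rw [Real.norm_of_nonneg (by positivity)]; exact hbd n x)
      (Eventually.of_forall hpt)
    simpa using this
  obtain ⟨n₀, hn₀⟩ := 
    (hlow.eventually_lt_const (u := η / 4) (by linarith)).exists_forall_of_atTop
  refine ⟨n₀, fun n hn => ?_⟩
  have h1 : ∫ x in Metric.ball 0 R, (v n).fn x ^ 2 ≤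
      2 * (∫ x in Metric.ball 0 R, ‖ℓ x (v n)‖ ^ 2) + 2 * ∫ x in Metric.ball 0 R, ‖r n x‖ ^ 2 := by
    rw [← integral_const_mul, ← integral_const_mul, ← integral_add ((hli n).const_mul 2)
      ((CL2.integrable_norm_sq (r n)).integrableOn.const_mul 2)]
    refine integral_mono_ae (L2.integrable_sq _).integrableOn (((hli n).const_mul 2).add
      ((CL2.integrable_norm_sq (r n)).integrableOn.const_mul 2)) (ae_restrict_of_ae ?_)
    filter_upwards [hur n] with x hx
    have h2 : |(v n).fn x| ≤ ‖ℓ x (v n)‖ + ‖r n x‖ := by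
      rw [← Real.norm_eq_abs, ← Complex.norm_real, hℓv]
      exact (congrArg _ hx).trans_le (norm_add_le _ _)
    rw [← sq_abs]
    nlinarith [abs_nonneg ((v n).fn x), sq_nonneg (‖ℓ x (v n)‖ - ‖r n x‖)]
  have h3 : ∫ x in Metric.ball 0 R, ‖r n x‖ ^ 2 ≤ (Λ ^ (-s) * M) ^ 2 := by
    refine (setIntegral_le_integral (CL2.integrable_norm_sq (r n))
      (Eventually.of_forall fun x => by positivity)).trans ?_
    rw [← CL2.norm_sq]
    refine pow_le_pow_left₀ (norm_nonneg _) ((hr n).trans ?_) 2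
    exact mul_le_mul_of_nonneg_left ((W.norm_fracLap_le _).trans (hM n)) (by positivity)
  have h4 : 0 ≤ ∫ x in Metric.ball 0 R, (v n).fn x ^ 2 := integral_nonneg fun x => sq_nonneg _
  have h5 := hn₀ n hn
  rw [Real.dist_eq, sub_zero, abs_of_nonneg h4]
  linarith

theorem W.exists_sobolev_bound (hN : 0 < N) (hs : 0 < s) (hsN : 2 * s < N) (hV₀ : 0 < V₀)
    (hV : ∀ x, V₀ ≤ V x) {r : ℝ} (hr2 : 2 ≤ r) (hr : r < 2 * N / (N - 2 * s)) :
    ∃ C, 0 < C ∧ ∀ u : W s V ε, Integrable (fun x => |u.fn x| ^ r) volume ∧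
      ∫ x, |u.fn x| ^ r ≤ C * ‖u‖ ^ r := by
  obtain ⟨C, hC, h⟩ := FracSchrodingerPoisson.exists_sobolev_bound hN hs hsN hr2 hr
  refine ⟨C * ((√V₀)⁻¹ + 1) ^ r + 1, by positivity, fun u => ⟨(h _).1, (h _).2.trans ?_⟩⟩
  have h1 : ‖(W.toHs u : L2 N)‖ + ‖fracLap s (W.toHs u)‖ ≤ ((√V₀)⁻¹ + 1) * ‖u‖ := by
    have := W.norm_toHs_le hV₀ hV u
    have := W.norm_fracLap_le u
    linarith
  calc C * (‖(W.toHs u : L2 N)‖ + ‖fracLap s (W.toHs u)‖) ^ r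
      ≤ C * (((√V₀)⁻¹ + 1) * ‖u‖) ^ r := by gcongr
    _ = C * ((√V₀)⁻¹ + 1) ^ r * ‖u‖ ^ r := by
      rw [mul_rpow (by positivity) (norm_nonneg _), mul_assoc]
    _ ≤ _ := by
      have : 0 ≤ ‖u‖ ^ r := by positivity
      nlinarith

end WSpace

/-! ### Hölder-type estimates and superposition operators. -/

theorem rpow_mul_le_add {q a b : ℝ} (hq : 0 ≤ q) (ha : 0 ≤ a) (hb : 0 ≤ b) :
    a ^ q * b ≤ a ^ (q + 1) + b ^ (q + 1) := by
  rcases le_total a b with h | h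
  · calc a ^ q * b ≤ b ^ q * b := by gcongr
      _ = b ^ (q + 1) := by rw [rpow_add_of_nonneg hb hq zero_le_one, rpow_one]
      _ ≤ _ := by have := rpow_nonneg ha (q + 1); linarith
  · calc a ^ q * b ≤ a ^ q * a := by gcongr
      _ = a ^ (q + 1) := by rw [rpow_add_of_nonneg ha hq zero_le_one, rpow_one]
      _ ≤ _ := by have := rpow_nonneg hb (q + 1); linarith

section Measure

variable {Ω : Type*} [MeasurableSpace Ω] {μ : Measure Ω}

theorem integrable_rpow_mul {q : ℝ} (hq : 0 ≤ q) {x z : Ω → ℝ} (hx : AEStronglyMeasurable x μ)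
    (hz : AEStronglyMeasurable z μ) (hxi : Integrable (fun t => |x t| ^ (q + 1)) μ)
    (hzi : Integrable (fun t => |z t| ^ (q + 1)) μ) :
    Integrable (fun t => |x t| ^ q * |z t|) μ := by
  refine (hxi.add hzi).mono'
    ((hx.aemeasurable.norm.pow_const q).mul hz.aemeasurable.norm).aestronglyMeasurable
    (Eventually.of_forall fun t => ?_)
  rw [Real.norm_of_nonneg (by positivity)]
  exact rpow_mul_le_add hq (abs_nonneg _) (abs_nonneg _)

/-- A form of Hölder's inequality. -/
theorem integral_rpow_mul_le {q : ℝ} (hq : 0 < q) {x z : Ω → ℝ} (hx : AEStronglyMeasurable x μ)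
    (hz : AEStronglyMeasurable z μ) (hxi : Integrable (fun t => |x t| ^ (q + 1)) μ)
    (hzi : Integrable (fun t => |z t| ^ (q + 1)) μ) {C X Z : ℝ} (hX : 0 ≤ X) (hZ : 0 ≤ Z)
    (hxC : ∫ t, |x t| ^ (q + 1) ∂μ ≤ C * X ^ (q + 1))
    (hzC : ∫ t, |z t| ^ (q + 1) ∂μ ≤ C * Z ^ (q + 1)) :
    ∫ t, |x t| ^ q * |z t| ∂μ ≤ 2 * C * X ^ q * Z := by
  have hzero : ∀ y : Ω → ℝ, Integrable (fun t => |y t| ^ (q + 1)) μ →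
      ∫ t, |y t| ^ (q + 1) ∂μ ≤ C * 0 ^ (q + 1) → ∀ᵐ t ∂μ, y t = 0 := fun y hy h => by
    rw [zero_rpow (by positivity), mul_zero] at h
    have h1 := le_antisymm h (integral_nonneg fun t => by positivity)
    rw [integral_eq_zero_iff_of_nonneg (fun t => by positivity) hy] at h1
    filter_upwards [h1] with t ht
    have := (rpow_eq_zero (abs_nonneg _) (by positivity)).mp ht
    exact abs_eq_zero.mp this
  rcases hX.eq_or_lt with rfl | hX
  · rw [integral_congr_ae (g := fun _ => (0 : ℝ))]
    · simp [zero_rpow hq.ne']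
    · filter_upwards [hzero x hxi hxC] with t ht
      simp [ht, zero_rpow hq.ne']
  rcases hZ.eq_or_lt with rfl | hZ
  · rw [integral_congr_ae (g := fun _ => (0 : ℝ))]
    · simp
    · filter_upwards [hzero z hzi hzC] with t ht
      simp [ht]
  have hXq : 0 < X ^ (q + 1) := by positivity
  have hZq : 0 < Z ^ (q + 1) := by positivity
  -- Young's inequality for the normalized functions `x / X` and `z / Z`; the degenerate cases were
  -- removed above.
  have h1 : ∀ t, |x t| ^ q * |z t| ≤
      X ^ q * Z * ((X ^ (q + 1))⁻¹ * |x t| ^ (q + 1) + (Z ^ (q + 1))⁻¹ * |z t| ^ (q + 1)) :=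
    fun t => by
      have h2 := rpow_mul_le_add hq.le (div_nonneg (abs_nonneg (x t)) hX.le)
        (div_nonneg (abs_nonneg (z t)) hZ.le)
      rw [div_rpow (abs_nonneg _) hX.le, div_rpow (abs_nonneg _) hX.le,
        div_rpow (abs_nonneg _) hZ.le] at h2
      calc |x t| ^ q * |z t| = X ^ q * Z * (|x t| ^ q / X ^ q * (|z t| / Z)) := by
            have : 0 < X ^ q := by positivity
            field_simp
        _ ≤ _ := by
          refine mul_le_mul_of_nonneg_left ?_ (by positivity)
          rwa [inv_mul_eq_div, inv_mul_eq_div]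
  calc ∫ t, |x t| ^ q * |z t| ∂μ ≤ ∫ t, X ^ q * Z *
        ((X ^ (q + 1))⁻¹ * |x t| ^ (q + 1) + (Z ^ (q + 1))⁻¹ * |z t| ^ (q + 1)) ∂μ :=
      integral_mono (integrable_rpow_mul hq.le hx hz hxi hzi)
        (((hxi.const_mul _).add (hzi.const_mul _)).const_mul _) h1
    _ = X ^ q * Z * ((X ^ (q + 1))⁻¹ * (∫ t, |x t| ^ (q + 1) ∂μ) +
        (Z ^ (q + 1))⁻¹ * ∫ t, |z t| ^ (q + 1) ∂μ) := by
      rw [integral_const_mul, integral_add (hxi.const_mul _) (hzi.const_mul _),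
        integral_const_mul, integral_const_mul]
    _ ≤ X ^ q * Z * (C + C) := by
      refine mul_le_mul_of_nonneg_left (add_le_add ?_ ?_) (by positivity)
      · rw [inv_mul_le_iff₀ hXq, mul_comm]; exact hxC
      · rw [inv_mul_le_iff₀ hZq, mul_comm]; exact hzC
    _ = _ := by ring

end Measure

/-- `W_ε` embeds continuously in `L^r`. -/
def SobolevBound {N : ℕ} (s : ℝ) (V : Potential N) (ε r : ℝ) : Prop :=
  ∃ C, 0 < C ∧ ∀ u : W s V ε, Integrable (fun x => |u.fn x| ^ r) volume ∧
    ∫ x, |u.fn x| ^ r ≤ C * ‖u‖ ^ r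

section WSpace

variable {N : ℕ} {s : ℝ} {V : Potential N} {ε q : ℝ}

theorem W.aesm (u : W s V ε) : AEStronglyMeasurable u.fn volume := Lp.aestronglyMeasurable _

theorem W.fn_sub (u v : W s V ε) : (u - v).fn =ᵐ[volume] fun x => u.fn x - v.fn x :=
  Lp.coeFn_sub (W.toHs u : L2 N) (W.toHs v : L2 N)

theorem SobolevBound.pairing {r : ℝ} (hr : 0 < r) (h : SobolevBound s V ε (r + 1)) :
    ∃ C, 0 < C ∧ ∀ u z : W s V ε, Integrable (fun x => |u.fn x| ^ r * |z.fn x|) volume ∧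
      ∫ x, |u.fn x| ^ r * |z.fn x| ≤ C * ‖u‖ ^ r * ‖z‖ := by
  obtain ⟨C, hC, h⟩ := h
  exact ⟨2 * C, by positivity, fun u z => ⟨integrable_rpow_mul hr.le u.aesm z.aesm (h u).1 (h z).1,
    integral_rpow_mul_le hr u.aesm z.aesm (h u).1 (h z).1 (norm_nonneg _) (norm_nonneg _)
      (h u).2 (h z).2⟩⟩

theorem SobolevBound.pairing_add (hq : 0 < q) (h2 : SobolevBound s V ε 2)
    (hp : SobolevBound s V ε (q + 1)) :
    ∃ C, 0 < C ∧ ∀ u z : W s V ε,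
      Integrable (fun x => (|u.fn x| ^ (1 : ℝ) + |u.fn x| ^ q) * |z.fn x|) volume ∧
      ∫ x, (|u.fn x| ^ (1 : ℝ) + |u.fn x| ^ q) * |z.fn x| ≤
        C * (‖u‖ ^ (1 : ℝ) + ‖u‖ ^ q) * ‖z‖ := by
  obtain ⟨C, hC, h⟩ := SobolevBound.pairing (r := 1) one_pos
    (by rwa [show (1 : ℝ) + 1 = 2 by norm_num] : SobolevBound s V ε (1 + 1))
  obtain ⟨D, hD, h'⟩ := hp.pairing hq
  refine ⟨C + D, by positivity, fun u z => ?_⟩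
  simp only [add_mul]
  refine ⟨(h u z).1.add (h' u z).1, ?_⟩
  rw [integral_add (h u z).1 (h' u z).1]
  have h1 := (h u z).2
  have h2 := (h' u z).2
  have h3 : 0 ≤ C * ‖u‖ ^ q * ‖z‖ := by positivity
  have h4 : 0 ≤ D * ‖u‖ ^ (1 : ℝ) * ‖z‖ := by positivity
  nlinarith

variable {h : ℝ → ℝ}

theorem W.integrable_nemytskii (hq : 0 < q) (h2 : SobolevBound s V ε 2)
    (hp : SobolevBound s V ε (q + 1)) (hh : IsIntermediate 1 q h) (u z : W s V ε) :
    Integrable (fun x => h (u.fn x) * z.fn x) volume := by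
  obtain ⟨C, hC, hb⟩ := hh.bound hq.le one_pos
  obtain ⟨D, hD, hint⟩ := h2.pairing_add hq hp
  refine ((hint u z).1.const_mul (1 + C)).mono'
    ((hh.continuous.comp_aestronglyMeasurable u.aesm).mul z.aesm) (Eventually.of_forall fun x => ?_)
  rw [norm_mul, Real.norm_eq_abs, Real.norm_eq_abs, ← mul_assoc]
  refine mul_le_mul_of_nonneg_right ((hb _).trans ?_) (abs_nonneg _)
  have h1 : 0 ≤ |u.fn x| ^ q := by positivity
  have h2 : 0 ≤ |u.fn x| ^ (1 : ℝ) := by positivity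
  nlinarith

theorem W.exists_abs_integral_nemytskii_le (hq : 0 < q) (h2 : SobolevBound s V ε 2)
    (hp : SobolevBound s V ε (q + 1)) (hh : IsIntermediate 1 q h) :
    ∃ C, 0 < C ∧ ∀ u z : W s V ε, |∫ x, h (u.fn x) * z.fn x| ≤
        C * (‖u‖ ^ (1 : ℝ) + ‖u‖ ^ q) * ‖z‖ := by
  obtain ⟨C, hC, hb⟩ := hh.bound hq.le one_pos
  obtain ⟨D, hD, hint⟩ := h2.pairing_add hq hp
  refine ⟨(1 + C) * D, by positivity, fun u z => ?_⟩
  calc |∫ x, h (u.fn x) * z.fn x| ≤ ∫ x, |h (u.fn x) * z.fn x| := abs_integral_le_integral_abs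
    _ ≤ ∫ x, (1 + C) * ((|u.fn x| ^ (1 : ℝ) + |u.fn x| ^ q) * |z.fn x|) := by
      refine integral_mono (W.integrable_nemytskii hq h2 hp hh u z).abs
        ((hint u z).1.const_mul _) fun x => ?_
      simp only
      rw [abs_mul, ← mul_assoc]
      refine mul_le_mul_of_nonneg_right ((hb _).trans ?_) (abs_nonneg _)
      have h1 : 0 ≤ |u.fn x| ^ q := by positivity
      have h2 : 0 ≤ |u.fn x| ^ (1 : ℝ) := by positivity
      nlinarith
    _ ≤ _ := by
      rw [integral_const_mul, mul_assoc, mul_assoc]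
      refine mul_le_mul_of_nonneg_left ?_ (by positivity)
      rw [← mul_assoc]
      exact (hint u z).2

/-- The continuous linear form `z ↦ ∫ h(u) z`. -/
noncomputable def W.nemytskii (hq : 0 < q) (h2 : SobolevBound s V ε 2)
    (hp : SobolevBound s V ε (q + 1)) (hh : IsIntermediate 1 q h) (u : W s V ε) :
    W s V ε →L[ℝ] ℝ :=
  LinearMap.mkContinuousOfExistsBound
    { toFun := fun z => ∫ x, h (u.fn x) * z.fn x
      map_add' := fun y z => by
        rw [← integral_add (W.integrable_nemytskii hq h2 hp hh u y)
          (W.integrable_nemytskii hq h2 hp hh u z)]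
        refine integral_congr_ae ?_
        filter_upwards [W.fn_add y z] with x hx
        rw [hx, mul_add]
      map_smul' := fun c z => by
        rw [RingHom.id_apply, smul_eq_mul, ← integral_const_mul]
        refine integral_congr_ae ?_
        filter_upwards [W.fn_smul c z] with x hx
        rw [hx]; ring }
    (by
      obtain ⟨C, -, hC⟩ := W.exists_abs_integral_nemytskii_le hq h2 hp hh
      exact ⟨_, hC u⟩)

theorem W.nemytskii_apply (hq : 0 < q) (h2 : SobolevBound s V ε 2)
    (hp : SobolevBound s V ε (q + 1)) (hh : IsIntermediate 1 q h) (u z : W s V ε) :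
    W.nemytskii hq h2 hp hh u z = ∫ x, h (u.fn x) * z.fn x := rfl

/-- The shape of `IsIntermediate.increment` integrated against a test function. It gives both the
continuity of the superposition operator and, with `z = y`, the Taylor remainder of `∫ F(u)`. -/
theorem W.exists_bound_of_increment (hq : 0 < q) (h2 : SobolevBound s V ε 2)
    (hp : SobolevBound s V ε (q + 1)) :
    ∃ D, 0 < D ∧ ∀ (u y z : W s V ε) (g : RN N → ℝ) (η C : ℝ), 0 ≤ η → 0 ≤ C →
      (∀ᵐ x, |g x| ≤ (η * (|u.fn x| ^ (1 : ℝ) + |u.fn x| ^ q) +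
        C * (|y.fn x| ^ (1 : ℝ) + |y.fn x| ^ q)) * |z.fn x|) →
      |∫ x, g x| ≤ D * (η * (‖u‖ ^ (1 : ℝ) + ‖u‖ ^ q) + C * (‖y‖ ^ (1 : ℝ) + ‖y‖ ^ q)) * ‖z‖ := by
  obtain ⟨D, hD, hint⟩ := h2.pairing_add hq hp
  refine ⟨D, hD, fun u y z g η C hη hC hg => ?_⟩
  have hi := ((hint u z).1.const_mul η).add ((hint y z).1.const_mul C)
  calc |∫ x, g x| ≤ ∫ x, |g x| := abs_integral_le_integral_abs
    _ ≤ ∫ x, (η * ((|u.fn x| ^ (1 : ℝ) + |u.fn x| ^ q) * |z.fn x|) +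
        C * ((|y.fn x| ^ (1 : ℝ) + |y.fn x| ^ q) * |z.fn x|)) := by
      refine integral_mono_of_nonneg (Eventually.of_forall fun x => abs_nonneg _) hi ?_
      filter_upwards [hg] with x hx
      refine hx.trans_eq ?_
      ring
    _ = η * (∫ x, (|u.fn x| ^ (1 : ℝ) + |u.fn x| ^ q) * |z.fn x|) +
        C * ∫ x, (|y.fn x| ^ (1 : ℝ) + |y.fn x| ^ q) * |z.fn x| := by
      rw [integral_add ((hint u z).1.const_mul η) ((hint y z).1.const_mul C),
        integral_const_mul, integral_const_mul]
    _ ≤ η * (D * (‖u‖ ^ (1 : ℝ) + ‖u‖ ^ q) * ‖z‖) + C * (D * (‖y‖ ^ (1 : ℝ) + ‖y‖ ^ q) * ‖z‖) :=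
      add_le_add (mul_le_mul_of_nonneg_left (hint u z).2 hη)
        (mul_le_mul_of_nonneg_left (hint y z).2 hC)
    _ = _ := by ring

/-- Given `A ≥ 0` and `D, C`, small increments make the bound of the previous theorem small. -/
theorem exists_small_increment {q D A : ℝ} (hq : 0 < q) (hD : 0 < D) (hA : 0 ≤ A) {c : ℝ}
    (hc : 0 < c) (C : ℝ → ℝ) :
    ∃ η > 0, ∃ δ > 0, ∀ t, 0 ≤ t → t < δ → D * (η * A + C η * (t ^ (1 : ℝ) + t ^ q)) ≤ c := by
  set η := c / (2 * D * (A + 1)) with hη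
  have hη0 : 0 < η := by positivity
  have h1 : D * (η * A) < c := by
    have : D * (η * (A + 1)) = c / 2 := by rw [hη]; field_simp
    nlinarith [mul_pos hD hη0]
  have h2 : Tendsto (fun t : ℝ => D * (η * A + C η * (t ^ (1 : ℝ) + t ^ q))) (𝓝 0)
      (𝓝 (D * (η * A + C η * (0 ^ (1 : ℝ) + 0 ^ q)))) := by
    have e1 : ContinuousAt (fun t : ℝ => t ^ (1 : ℝ)) 0 :=
      continuousAt_rpow_const _ _ (Or.inr zero_le_one)
    have e2 : ContinuousAt (fun t : ℝ => t ^ q) 0 := continuousAt_rpow_const _ _ (Or.inr hq.le)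
    exact (((e1.add e2).const_mul (C η)).const_add (η * A)).const_mul D
  rw [zero_rpow one_ne_zero, zero_rpow hq.ne', add_zero, mul_zero, add_zero] at h2
  obtain ⟨δ, hδ, h3⟩ := Metric.eventually_nhds_iff.mp (h2.eventually_lt_const h1)
  refine ⟨η, hη0, δ, hδ, fun t ht htδ => (h3 ?_).le⟩
  rwa [Real.dist_eq, sub_zero, abs_of_nonneg ht]

theorem W.continuous_nemytskii (hq : 0 < q) (h2 : SobolevBound s V ε 2)
    (hp : SobolevBound s V ε (q + 1)) (hh : IsIntermediate 1 q h) :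
    Continuous (W.nemytskii hq h2 hp hh) := by
  obtain ⟨D, hD, hbd⟩ := W.exists_bound_of_increment hq h2 hp
  refine (Metric.continuous_iff (α := W s V ε) (β := W s V ε →L[ℝ] ℝ)).mpr fun u c hc => ?_
  choose! C hC hinc using fun η (hη : 0 < η) => hh.increment zero_le_one hq.le hη
  obtain ⟨η, hη, δ, hδ, hsmall⟩ := exists_small_increment hq hD
    (A := ‖u‖ ^ (1 : ℝ) + ‖u‖ ^ q) (by positivity) (half_pos hc) C
  refine ⟨δ, hδ, fun v hv => ?_⟩
  rw [dist_eq_norm] at hv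
  refine (dist_eq_norm (W.nemytskii hq h2 hp hh v) (W.nemytskii hq h2 hp hh u)).trans_lt ?_
  refine lt_of_le_of_lt (ContinuousLinearMap.opNorm_le_bound _ (half_pos hc).le fun z => ?_)
    (half_lt_self hc)
  rw [sub_apply, W.nemytskii_apply, W.nemytskii_apply,
    ← integral_sub (W.integrable_nemytskii hq h2 hp hh v z)
      (W.integrable_nemytskii hq h2 hp hh u z)]
  refine (hbd u (v - u) z _ η (C η) hη.le (hC η hη) ?_).trans
    (mul_le_mul_of_nonneg_right (hsmall _ (norm_nonneg _) hv) (norm_nonneg _))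
  filter_upwards [W.fn_sub v u] with x hx
  rw [← sub_mul, abs_mul]
  refine mul_le_mul_of_nonneg_right ?_ (abs_nonneg _)
  have := hinc η hη (u.fn x) ((v - u).fn x)
  rw [hx] at this ⊢
  rwa [add_sub_cancel] at this

/-- The remainder is `∫ (f τ - f x)` over the interval from `x` to `x + y`, on which `|τ - x| ≤
|y|`. -/
theorem abs_primitive_sub_le {f : ℝ → ℝ} (hf : Continuous f) {q η C : ℝ} (hq : 0 < q)
    (hC : 0 ≤ C) (hinc : ∀ x y, |f (x + y) - f x| ≤
      η * (|x| ^ (1 : ℝ) + |x| ^ q) + C * (|y| ^ (1 : ℝ) + |y| ^ q)) (x y : ℝ) :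
    |primitive f (x + y) - primitive f x - f x * y| ≤
      (η * (|x| ^ (1 : ℝ) + |x| ^ q) + C * (|y| ^ (1 : ℝ) + |y| ^ q)) * |y| := by
  have h1 : primitive f (x + y) - primitive f x - f x * y = ∫ τ in x..(x + y), (f τ - f x) := by
    rw [intervalIntegral.integral_sub (hf.intervalIntegrable _ _) (by simp),
      intervalIntegral.integral_const, primitive, primitive,
      intervalIntegral.integral_interval_sub_left (hf.intervalIntegrable _ _)
        (hf.intervalIntegrable _ _), add_sub_cancel_left, smul_eq_mul, mul_comm y]
  rw [h1]
  have h2 := intervalIntegral.norm_integral_le_of_norm_le_const (a := x) (b := x + y)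
    (f := fun τ => f τ - f x)
    (C := η * (|x| ^ (1 : ℝ) + |x| ^ q) + C * (|y| ^ (1 : ℝ) + |y| ^ q)) (fun τ hτ => by
      have h3 := hinc x (τ - x)
      rw [add_sub_cancel] at h3
      refine h3.trans (add_le_add_right (mul_le_mul_of_nonneg_left ?_ hC) _)
      have h4 : |τ - x| ≤ |y| := by
        have := Set.abs_sub_left_of_mem_uIcc (uIoc_subset_uIcc hτ)
        rwa [add_sub_cancel_left] at this
      gcongr)
  rwa [add_sub_cancel_left] at h2

theorem W.integrable_of_intermediate (h2 : SobolevBound s V ε 2)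
    (hp : SobolevBound s V ε (q + 1)) (hq : 0 < q) (hh : IsIntermediate 2 (q + 1) h) (u : W s V ε) :
    Integrable (fun x => h (u.fn x)) volume := by
  obtain ⟨C, hC, hb⟩ := hh.bound (by positivity) one_pos
  obtain ⟨_, _, h2⟩ := h2
  obtain ⟨_, _, hp⟩ := hp
  refine (((h2 u).1.const_mul 1).add ((hp u).1.const_mul C)).mono'
    (hh.continuous.comp_aestronglyMeasurable u.aesm) (Eventually.of_forall fun x => ?_)
  exact hb _

theorem W.hasFDerivAt_integral_primitive {f : ℝ → ℝ} (hq : 0 < q) (h2 : SobolevBound s V ε 2)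
    (hp : SobolevBound s V ε (q + 1)) (hf : IsAdmissible f q) (u : W s V ε) :
    HasFDerivAt (fun v : W s V ε => ∫ x, primitive f (v.fn x))
      (W.nemytskii hq h2 hp hf.intermediate u) u := by
  obtain ⟨D, hD, hbd⟩ := W.exists_bound_of_increment hq h2 hp
  have hint := W.integrable_of_intermediate h2 hp hq (hf.intermediate_primitive hq.le)
  rw [hasFDerivAt_iff_isLittleO_nhds_zero, Asymptotics.isLittleO_iff]
  intro c hc
  choose! C hC hinc using fun η (hη : 0 < η) => hf.intermediate.increment zero_le_one hq.le hη
  obtain ⟨η, hη, δ, hδ, hsmall⟩ := exists_small_increment hq hD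
    (A := ‖u‖ ^ (1 : ℝ) + ‖u‖ ^ q) (by positivity) hc C
  rw [Metric.eventually_nhds_iff]
  refine ⟨δ, hδ, fun y hy => ?_⟩
  rw [dist_zero_right] at hy
  have hd : Integrable (fun x => primitive f ((u + y).fn x) - primitive f (u.fn x)) volume :=
    (hint _).sub (hint _)
  rw [W.nemytskii_apply, ← integral_sub (hint _) (hint _),
    ← integral_sub hd (W.integrable_nemytskii hq h2 hp hf.intermediate u y)]
  refine (hbd u y y _ η (C η) hη.le (hC η hη) ?_).trans
    (mul_le_mul_of_nonneg_right (hsmall _ (norm_nonneg _) hy) (norm_nonneg _))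
  filter_upwards [W.fn_add u y] with x hx
  rw [hx]
  exact abs_primitive_sub_le hf.intermediate.continuous hq (hC η hη) (hinc η hη) _ _

end WSpace

/-! ### The Riesz kernel. -/

/-- The Riesz kernel `|z|^{α-N}`. -/
noncomputable def rieszKernel {N : ℕ} (α : ℝ) (z : RN N) : ℝ := 1 / ‖z‖ ^ ((N : ℝ) - α)

section Riesz

variable {N : ℕ} {α : ℝ}

theorem rieszKernel_nonneg (z : RN N) : 0 ≤ rieszKernel α z := by
  rw [rieszKernel]; positivity

theorem rieszKernel_neg (z : RN N) : rieszKernel α (-z) = rieszKernel α z := by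
  rw [rieszKernel, rieszKernel, norm_neg]

theorem measurable_rieszKernel : Measurable (rieszKernel α : RN N → ℝ) :=
  (measurable_norm.pow_const ((N : ℝ) - α)).const_div 1

theorem rieszKernel_le (hα : α < N) (z : RN N) :
    rieszKernel α z ≤ 1 + (Metric.ball 0 1).indicator (rieszKernel α) z := by
  by_cases h : z ∈ Metric.ball (0 : RN N) 1
  · rw [indicator_of_mem h]; linarith
  · rw [indicator_of_notMem h, add_zero, rieszKernel]
    have h1 : 1 ≤ ‖z‖ := by simpa using h
    rw [div_le_one (by positivity)]
    exact one_le_rpow h1 (by linarith)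

theorem integrable_rieszKernel_ball (hN : 0 < N) (hα : 0 < α) :
    Integrable ((Metric.ball 0 1).indicator (rieszKernel α) : RN N → ℝ) volume := by
  rw [integrable_indicator_iff measurableSet_ball]
  refine IntegrableOn.congr_fun
    (integrableOn_ball_norm_rpow hN (β := (N : ℝ) - α) (by linarith) 1) (fun z _ => ?_)
    measurableSet_ball
  rw [rieszKernel, rpow_neg (norm_nonneg _), one_div]

/-- A bilinear estimate for the Riesz kernel, in place of the Hardy–Littlewood–Sobolev
inequality. -/
theorem exists_riesz_bound (hN : 0 < N) (hα : 0 < α) (hαN : α < N) :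
    ∃ K, 0 ≤ K ∧ ∀ a b : RN N → ℝ, (∀ x, 0 ≤ a x) → (∀ x, 0 ≤ b x) → Integrable a volume →
      Integrable b volume → Integrable (fun x => a x ^ 2) volume →
      Integrable (fun x => b x ^ 2) volume →
      Integrable (fun p : RN N × RN N => a p.1 * b p.2 * rieszKernel α (p.1 - p.2))
        (volume.prod volume) ∧
      ∀ τ > 0, ∫ p : RN N × RN N, a p.1 * b p.2 * rieszKernel α (p.1 - p.2)
        ∂(volume.prod volume) ≤
        (∫ x, a x) * (∫ x, b x) + K * (τ * (∫ x, a x ^ 2) + τ⁻¹ * ∫ x, b x ^ 2) := by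
  -- The kernel is at most `1 + k`, with `k` its integrable singular part. The `1` gives the product
  -- of the `L¹` norms, and `a b ≤ τ a² + τ⁻¹ b²` under `k` gives the squared `L²` norms. The
  -- parameter `τ` stays free: it later balances the two terms, or makes one of them small.
  set k : RN N → ℝ := (Metric.ball 0 1).indicator (rieszKernel α) with hk
  have hki : Integrable k volume := integrable_rieszKernel_ball hN hα
  have hk0 : ∀ z, 0 ≤ k z := fun z => indicator_nonneg (fun z _ => rieszKernel_nonneg z) z
  have hkneg : ∀ z, k (-z) = k z := fun z => by
    by_cases h : z ∈ Metric.ball (0 : RN N) 1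
    · have h' : -z ∈ Metric.ball (0 : RN N) 1 := by simpa using h
      rw [hk, indicator_of_mem h, indicator_of_mem h', rieszKernel_neg]
    · have h' : -z ∉ Metric.ball (0 : RN N) 1 := by simpa using h
      rw [hk, indicator_of_notMem h, indicator_of_notMem h']
  have hconv : ∀ g : RN N → ℝ, Integrable g volume →
      Integrable (fun p : RN N × RN N => g p.2 * k (p.1 - p.2)) (volume.prod volume) ∧
      ∫ p : RN N × RN N, g p.2 * k (p.1 - p.2) ∂(volume.prod volume) = (∫ z, k z) * ∫ x, g x :=
    fun g hg => by
      have h1 : Integrable (fun p : RN N × RN N => g p.2 * k (p.1 - p.2)) (volume.prod volume) :=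
        hg.convolution_integrand (ContinuousLinearMap.mul ℝ ℝ) hki
      refine ⟨h1, ?_⟩
      rw [integral_prod_symm _ h1]
      simp only [integral_const_mul]
      have h2 : ∀ y : RN N, ∫ x, k (x - y) = ∫ z, k z := fun y =>
        integral_sub_right_eq_self k y
      simp only [h2, integral_mul_const]
      ring
  have hconv' : ∀ g : RN N → ℝ, Integrable g volume →
      Integrable (fun p : RN N × RN N => g p.1 * k (p.1 - p.2)) (volume.prod volume) ∧
      ∫ p : RN N × RN N, g p.1 * k (p.1 - p.2) ∂(volume.prod volume) = (∫ z, k z) * ∫ x, g x :=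
    fun g hg => by
      have h1 : (fun p : RN N × RN N => g p.1 * k (p.1 - p.2)) =
          (fun p : RN N × RN N => g p.2 * k (p.1 - p.2)) ∘ Prod.swap := by
        ext p
        simp only [Function.comp_apply, Prod.fst_swap, Prod.snd_swap]
        rw [← hkneg, neg_sub]
      rw [h1]
      refine ⟨(hconv g hg).1.swap, ?_⟩
      rw [← (hconv g hg).2]
      exact integral_prod_swap (fun p : RN N × RN N => g p.2 * k (p.1 - p.2))
  refine ⟨∫ z, k z, integral_nonneg hk0, fun a b ha hb hai hbi ha2 hb2 => ?_⟩
  have hdom : ∀ τ > 0, Integrable (fun p : RN N × RN N => a p.1 * b p.2 +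
      (τ * (a p.1 ^ 2 * k (p.1 - p.2)) + τ⁻¹ * (b p.2 ^ 2 * k (p.1 - p.2))))
      (volume.prod volume) := fun τ hτ =>
    (hai.mul_prod hbi).add (((hconv' _ ha2).1.const_mul τ).add ((hconv _ hb2).1.const_mul τ⁻¹))
  have hle : ∀ τ > 0, ∀ p : RN N × RN N, a p.1 * b p.2 * rieszKernel α (p.1 - p.2) ≤
      a p.1 * b p.2 +
      (τ * (a p.1 ^ 2 * k (p.1 - p.2)) + τ⁻¹ * (b p.2 ^ 2 * k (p.1 - p.2))) := fun τ hτ p => by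
    have h1 := mul_le_mul_of_nonneg_left (rieszKernel_le hαN (p.1 - p.2))
      (mul_nonneg (ha p.1) (hb p.2))
    have h2 : a p.1 * b p.2 ≤ τ * a p.1 ^ 2 + τ⁻¹ * b p.2 ^ 2 := by
      have h3 : 0 ≤ τ⁻¹ * ((τ * a p.1 - b p.2) ^ 2) := by positivity
      have h4 : τ⁻¹ * ((τ * a p.1 - b p.2) ^ 2) =
          τ * a p.1 ^ 2 - 2 * (a p.1 * b p.2) + τ⁻¹ * b p.2 ^ 2 := by field_simp; ring
      have := mul_nonneg (ha p.1) (hb p.2)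
      linarith
    have h5 := mul_le_mul_of_nonneg_right h2 (hk0 (p.1 - p.2))
    change _ ≤ a p.1 * b p.2 * (1 + k (p.1 - p.2)) at h1
    linarith
  have hint : Integrable (fun p : RN N × RN N => a p.1 * b p.2 * rieszKernel α (p.1 - p.2))
      (volume.prod volume) := by
    refine (hdom 1 one_pos).mono' ?_ (Eventually.of_forall fun p => ?_)
    · exact (hai.mul_prod hbi).aestronglyMeasurable.mul
        (measurable_rieszKernel.comp (measurable_fst.sub measurable_snd)).aestronglyMeasurable
    · rw [Real.norm_of_nonneg (mul_nonneg (mul_nonneg (ha _) (hb _)) (rieszKernel_nonneg _))]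
      exact hle 1 one_pos p
  refine ⟨hint, fun τ hτ => ?_⟩
  refine (integral_mono hint (hdom τ hτ) (hle τ hτ)).trans_eq ?_
  have hsum : Integrable (fun p : RN N × RN N => τ * (a p.1 ^ 2 * k (p.1 - p.2)) +
      τ⁻¹ * (b p.2 ^ 2 * k (p.1 - p.2))) (volume.prod volume) :=
    ((hconv' _ ha2).1.const_mul τ).add ((hconv _ hb2).1.const_mul τ⁻¹)
  rw [integral_add (hai.mul_prod hbi) hsum, integral_add ((hconv' _ ha2).1.const_mul τ)
    ((hconv _ hb2).1.const_mul τ⁻¹), integral_const_mul, integral_const_mul, (hconv _ hb2).2,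
    (hconv' _ ha2).2, integral_prod_mul]
  ring

end Riesz

/-! ### The nonlocal energy as the squared norm of a bilinear map. -/

section WSpace

variable {N : ℕ} {s : ℝ} {V : Potential N} {ε α : ℝ}

theorem SobolevBound.integrable_pow {n : ℕ} (h : SobolevBound s V ε n) (hn : Even n)
    (u : W s V ε) : Integrable (fun x => u.fn x ^ n) volume := by
  obtain ⟨C, hC, h⟩ := h
  refine (h u).1.congr (Eventually.of_forall fun x => ?_)
  simp only
  rw [rpow_natCast, hn.pow_abs]

theorem SobolevBound.integral_pow_le {n : ℕ} (h : SobolevBound s V ε n) (hn : Even n) :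
    ∃ C, 0 < C ∧ ∀ u : W s V ε, ∫ x, u.fn x ^ n ≤ C * ‖u‖ ^ n := by
  obtain ⟨C, hC, h⟩ := h
  refine ⟨C, hC, fun u => ?_⟩
  have := (h u).2
  simp only [rpow_natCast, hn.pow_abs] at this
  exact this

/-- The space `L²(ℝ^N × ℝ^N)`. -/
abbrev L2prod (N : ℕ) : Type :=
  Lp ℝ 2 ((volume : Measure (RN N)).prod (volume : Measure (RN N)))

/-- The function `(x, y) ↦ u(x) v(y) |x - y|^{(α-N)/2}`. -/
noncomputable def W.tensorFun (α : ℝ) (u v : W s V ε) (p : RN N × RN N) : ℝ :=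
  u.fn p.1 * v.fn p.2 * √(rieszKernel α (p.1 - p.2))

theorem W.tensorFun_mul (a b c d : W s V ε) (p : RN N × RN N) :
    W.tensorFun α a b p * W.tensorFun α c d p =
      (a.fn p.1 * c.fn p.1) * (b.fn p.2 * d.fn p.2) * rieszKernel α (p.1 - p.2) := by
  have := mul_self_sqrt (rieszKernel_nonneg (α := α) (p.1 - p.2))
  rw [W.tensorFun, W.tensorFun]
  linear_combination (a.fn p.1 * b.fn p.2 * c.fn p.1 * d.fn p.2) * this

theorem ae_prod_of_ae_fst {P : RN N → Prop} (h : ∀ᵐ x, P x) :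
    ∀ᵐ p : RN N × RN N ∂(volume.prod volume), P p.1 :=
  Measure.quasiMeasurePreserving_fst.ae h

theorem ae_prod_of_ae_snd {P : RN N → Prop} (h : ∀ᵐ x, P x) :
    ∀ᵐ p : RN N × RN N ∂(volume.prod volume), P p.2 :=
  Measure.quasiMeasurePreserving_snd.ae h

theorem W.memLp_tensorFun (hN : 0 < N) (hα : 0 < α) (hαN : α < N)
    (h2 : SobolevBound s V ε (2 : ℕ)) (h4 : SobolevBound s V ε (4 : ℕ)) (u v : W s V ε) :
    MemLp (W.tensorFun α u v) 2 (volume.prod volume) := by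
  have hm : AEStronglyMeasurable (W.tensorFun α u v) (volume.prod volume) := by
    refine (AEStronglyMeasurable.mul ?_ ?_).mul ?_
    · exact u.aesm.comp_fst
    · exact v.aesm.comp_snd
    · exact (measurable_rieszKernel.comp
        (measurable_fst.sub measurable_snd)).sqrt.aestronglyMeasurable
  rw [memLp_two_iff_integrable_sq hm]
  obtain ⟨K, -, h⟩ := exists_riesz_bound hN hα hαN
  have e4 : ∀ w : W s V ε, Integrable (fun x => (w.fn x ^ 2) ^ 2) volume := fun w => by
    simp only [← pow_mul]; exact h4.integrable_pow (by decide) w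
  have := (h (fun x => u.fn x ^ 2) (fun x => v.fn x ^ 2) (fun x => sq_nonneg _)
    (fun x => sq_nonneg _) (h2.integrable_pow even_two u) (h2.integrable_pow even_two v)
    (e4 u) (e4 v)).1
  refine this.congr (Eventually.of_forall fun p => ?_)
  simp only
  rw [sq (W.tensorFun α u v p), W.tensorFun_mul]
  ring

/-- The bounded bilinear map `(u, v) ↦ u(x) v(y) |x - y|^{(α-N)/2}`. -/
theorem W.exists_tensor (hN : 0 < N) (hα : 0 < α) (hαN : α < N)
    (h2 : SobolevBound s V ε (2 : ℕ)) (h4 : SobolevBound s V ε (4 : ℕ)) :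
    ∃ T : W s V ε →L[ℝ] W s V ε →L[ℝ] L2prod N, ∀ u v,
      T u v =ᵐ[volume.prod volume] W.tensorFun α u v := by
  set t : ∀ u v : W s V ε, L2prod N := fun u v =>
    (W.memLp_tensorFun hN hα hαN h2 h4 u v).toLp with ht
  have htc : ∀ u v, t u v =ᵐ[volume.prod volume] W.tensorFun α u v := fun u v =>
    (W.memLp_tensorFun hN hα hαN h2 h4 u v).coeFn_toLp
  set B : W s V ε →ₗ[ℝ] W s V ε →ₗ[ℝ] L2prod N := LinearMap.mk₂ ℝ t
    (fun u u' v => by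
      apply Lp.ext
      filter_upwards [htc (u + u') v, htc u v, htc u' v, Lp.coeFn_add (t u v) (t u' v),
        ae_prod_of_ae_fst (W.fn_add u u')] with p e1 e2 e3 e5 e6
      rw [e1, e5, Pi.add_apply, e2, e3, W.tensorFun, W.tensorFun, W.tensorFun, e6]
      ring)
    (fun c u v => by
      apply Lp.ext
      filter_upwards [htc (c • u) v, htc u v, Lp.coeFn_smul c (t u v),
        ae_prod_of_ae_fst (W.fn_smul c u)] with p e1 e2 e5 e6
      rw [e1, e5, Pi.smul_apply, e2, W.tensorFun, W.tensorFun, e6, smul_eq_mul]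
      ring)
    (fun u v v' => by
      apply Lp.ext
      filter_upwards [htc u (v + v'), htc u v, htc u v', Lp.coeFn_add (t u v) (t u v'),
        ae_prod_of_ae_snd (W.fn_add v v')] with p e1 e2 e3 e5 e6
      rw [e1, e5, Pi.add_apply, e2, e3, W.tensorFun, W.tensorFun, W.tensorFun, e6]
      ring)
    (fun c u v => by
      apply Lp.ext
      filter_upwards [htc u (c • v), htc u v, Lp.coeFn_smul c (t u v),
        ae_prod_of_ae_snd (W.fn_smul c v)] with p e1 e2 e5 e6
      rw [e1, e5, Pi.smul_apply, e2, W.tensorFun, W.tensorFun, e6, smul_eq_mul]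
      ring) with hB
  have hBt : ∀ u v, B u v = t u v := fun u v => rfl
  obtain ⟨K, hK, h⟩ := exists_riesz_bound hN hα hαN
  obtain ⟨C, hC, hC2⟩ := h2.integral_pow_le even_two
  obtain ⟨D, hD, hD4⟩ := h4.integral_pow_le (by decide)
  have e4 : ∀ w : W s V ε, Integrable (fun x => (w.fn x ^ 2) ^ 2) volume := fun w => by
    simp only [← pow_mul]; exact h4.integrable_pow (by decide) w
  have hbound : ∀ u v, ‖B u v‖ ≤ √(C ^ 2 + 2 * K * D) * ‖u‖ * ‖v‖ := fun u v => by
    rcases eq_or_ne u 0 with rfl | hu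
    · simp
    rcases eq_or_ne v 0 with rfl | hv
    · simp
    have hu' : 0 < ‖u‖ := norm_pos_iff.mpr hu
    have hv' : 0 < ‖v‖ := norm_pos_iff.mpr hv
    have h1 : ‖B u v‖ ^ 2 ≤ (C ^ 2 + 2 * K * D) * (‖u‖ ^ 2 * ‖v‖ ^ 2) := by
      have e1 : ‖B u v‖ ^ 2 = ∫ p : RN N × RN N, u.fn p.1 ^ 2 * v.fn p.2 ^ 2 *
          rieszKernel α (p.1 - p.2) ∂(volume.prod volume) := by
        rw [← real_inner_self_eq_norm_sq, L2.inner_def]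
        refine integral_congr_ae ?_
        filter_upwards [htc u v] with p hp
        rw [hBt, hp]
        change W.tensorFun α u v p * W.tensorFun α u v p = _
        rw [W.tensorFun_mul]
        ring
      rw [e1]
      -- The choice `τ = ‖v‖² / ‖u‖²` turns both `L⁴` terms into multiples of `‖u‖² ‖v‖²`.
      refine ((h (fun x => u.fn x ^ 2) (fun x => v.fn x ^ 2) (fun x => sq_nonneg _)
        (fun x => sq_nonneg _) (h2.integrable_pow even_two u) (h2.integrable_pow even_two v)
        (e4 u) (e4 v)).2 (‖v‖ ^ 2 / ‖u‖ ^ 2) (by positivity)).trans ?_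
      simp only [← pow_mul, Nat.reduceMul]
      have e2 : (∫ x, u.fn x ^ 2) * (∫ x, v.fn x ^ 2) ≤ (C * ‖u‖ ^ 2) * (C * ‖v‖ ^ 2) :=
        mul_le_mul (hC2 u) (hC2 v) (integral_nonneg fun x => sq_nonneg _) (by positivity)
      have e3 : ‖v‖ ^ 2 / ‖u‖ ^ 2 * (∫ x, u.fn x ^ 4) ≤ D * (‖u‖ ^ 2 * ‖v‖ ^ 2) := by
        calc _ ≤ ‖v‖ ^ 2 / ‖u‖ ^ 2 * (D * ‖u‖ ^ 4) :=
              mul_le_mul_of_nonneg_left (hD4 u) (by positivity)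
          _ = _ := by field_simp
      have e5 : (‖v‖ ^ 2 / ‖u‖ ^ 2)⁻¹ * (∫ x, v.fn x ^ 4) ≤ D * (‖u‖ ^ 2 * ‖v‖ ^ 2) := by
        calc _ ≤ (‖v‖ ^ 2 / ‖u‖ ^ 2)⁻¹ * (D * ‖v‖ ^ 4) :=
              mul_le_mul_of_nonneg_left (hD4 v) (by positivity)
          _ = _ := by field_simp
      have e6 := mul_le_mul_of_nonneg_left (add_le_add e3 e5) hK
      linarith
    refine (sq_le_sq₀ (norm_nonneg _) (by positivity)).mp (h1.trans_eq ?_)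
    rw [mul_pow, mul_pow, sq_sqrt (by positivity)]
    ring
  refine ⟨LinearMap.mkContinuous₂ B _ hbound, fun u v => ?_⟩
  rw [LinearMap.mkContinuous₂_apply]
  exact htc u v

theorem W.inner_tensor {T : W s V ε →L[ℝ] W s V ε →L[ℝ] L2prod N}
    (hT : ∀ u v, T u v =ᵐ[volume.prod volume] W.tensorFun α u v) (a b c d : W s V ε) :
    inner ℝ (T a b) (T c d) = ∫ p : RN N × RN N, (a.fn p.1 * c.fn p.1) * (b.fn p.2 * d.fn p.2) *
      rieszKernel α (p.1 - p.2) ∂(volume.prod volume) := by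
  rw [L2.inner_def]
  refine integral_congr_ae ?_
  filter_upwards [hT a b, hT c d] with p h1 h2
  rw [h1, h2]
  change W.tensorFun α c d p * W.tensorFun α a b p = _
  rw [W.tensorFun_mul]
  ring

/-- The kernel is even. Consequently the two halves of the derivative of `‖T u u‖²` coincide. -/
theorem W.inner_tensor_swap {T : W s V ε →L[ℝ] W s V ε →L[ℝ] L2prod N}
    (hT : ∀ u v, T u v =ᵐ[volume.prod volume] W.tensorFun α u v) (a b c d : W s V ε) :
    inner ℝ (T a b) (T c d) = inner ℝ (T b a) (T d c) := by
  rw [W.inner_tensor hT, W.inner_tensor hT, ← integral_prod_swap]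
  refine integral_congr_ae (Eventually.of_forall fun p => ?_)
  simp only [Prod.fst_swap, Prod.snd_swap]
  rw [← rieszKernel_neg, neg_sub]
  ring

/-- Each factor of the square carries one square root of the kernel. Smoothness of the quartic term
then reduces to that of a continuous bilinear map followed by a squared norm. -/
theorem W.integral_poissonPotential {T : W s V ε →L[ℝ] W s V ε →L[ℝ] L2prod N}
    (hT : ∀ u v, T u v =ᵐ[volume.prod volume] W.tensorFun α u v) (θ : ℝ) (u : W s V ε) :
    ∫ x, poissonPotential α θ ε u.fn x * u.fn x ^ 2 = ε ^ (α - θ) * ‖T u u‖ ^ 2 := by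
  rw [← real_inner_self_eq_norm_sq, W.inner_tensor hT]
  have hi : Integrable (fun p : RN N × RN N => (u.fn p.1 * u.fn p.1) * (u.fn p.2 * u.fn p.2) *
      rieszKernel α (p.1 - p.2)) (volume.prod volume) := by
    refine ((memLp_two_iff_integrable_sq (Lp.aestronglyMeasurable _)).mp
      (Lp.memLp (T u u))).congr ?_
    filter_upwards [hT u u] with p hp
    rw [hp, sq, W.tensorFun_mul]
  rw [integral_prod _ hi, ← integral_const_mul]
  refine integral_congr_ae (Eventually.of_forall fun x => ?_)
  simp only [poissonPotential]
  rw [mul_assoc]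
  congr 1
  rw [← integral_mul_const]
  refine integral_congr_ae (Eventually.of_forall fun y => ?_)
  simp only [rieszKernel]
  ring

theorem W.hasFDerivAt_norm_sq_tensor {T : W s V ε →L[ℝ] W s V ε →L[ℝ] L2prod N}
    (u : W s V ε) :
    HasFDerivAt (fun v => ‖T v v‖ ^ 2)
      ((2 : ℕ) • (innerSL ℝ (T u u)) ∘L (T u + T.flip u)) u := by
  have h1 : HasFDerivAt (fun v => T v v) (T u + T.flip u) u := by
    have := T.hasFDerivAt (x := u) |>.clm_apply (hasFDerivAt_id u)
    refine this.congr_fderiv ?_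
    ext v
    simp
  have := h1.norm_sq
  exact this

theorem W.contDiff_norm_sq_tensor {T : W s V ε →L[ℝ] W s V ε →L[ℝ] L2prod N} :
    ContDiff ℝ 1 (fun v => ‖T v v‖ ^ 2) :=
  (T.contDiff.clm_apply contDiff_id).norm_sq ℝ

end WSpace

/-! ### The energy, its derivative and the boundedness of Palais–Smale sequences. -/

section WSpace

variable {N : ℕ} {s : ℝ} {V : Potential N} {ε q α θ : ℝ} {f : ℝ → ℝ}
  {T : W s V ε →L[ℝ] W s V ε →L[ℝ] L2prod N}

theorem W.energy_eq (hT : ∀ u v, T u v =ᵐ[volume.prod volume] W.tensorFun α u v) (u : W s V ε) :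
    energy α θ f u = 1 / 2 * ‖u‖ ^ 2 + ε ^ (α - θ) / 4 * ‖T u u‖ ^ 2 -
      ∫ x, primitive f (u.fn x) := by
  rw [energy, W.integral_poissonPotential hT, W.norm_sq, L2.norm_sq]
  ring

theorem W.contDiff_energy (hq : 0 < q) (h2 : SobolevBound s V ε 2)
    (hp : SobolevBound s V ε (q + 1)) (hf : IsAdmissible f q)
    (hT : ∀ u v, T u v =ᵐ[volume.prod volume] W.tensorFun α u v) :
    ContDiff ℝ 1 (energy α θ f : W s V ε → ℝ) := by
  have h1 : ContDiff ℝ 1 (fun v : W s V ε => ∫ x, primitive f (v.fn x)) :=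
    contDiff_one_iff_hasFDerivAt.mpr ⟨W.nemytskii hq h2 hp hf.intermediate,
      W.continuous_nemytskii hq h2 hp hf.intermediate,
      W.hasFDerivAt_integral_primitive hq h2 hp hf⟩
  have h3 : (energy α θ f : W s V ε → ℝ) = fun u => 1 / 2 * ‖u‖ ^ 2 +
      ε ^ (α - θ) / 4 * ‖T u u‖ ^ 2 - ∫ x, primitive f (u.fn x) := funext (W.energy_eq hT)
  rw [h3]
  exact ((contDiff_const.mul (contDiff_id.norm_sq ℝ)).add
    (contDiff_const.mul W.contDiff_norm_sq_tensor)).sub h1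

theorem W.fderiv_energy_apply (hq : 0 < q) (h2 : SobolevBound s V ε 2)
    (hp : SobolevBound s V ε (q + 1)) (hf : IsAdmissible f q)
    (hT : ∀ u v, T u v =ᵐ[volume.prod volume] W.tensorFun α u v) (u z : W s V ε) :
    fderiv ℝ (energy α θ f : W s V ε → ℝ) u z =
      inner ℝ u z + ε ^ (α - θ) * inner ℝ (T u u) (T u z) - ∫ x, f (u.fn x) * z.fn x := by
  have h3 : (energy α θ f : W s V ε → ℝ) = fun u => 1 / 2 * ‖u‖ ^ 2 +
      ε ^ (α - θ) / 4 * ‖T u u‖ ^ 2 - ∫ x, primitive f (u.fn x) := funext (W.energy_eq hT)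
  have h4 := (((hasFDerivAt_id u).norm_sq.const_mul (1 / 2)).add
    ((W.hasFDerivAt_norm_sq_tensor (T := T) u).const_mul (ε ^ (α - θ) / 4))).sub
    (W.hasFDerivAt_integral_primitive hq h2 hp hf u)
  have h7 := W.inner_tensor_swap hT u u z u
  rw [h3]
  refine (congrArg (fun L : W s V ε →L[ℝ] ℝ => L z) h4.fderiv).trans ?_
  change (1 / 2 : ℝ) • ((2 : ℕ) • inner ℝ u z) +
    (ε ^ (α - θ) / 4) • ((2 : ℕ) • inner ℝ (T u u) (T u z + T z u)) -
    (∫ x, f (u.fn x) * z.fn x) = _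
  rw [inner_add_right, h7]
  simp only [smul_eq_mul, nsmul_eq_mul]
  push_cast
  ring

theorem W.integral_gap (hq : 0 < q) (h2 : SobolevBound s V ε 2)
    (hp : SobolevBound s V ε (q + 1)) (hf : IsAdmissible f q) (u : W s V ε) :
    ∫ x, gap f (u.fn x) =
      1 / 4 * (∫ x, f (u.fn x) * u.fn x) - ∫ x, primitive f (u.fn x) := by
  rw [← integral_const_mul, ← integral_sub
    ((W.integrable_nemytskii hq h2 hp hf.intermediate u u).const_mul _)
    (W.integrable_of_intermediate h2 hp hq (hf.intermediate_primitive hq.le) u)]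
  refine integral_congr_ae (Eventually.of_forall fun x => ?_)
  simp only [gap]
  ring

/-- The factor `1 / 4` is the reciprocal of the degree of the nonlocal term, which therefore
disappears; both terms left are nonnegative. -/
theorem W.energy_sub_fderiv (hq : 0 < q) (h2 : SobolevBound s V ε 2)
    (hp : SobolevBound s V ε (q + 1)) (hf : IsAdmissible f q)
    (hT : ∀ u v, T u v =ᵐ[volume.prod volume] W.tensorFun α u v) (u : W s V ε) :
    energy α θ f u - 1 / 4 * fderiv ℝ (energy α θ f : W s V ε → ℝ) u u =
      1 / 4 * ‖u‖ ^ 2 + ∫ x, gap f (u.fn x) := by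
  rw [W.fderiv_energy_apply hq h2 hp hf hT, W.energy_eq hT, W.integral_gap hq h2 hp hf,
    real_inner_self_eq_norm_sq,
    real_inner_self_eq_norm_sq]
  ring

theorem W.integral_gap_nonneg (hf : IsAdmissible f q) (u : W s V ε) :
    0 ≤ ∫ x, gap f (u.fn x) := integral_nonneg fun _ => hf.gap_nonneg _

/-- A sequence with bounded energy and bounded derivative of the energy is bounded. -/
theorem W.norm_le_of_energy_le (hq : 0 < q) (h2 : SobolevBound s V ε 2)
    (hp : SobolevBound s V ε (q + 1)) (hf : IsAdmissible f q)
    (hT : ∀ u v, T u v =ᵐ[volume.prod volume] W.tensorFun α u v) {u : W s V ε} {A : ℝ}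
    (hA : 0 ≤ A) (h1 : energy α θ f u ≤ A)
    (h3 : ‖fderiv ℝ (energy α θ f : W s V ε → ℝ) u‖ ≤ 1) : ‖u‖ ≤ 4 * A + 1 := by
  have h4 := W.energy_sub_fderiv (θ := θ) hq h2 hp hf hT u
  have h5 := W.integral_gap_nonneg hf u
  have h6 : |fderiv ℝ (energy α θ f : W s V ε → ℝ) u u| ≤ 1 * ‖u‖ :=
    (fderiv ℝ (energy α θ f : W s V ε → ℝ) u).le_of_opNorm_le h3 u
  have h7 := neg_abs_le (fderiv ℝ (energy α θ f : W s V ε → ℝ) u u)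
  have h8 : ‖u‖ ^ 2 ≤ 4 * A + ‖u‖ := by linarith
  by_contra h
  push Not at h
  nlinarith [norm_nonneg u]

end WSpace

/-! ### Vanishing of mixed terms for bounded, locally null sequences. -/

/-- Split at the threshold `A` with `A ^ (r - r') = η`: below it the square dominates, above it the
higher power. -/
theorem exists_rpow_le_interpolation {r r' : ℝ} (hr : 2 ≤ r) (hr' : r < r') {η : ℝ} (hη : 0 < η) :
    ∃ C, 0 ≤ C ∧ ∀ t, 0 ≤ t → t ^ r ≤ C * t ^ 2 + η * t ^ r' := by
  set A : ℝ := η ^ (1 / (r - r')) with hA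
  have hA0 : 0 < A := by positivity
  have hAη : A ^ (r - r') = η := by
    rw [hA, ← rpow_mul hη.le, one_div_mul_cancel (by linarith), rpow_one]
  refine ⟨A ^ (r - 2), by positivity, fun t ht => ?_⟩
  rcases ht.eq_or_lt with rfl | ht
  · rw [zero_rpow (by linarith), zero_rpow (by linarith)]; simp
  rcases le_total t A with h | h
  · have h1 : t ^ r = t ^ (r - 2) * t ^ 2 := by
      rw [← rpow_two, ← rpow_add ht, sub_add_cancel]
    have h2 : t ^ (r - 2) ≤ A ^ (r - 2) := rpow_le_rpow ht.le h (by linarith)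
    have h3 : 0 ≤ η * t ^ r' := by positivity
    nlinarith [sq_nonneg t]
  · have h1 : t ^ r = t ^ (r - r') * t ^ r' := by rw [← rpow_add ht, sub_add_cancel]
    have h2 : t ^ (r - r') ≤ η := by
      rw [← hAη]; exact rpow_le_rpow_of_nonpos hA0 h (by linarith)
    have h3 : 0 ≤ A ^ (r - 2) * t ^ 2 := by positivity
    have h4 : 0 ≤ t ^ r' := by positivity
    nlinarith

/-- Young's inequality with a small weight on one factor: compare `x` with `κ * y`, where `κ ^ a =
η`. -/
theorem exists_rpow_mul_rpow_le {a b : ℝ} (ha : 0 < a) (hb : 0 < b) {η : ℝ} (hη : 0 < η) :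
    ∃ C, 0 ≤ C ∧ ∀ x y, 0 ≤ x → 0 ≤ y →
      x ^ a * y ^ b ≤ η * y ^ (a + b) + C * x ^ (a + b) := by
  set κ : ℝ := η ^ (1 / a) with hκ
  have hκ0 : 0 < κ := by positivity
  have hκη : κ ^ a = η := by rw [hκ, ← rpow_mul hη.le, one_div_mul_cancel ha.ne', rpow_one]
  refine ⟨(κ ^ b)⁻¹, by positivity, fun x y hx hy => ?_⟩
  rw [rpow_add_of_nonneg hx ha.le hb.le, rpow_add_of_nonneg hy ha.le hb.le]
  have hxa := rpow_nonneg hx a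
  have hxb := rpow_nonneg hx b
  have hya := rpow_nonneg hy a
  have hyb := rpow_nonneg hy b
  rcases le_total x (κ * y) with h | h
  · have h1 : x ^ a ≤ η * y ^ a := by
      rw [← hκη, ← mul_rpow hκ0.le hy]; exact rpow_le_rpow hx h ha.le
    have h2 : 0 ≤ (κ ^ b)⁻¹ * (x ^ a * x ^ b) := by positivity
    nlinarith
  · have h1 : y ^ b ≤ (κ ^ b)⁻¹ * x ^ b := by
      rw [inv_mul_eq_div, le_div_iff₀ (by positivity), mul_comm, ← mul_rpow hκ0.le hy]
      exact rpow_le_rpow (by positivity) h hb.le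
    have h2 : 0 ≤ η * (y ^ a * y ^ b) := by positivity
    nlinarith

theorem exists_setIntegral_compl_ball_lt {N : ℕ} {g : RN N → ℝ} (hg : Integrable g volume) {η : ℝ}
    (hη : 0 < η) : ∃ R : ℝ, ∀ R' ≥ R, ∫ x in (Metric.ball 0 R')ᶜ, |g x| < η := by
  have h1 := tendsto_setIntegral_of_antitone (μ := (volume : Measure (RN N)))
    (s := fun n : ℕ => (Metric.ball (0 : RN N) n)ᶜ) (f := fun x => |g x|)
    (fun n => measurableSet_ball.compl)
    (fun m n hmn => compl_subset_compl.mpr (Metric.ball_subset_ball (by exact_mod_cast hmn)))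
    ⟨0, hg.abs.integrableOn⟩
  have h2 : ⋂ n : ℕ, (Metric.ball (0 : RN N) n)ᶜ = ∅ := by
    rw [← compl_iUnion, Metric.iUnion_ball_nat, compl_univ]
  rw [h2, setIntegral_empty] at h1
  obtain ⟨n, hn⟩ := (h1.eventually_lt_const hη).exists
  refine ⟨n, fun R' hR' => lt_of_le_of_lt ?_ hn⟩
  exact setIntegral_mono_set hg.abs.integrableOn (Eventually.of_forall fun x => abs_nonneg _)
    (Eventually.of_forall (compl_subset_compl.mpr (Metric.ball_subset_ball hR')))

theorem exists_pos_mul_le {A c : ℝ} (hA : 0 ≤ A) (hc : 0 < c) : ∃ η > 0, η * A ≤ c := by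
  refine ⟨c / (A + 1), by positivity, ?_⟩
  rw [div_mul_eq_mul_div, div_le_iff₀ (by positivity)]
  nlinarith

theorem tendsto_zero_of_forall_eventually_abs_le {a : ℕ → ℝ}
    (h : ∀ η > 0, ∀ᶠ n in atTop, |a n| ≤ η) : Tendsto a atTop (𝓝 0) := by
  rw [Metric.tendsto_nhds]
  intro η hη
  filter_upwards [h (η / 2) (half_pos hη)] with n hn
  rw [Real.dist_eq, sub_zero]
  linarith

section WSpace

variable {N : ℕ} {s : ℝ} {V : Potential N} {ε q α θ M : ℝ} {f : ℝ → ℝ} {v : ℕ → W s V ε}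

theorem SobolevBound.exists_bound {r : ℝ} (hr : 0 ≤ r) (h : SobolevBound s V ε r)
    (hM : ∀ n, ‖v n‖ ≤ M) : ∃ K, 0 ≤ K ∧ ∀ n, ∫ x, |(v n).fn x| ^ r ≤ K := by
  obtain ⟨C, hC, h⟩ := h
  have hM0 : 0 ≤ M := (norm_nonneg _).trans (hM 0)
  refine ⟨C * M ^ r, by positivity, fun n => (h (v n)).2.trans ?_⟩
  exact mul_le_mul_of_nonneg_left (rpow_le_rpow (norm_nonneg _) (hM n) hr) hC.le

theorem SobolevBound.integrable {r : ℝ} (h : SobolevBound s V ε r) (u : W s V ε) :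
    Integrable (fun x => |u.fn x| ^ r) volume := by
  obtain ⟨C, hC, h⟩ := h
  exact (h u).1

theorem W.integrable_fn_sq (u : W s V ε) : Integrable (fun x => u.fn x ^ 2) volume :=
  L2.integrable_sq _

/-- The spare exponent `r' > r`, in which the sequence stays bounded, controls the large values of
`v n`. -/
theorem W.tendsto_setIntegral_rpow {r r' : ℝ} (hr : 2 ≤ r) (hr' : r < r')
    (hSr : SobolevBound s V ε r) (hSr' : SobolevBound s V ε r') (hM : ∀ n, ‖v n‖ ≤ M)
    {S : Set (RN N)} (hS : Tendsto (fun n => ∫ x in S, (v n).fn x ^ 2) atTop (𝓝 0)) :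
    Tendsto (fun n => ∫ x in S, |(v n).fn x| ^ r) atTop (𝓝 0) := by
  obtain ⟨K, hK, hKb⟩ := hSr'.exists_bound (by linarith) hM
  refine tendsto_zero_of_forall_eventually_abs_le fun η hη => ?_
  obtain ⟨η₁, hη₁, hη₁K⟩ := exists_pos_mul_le hK (half_pos hη)
  obtain ⟨C, hC, hint⟩ := exists_rpow_le_interpolation hr hr' hη₁
  have h1 := hS.const_mul C
  rw [mul_zero] at h1
  filter_upwards [h1.eventually_lt_const (half_pos hη)] with n hn
  rw [abs_of_nonneg (integral_nonneg fun x => by positivity)]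
  calc ∫ x in S, |(v n).fn x| ^ r
      ≤ ∫ x in S, (C * (v n).fn x ^ 2 + η₁ * |(v n).fn x| ^ r') := by
        refine integral_mono (hSr.integrable _).integrableOn
          (((v n).integrable_fn_sq.const_mul C).integrableOn.add
            ((hSr'.integrable _).const_mul η₁).integrableOn) fun x => ?_
        have := hint _ (abs_nonneg ((v n).fn x))
        rwa [sq_abs] at this
    _ = C * (∫ x in S, (v n).fn x ^ 2) + η₁ * ∫ x in S, |(v n).fn x| ^ r' := by
      rw [integral_add ((v n).integrable_fn_sq.const_mul C).integrableOn
        ((hSr'.integrable _).const_mul η₁).integrableOn, integral_const_mul, integral_const_mul]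
    _ ≤ η / 2 + η₁ * K := by
      refine add_le_add hn.le (mul_le_mul_of_nonneg_left ?_ hη₁.le)
      exact (setIntegral_le_integral (hSr'.integrable _)
        (Eventually.of_forall fun x => by positivity)).trans (hKb n)
    _ ≤ η := by linarith

/-- A superposition operator of intermediate growth on a set where `v` tends to zero in `L²`. -/
theorem W.tendsto_setIntegral_intermediate {p r' : ℝ} {h : ℝ → ℝ} (hp2 : 2 ≤ p) (hpr : p < r')
    (hp : SobolevBound s V ε p) (hSr' : SobolevBound s V ε r') (hM : ∀ n, ‖v n‖ ≤ M)
    (hh : IsIntermediate 2 p h) {S : Set (RN N)}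
    (hS : Tendsto (fun n => ∫ x in S, (v n).fn x ^ 2) atTop (𝓝 0)) :
    Tendsto (fun n => ∫ x in S, h ((v n).fn x)) atTop (𝓝 0) := by
  obtain ⟨C, hC, hb⟩ := hh.bound (by linarith) one_pos
  have h1 := W.tendsto_setIntegral_rpow hp2 hpr hp hSr' hM hS
  have h2 := hS.add (h1.const_mul C)
  rw [mul_zero, add_zero] at h2
  refine squeeze_zero_norm (fun n => ?_) h2
  rw [← integral_const_mul, ← integral_add (v n).integrable_fn_sq.integrableOn
    ((hp.integrable _).const_mul C).integrableOn]
  refine norm_integral_le_of_norm_le ((v n).integrable_fn_sq.integrableOn.add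
    ((hp.integrable _).const_mul C).integrableOn) (Eventually.of_forall fun x => ?_)
  have := hb ((v n).fn x)
  rwa [rpow_two, sq_abs, one_mul] at this

theorem W.integrable_rpow_mul_rpow {a b : ℝ} (ha : 0 < a) (hb : 0 < b)
    (hab : SobolevBound s V ε (a + b)) (u z : W s V ε) :
    Integrable (fun x => |u.fn x| ^ a * |z.fn x| ^ b) volume := by
  obtain ⟨C, hC, h⟩ := exists_rpow_mul_rpow_le ha hb one_pos
  refine (((hab.integrable z).const_mul 1).add ((hab.integrable u).const_mul C)).mono'
    ((u.aesm.aemeasurable.norm.pow_const a).mul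
      (z.aesm.aemeasurable.norm.pow_const b)).aestronglyMeasurable
    (Eventually.of_forall fun x => ?_)
  rw [Real.norm_of_nonneg (by positivity)]
  exact h _ _ (abs_nonneg _) (abs_nonneg _)

/-- In a large ball `v n` is small, outside it the fixed `u` is small; in each region Young's
inequality puts its small weight on the other factor. -/
theorem W.tendsto_integral_rpow_mul_rpow {a b : ℝ} (ha : 0 < a) (hb : 0 < b)
    (hab : SobolevBound s V ε (a + b)) (hM : ∀ n, ‖v n‖ ≤ M)
    (hloc : ∀ R, Tendsto (fun n => ∫ x in Metric.ball 0 R, |(v n).fn x| ^ (a + b)) atTop (𝓝 0))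
    (u : W s V ε) : Tendsto (fun n => ∫ x, |u.fn x| ^ a * |(v n).fn x| ^ b) atTop (𝓝 0) := by
  obtain ⟨K, hK, hKb⟩ := hab.exists_bound (by linarith) hM
  set A : ℝ := ∫ x, |u.fn x| ^ (a + b) with hA
  have hA0 : 0 ≤ A := integral_nonneg fun x => by positivity
  refine tendsto_zero_of_forall_eventually_abs_le fun η hη => ?_
  have hη4 : 0 < η / 4 := by linarith
  obtain ⟨η₁, hη₁, hη₁K⟩ := exists_pos_mul_le hK hη4
  obtain ⟨C₁, hC₁, h₁⟩ := exists_rpow_mul_rpow_le ha hb hη₁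
  obtain ⟨η₂, hη₂, hη₂A⟩ := exists_pos_mul_le hA0 hη4
  obtain ⟨C₂, hC₂, h₂⟩ := exists_rpow_mul_rpow_le hb ha hη₂
  -- The tail of `u` must beat `C₁`, so the radius is chosen only after the Young weights.
  obtain ⟨τ, hτ, hτC⟩ := exists_pos_mul_le hC₁ hη4
  obtain ⟨R, hR⟩ := exists_setIntegral_compl_ball_lt (hab.integrable u) hτ
  have hR := hR R le_rfl
  have h3 := (hloc R).const_mul C₂
  rw [mul_zero] at h3
  filter_upwards [h3.eventually_lt_const hη4] with n hn
  have hi := W.integrable_rpow_mul_rpow ha hb hab u (v n)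
  rw [abs_of_nonneg (integral_nonneg fun x => by positivity),
    ← integral_add_compl (measurableSet_ball (x := (0 : RN N)) (ε := R)) hi]
  have h4 : ∫ x in Metric.ball 0 R, |u.fn x| ^ a * |(v n).fn x| ^ b ≤ η / 4 + η / 4 := by
    calc _ ≤ ∫ x in Metric.ball 0 R,
          (η₂ * |u.fn x| ^ (a + b) + C₂ * |(v n).fn x| ^ (a + b)) := by
          refine integral_mono hi.integrableOn (((hab.integrable u).const_mul η₂).integrableOn.add
            ((hab.integrable (v n)).const_mul C₂).integrableOn) fun x => ?_
          have := h₂ _ _ (abs_nonneg ((v n).fn x)) (abs_nonneg (u.fn x))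
          rw [add_comm b a] at this
          simp only
          linarith
      _ = η₂ * (∫ x in Metric.ball 0 R, |u.fn x| ^ (a + b)) +
          C₂ * ∫ x in Metric.ball 0 R, |(v n).fn x| ^ (a + b) := by
        rw [integral_add ((hab.integrable u).const_mul η₂).integrableOn
          ((hab.integrable (v n)).const_mul C₂).integrableOn, integral_const_mul,
          integral_const_mul]
      _ ≤ _ := by
        refine add_le_add (le_trans (mul_le_mul_of_nonneg_left ?_ hη₂.le) hη₂A) hn.le
        exact setIntegral_le_integral (hab.integrable u)
          (Eventually.of_forall fun x => by positivity)
  have h5 : ∫ x in (Metric.ball 0 R)ᶜ, |u.fn x| ^ a * |(v n).fn x| ^ b ≤ η / 4 + η / 4 := by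
    calc _ ≤ ∫ x in (Metric.ball 0 R)ᶜ,
          (η₁ * |(v n).fn x| ^ (a + b) + C₁ * |u.fn x| ^ (a + b)) := by
          refine integral_mono hi.integrableOn
            (((hab.integrable (v n)).const_mul η₁).integrableOn.add
            ((hab.integrable u).const_mul C₁).integrableOn) fun x => ?_
          exact h₁ _ _ (abs_nonneg (u.fn x)) (abs_nonneg ((v n).fn x))
      _ = η₁ * (∫ x in (Metric.ball 0 R)ᶜ, |(v n).fn x| ^ (a + b)) +
          C₁ * ∫ x in (Metric.ball 0 R)ᶜ, |u.fn x| ^ (a + b) := by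
        rw [integral_add ((hab.integrable (v n)).const_mul η₁).integrableOn
          ((hab.integrable u).const_mul C₁).integrableOn, integral_const_mul,
          integral_const_mul]
      _ ≤ _ := by
        refine add_le_add (le_trans (mul_le_mul_of_nonneg_left ?_ hη₁.le) hη₁K) ?_
        · exact (setIntegral_le_integral (hab.integrable (v n))
            (Eventually.of_forall fun x => by positivity)).trans (hKb n)
        · rw [mul_comm] at hτC
          refine le_trans (mul_le_mul_of_nonneg_left ?_ hC₁) hτC
          exact (integral_mono (hab.integrable u).integrableOn
            (hab.integrable u).abs.integrableOn fun x => le_abs_self _).trans hR.le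
  linarith

/-- The increment of `f` from `v n` to `v n + w` costs a small multiple of bounded quantities, plus
a large multiple of mixed integrals of `w` and `v n`, which vanish in the limit. -/
theorem W.tendsto_integral_nemytskii_sub (hq : 1 < q) {r' : ℝ} (hr' : q + 1 < r')
    (h2 : SobolevBound s V ε 2) (hp : SobolevBound s V ε (q + 1)) (hSr' : SobolevBound s V ε r')
    (hf : IsIntermediate 1 q f) (hM : ∀ n, ‖v n‖ ≤ M)
    (hloc : ∀ R, Tendsto (fun n => ∫ x in Metric.ball 0 R, (v n).fn x ^ 2) atTop (𝓝 0))
    (w : W s V ε) :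
    Tendsto (fun n => (∫ x, f ((v n + w).fn x) * (v n).fn x) - ∫ x, f ((v n).fn x) * (v n).fn x)
      atTop (𝓝 0) := by
  have hq0 : 0 < q := by linarith
  have hM0 : 0 ≤ M := (norm_nonneg _).trans (hM 0)
  have h2' : SobolevBound s V ε (1 + 1) := by rwa [one_add_one_eq_two]
  obtain ⟨D, hD, hint⟩ := h2.pairing_add hq0 hp
  have hw1 := W.tendsto_integral_rpow_mul_rpow one_pos one_pos h2' hM (fun R => by
    simpa only [one_add_one_eq_two, rpow_two, sq_abs] using hloc R) w
  have hw2 := W.tendsto_integral_rpow_mul_rpow hq0 one_pos hp hM (fun R =>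
    W.tendsto_setIntegral_rpow (by linarith) hr' hp hSr' hM (hloc R)) w
  have hw := hw1.add hw2
  rw [add_zero] at hw
  have hwe : ∀ n, (∫ x, |w.fn x| ^ (1 : ℝ) * |(v n).fn x| ^ (1 : ℝ)) +
      (∫ x, |w.fn x| ^ q * |(v n).fn x| ^ (1 : ℝ)) =
      ∫ x, (|w.fn x| ^ (1 : ℝ) + |w.fn x| ^ q) * |(v n).fn x| := fun n => by
    rw [← integral_add (W.integrable_rpow_mul_rpow one_pos one_pos h2' w (v n))
      (W.integrable_rpow_mul_rpow hq0 one_pos hp w (v n))]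
    refine integral_congr_ae (Eventually.of_forall fun x => ?_)
    simp only [rpow_one]
    ring
  simp only [hwe] at hw
  refine tendsto_zero_of_forall_eventually_abs_le fun η hη => ?_
  obtain ⟨η₁, hη₁, hη₁b⟩ := exists_pos_mul_le
    (A := D * (M ^ (1 : ℝ) + M ^ q) * M) (by positivity) (half_pos hη)
  obtain ⟨C, hC, hinc⟩ := hf.increment zero_le_one hq0.le hη₁
  have hw' := hw.const_mul C
  rw [mul_zero] at hw'
  filter_upwards [hw'.eventually_lt_const (half_pos hη)] with n hn
  rw [← integral_sub (W.integrable_nemytskii hq0 h2 hp hf _ _)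
    (W.integrable_nemytskii hq0 h2 hp hf _ _)]
  have hi := ((hint (v n) (v n)).1.const_mul η₁).add ((hint w (v n)).1.const_mul C)
  calc |∫ x, (f ((v n + w).fn x) * (v n).fn x - f ((v n).fn x) * (v n).fn x)|
      ≤ ∫ x, (η₁ * ((|(v n).fn x| ^ (1 : ℝ) + |(v n).fn x| ^ q) * |(v n).fn x|) +
        C * ((|w.fn x| ^ (1 : ℝ) + |w.fn x| ^ q) * |(v n).fn x|)) := by
        refine (Real.norm_eq_abs _).symm.trans_le (norm_integral_le_of_norm_le hi ?_)
        filter_upwards [W.fn_add (v n) w] with x hx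
        rw [hx, ← sub_mul, norm_mul, Real.norm_eq_abs, Real.norm_eq_abs, ← mul_assoc, ← mul_assoc,
          ← add_mul]
        exact mul_le_mul_of_nonneg_right (hinc _ _) (abs_nonneg _)
    _ = η₁ * (∫ x, (|(v n).fn x| ^ (1 : ℝ) + |(v n).fn x| ^ q) * |(v n).fn x|) +
        C * ∫ x, (|w.fn x| ^ (1 : ℝ) + |w.fn x| ^ q) * |(v n).fn x| := by
      rw [integral_add ((hint (v n) (v n)).1.const_mul η₁) ((hint w (v n)).1.const_mul C),
        integral_const_mul, integral_const_mul]
    _ ≤ η₁ * (D * (M ^ (1 : ℝ) + M ^ q) * M) + η / 2 := by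
      refine add_le_add (mul_le_mul_of_nonneg_left ((hint (v n) (v n)).2.trans ?_) hη₁.le) hn.le
      have := hM n
      gcongr
    _ ≤ η := by linarith

/-- A one-sided Brezis–Lieb estimate. Outside a large ball `w` is negligible; inside it the gap of
`v n` tends to zero and that of `v n + w` is nonnegative. -/
theorem W.eventually_integral_gap_le (hq : 1 < q) {r' : ℝ} (hr' : q + 1 < r')
    (h2 : SobolevBound s V ε 2) (hp : SobolevBound s V ε (q + 1)) (hSr' : SobolevBound s V ε r')
    (hf : IsAdmissible f q) (hM : ∀ n, ‖v n‖ ≤ M)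
    (hloc : ∀ R, Tendsto (fun n => ∫ x in Metric.ball 0 R, (v n).fn x ^ 2) atTop (𝓝 0))
    (w : W s V ε) {η : ℝ} (hη : 0 < η) :
    ∀ᶠ n in atTop, ∫ x, gap f ((v n).fn x) ≤ (∫ x, gap f ((v n + w).fn x)) + η := by
  have hq0 : 0 < q := by linarith
  have hG := hf.intermediate_gap hq0.le
  have hGi := W.integrable_of_intermediate h2 hp hq0 hG
  have hωi : ∀ u : W s V ε, Integrable (fun x => |u.fn x| ^ (2 : ℝ) + |u.fn x| ^ (q + 1)) volume :=
    fun u => (h2.integrable u).add (hp.integrable u)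
  obtain ⟨K, hK, hKb⟩ := h2.exists_bound zero_le_two hM
  obtain ⟨L, hL, hLb⟩ := hp.exists_bound (by linarith) hM
  have hη3 : 0 < η / 3 := by linarith
  obtain ⟨η₁, hη₁, hη₁b⟩ := exists_pos_mul_le (add_nonneg hK hL) hη3
  obtain ⟨C, hC, hinc⟩ := hG.increment zero_le_two (by linarith) hη₁
  obtain ⟨τ, hτ, hτC⟩ := exists_pos_mul_le hC hη3
  obtain ⟨R, hR⟩ := exists_setIntegral_compl_ball_lt (hωi w) hτ
  have hR := hR R le_rfl
  have h1 := W.tendsto_setIntegral_intermediate (by linarith) hr' hp hSr' hM hG (hloc R)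
  filter_upwards [h1.eventually_lt_const hη3] with n hn
  have hS := measurableSet_ball (x := (0 : RN N)) (ε := R)
  rw [← integral_add_compl hS (hGi (v n)), ← integral_add_compl hS (hGi (v n + w))]
  have h3 : 0 ≤ ∫ x in Metric.ball 0 R, gap f ((v n + w).fn x) :=
    integral_nonneg fun x => hf.gap_nonneg _
  have h4 : (∫ x in (Metric.ball 0 R)ᶜ, gap f ((v n).fn x)) -
      (∫ x in (Metric.ball 0 R)ᶜ, gap f ((v n + w).fn x)) ≤ η / 3 + η / 3 := by
    rw [← integral_sub (hGi _).integrableOn (hGi _).integrableOn]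
    calc _ ≤ ∫ x in (Metric.ball 0 R)ᶜ, (η₁ * (|(v n).fn x| ^ (2 : ℝ) + |(v n).fn x| ^ (q + 1)) +
          C * (|w.fn x| ^ (2 : ℝ) + |w.fn x| ^ (q + 1))) := by
          refine integral_mono_ae ((hGi _).sub (hGi _)).integrableOn
            (((hωi _).const_mul η₁).add ((hωi w).const_mul C)).integrableOn (ae_restrict_of_ae ?_)
          filter_upwards [W.fn_add (v n) w] with x hx
          have := hinc ((v n).fn x) (w.fn x)
          rw [← hx, abs_sub_comm] at this
          exact (le_abs_self _).trans this
      _ = η₁ * (∫ x in (Metric.ball 0 R)ᶜ, (|(v n).fn x| ^ (2 : ℝ) + |(v n).fn x| ^ (q + 1))) +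
          C * ∫ x in (Metric.ball 0 R)ᶜ, (|w.fn x| ^ (2 : ℝ) + |w.fn x| ^ (q + 1)) := by
        rw [integral_add ((hωi _).const_mul η₁).integrableOn
          ((hωi w).const_mul C).integrableOn, integral_const_mul, integral_const_mul]
      _ ≤ _ := by
        refine add_le_add (le_trans (mul_le_mul_of_nonneg_left ?_ hη₁.le) hη₁b) ?_
        · refine (setIntegral_le_integral (hωi _)
            (Eventually.of_forall fun x => by positivity)).trans ?_
          rw [integral_add (h2.integrable _) (hp.integrable _)]
          exact add_le_add (hKb n) (hLb n)
        · rw [mul_comm] at hτC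
          refine le_trans (mul_le_mul_of_nonneg_left ?_ hC) hτC
          exact (integral_mono (hωi w).integrableOn
            (hωi w).abs.integrableOn fun x => le_abs_self _).trans hR.le
  linarith

/-- Apply the Riesz bound with `a = (u n)²` and `b = |w * v n|`: a small `τ` handles the `L⁴` norm
of `u n`, while the `L¹` and `L²` norms of `b` tend to zero. -/
theorem W.tendsto_inner_tensor (hN : 0 < N) (hα : 0 < α) (hαN : α < N) {r' : ℝ} (hr' : 4 < r')
    (h2 : SobolevBound s V ε (2 : ℕ)) (h4 : SobolevBound s V ε (4 : ℕ))
    (hSr' : SobolevBound s V ε r') {T : W s V ε →L[ℝ] W s V ε →L[ℝ] L2prod N}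
    (hT : ∀ u v, T u v =ᵐ[volume.prod volume] W.tensorFun α u v) (hM : ∀ n, ‖v n‖ ≤ M)
    (hloc : ∀ R, Tendsto (fun n => ∫ x in Metric.ball 0 R, (v n).fn x ^ 2) atTop (𝓝 0))
    (w : W s V ε) {u : ℕ → W s V ε} {M' : ℝ} (hu : ∀ n, ‖u n‖ ≤ M') :
    Tendsto (fun n => inner ℝ (T (u n) w) (T (u n) (v n))) atTop (𝓝 0) := by
  have hM' : 0 ≤ M' := (norm_nonneg _).trans (hu 0)
  have e2 : SobolevBound s V ε (1 + 1) := by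
    rw [one_add_one_eq_two]; exact_mod_cast h2
  have e4 : SobolevBound s V ε (2 + 2) := by
    rw [show (2 : ℝ) + 2 = ((4 : ℕ) : ℝ) by norm_num]; exact h4
  have hw1 := W.tendsto_integral_rpow_mul_rpow one_pos one_pos e2 hM (fun R => by
    simpa only [one_add_one_eq_two, rpow_two, sq_abs] using hloc R) w
  have hw2 := W.tendsto_integral_rpow_mul_rpow two_pos two_pos e4 hM (fun R =>
    W.tendsto_setIntegral_rpow (by norm_num) (by linarith) e4 hSr' hM (hloc R)) w
  have i1 := fun n => W.integrable_rpow_mul_rpow one_pos one_pos e2 w (v n)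
  have i2 := fun n => W.integrable_rpow_mul_rpow two_pos two_pos e4 w (v n)
  have e5 : ∀ n x, |w.fn x| ^ (1 : ℝ) * |(v n).fn x| ^ (1 : ℝ) = |w.fn x * (v n).fn x| :=
    fun n x => by rw [rpow_one, rpow_one, abs_mul]
  have e6 : ∀ n x, |w.fn x| ^ (2 : ℝ) * |(v n).fn x| ^ (2 : ℝ) = |w.fn x * (v n).fn x| ^ 2 :=
    fun n x => by rw [rpow_two, rpow_two, abs_mul, mul_pow]
  simp only [e5] at hw1 i1
  simp only [e6] at hw2 i2
  obtain ⟨K, hK, hriesz⟩ := exists_riesz_bound hN hα hαN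
  obtain ⟨C, hC, hC2⟩ := h2.integral_pow_le even_two
  obtain ⟨D, hD, hD4⟩ := h4.integral_pow_le (by decide)
  have u4 : ∀ z : W s V ε, Integrable (fun x => (z.fn x ^ 2) ^ 2) volume := fun z => by
    simp only [← pow_mul]; exact h4.integrable_pow (by decide) z
  refine tendsto_zero_of_forall_eventually_abs_le fun η hη => ?_
  have hη3 : 0 < η / 3 := by linarith
  obtain ⟨τ, hτ, hτb⟩ := exists_pos_mul_le (A := K * (D * M' ^ 4)) (by positivity) hη3
  have hw1' := hw1.const_mul (C * M' ^ 2)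
  have hw2' := hw2.const_mul (K * τ⁻¹)
  rw [mul_zero] at hw1' hw2'
  filter_upwards [hw1'.eventually_lt_const hη3, hw2'.eventually_lt_const hη3] with n hn1 hn2
  obtain ⟨hri, hrb⟩ := hriesz (fun x => (u n).fn x ^ 2) (fun x => |w.fn x * (v n).fn x|)
    (fun x => sq_nonneg _) (fun x => abs_nonneg _) (h2.integrable_pow even_two (u n)) (i1 n)
    (u4 (u n)) (i2 n)
  rw [W.inner_tensor hT]
  refine ((Real.norm_eq_abs _).symm.trans_le (norm_integral_le_of_norm_le hri
    (Eventually.of_forall fun p => ?_))).trans ((hrb τ hτ).trans ?_)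
  · rw [norm_mul, norm_mul, Real.norm_of_nonneg (mul_self_nonneg _),
      Real.norm_of_nonneg (rieszKernel_nonneg _), Real.norm_eq_abs, ← sq]
  · have f1 : (∫ x, (u n).fn x ^ 2) ≤ C * M' ^ 2 :=
      (hC2 (u n)).trans (mul_le_mul_of_nonneg_left
        (pow_le_pow_left₀ (norm_nonneg _) (hu n) 2) hC.le)
    have f2 : (∫ x, ((u n).fn x ^ 2) ^ 2) ≤ D * M' ^ 4 := by
      simp only [← pow_mul]
      exact (hD4 (u n)).trans (mul_le_mul_of_nonneg_left
        (pow_le_pow_left₀ (norm_nonneg _) (hu n) 4) hD.le)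
    have f3 : 0 ≤ ∫ x, |w.fn x * (v n).fn x| := integral_nonneg fun x => abs_nonneg _
    have f4 := mul_le_mul_of_nonneg_right f1 f3
    have f5 := mul_le_mul_of_nonneg_left f2 (mul_nonneg hK hτ.le)
    linarith

/-! ### Comparison with the ground level of the limit problem. -/

variable {μ : ℝ}

theorem W.toHs_ne_zero {w : W s V ε} (hw : w ≠ 0) : W.toHs w ≠ 0 := fun h =>
  hw (Subtype.ext h)

theorem W.norm_fracLap_smul (r : ℝ) (w : W s V ε) :
    ‖fracLap s (W.toHs (r • w))‖ ^ 2 = r ^ 2 * ‖fracLap s (W.toHs w)‖ ^ 2 := by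
  rw [map_smul, map_smul, norm_smul, mul_pow, Real.norm_eq_abs, sq_abs]

theorem W.integral_sq_smul (r : ℝ) (w : W s V ε) :
    ∫ x, (r • w).fn x ^ 2 = r ^ 2 * ∫ x, w.fn x ^ 2 := by
  rw [← integral_const_mul]
  refine integral_congr_ae ?_
  filter_upwards [W.fn_smul r w] with x hx
  rw [hx, mul_pow]

/-- Projection on the Nehari manifold: the ground level of the limit problem is bounded by the
value of `‖w‖² / 4 + ∫ (f(w) w / 4 - F(w))` at every `w ≠ 0` inside the Nehari manifold. -/
theorem W.limitGroundLevel_le (hq : 1 < q) (h2 : SobolevBound s V ε 2)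
    (hp : SobolevBound s V ε (q + 1)) (hf : IsAdmissible f q) (hμ : 0 < μ) {w : W s V ε}
    (hw : w ≠ 0) (hle : ‖fracLap s (W.toHs w)‖ ^ 2 + μ * (∫ x, w.fn x ^ 2) ≤
      ∫ x, f (w.fn x) * w.fn x) :
    limitGroundLevel N s f μ ≤
      ((1 / 4 * (‖fracLap s (W.toHs w)‖ ^ 2 + μ * (∫ x, w.fn x ^ 2)) +
        ∫ x, gap f (w.fn x) : ℝ) : EReal) := by
  have hq0 : 0 < q := by linarith
  set Q : ℝ := ‖fracLap s (W.toHs w)‖ ^ 2 + μ * (∫ x, w.fn x ^ 2) with hQ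
  have hS : 0 < ∫ x, w.fn x ^ 2 := by
    have h1 : (W.toHs w : L2 N) ≠ 0 := fun h => W.toHs_ne_zero hw (Subtype.ext h)
    have h3 : ∫ x, w.fn x ^ 2 = ‖(W.toHs w : L2 N)‖ ^ 2 := (L2.norm_sq _).symm
    rw [h3]
    have := norm_pos_iff.mpr h1
    positivity
  have hQS : μ * (∫ x, w.fn x ^ 2) ≤ Q := by
    have := sq_nonneg ‖fracLap s (W.toHs w)‖
    linarith
  have hQ0 : 0 < Q := (mul_pos hμ hS).trans_le hQS
  -- A zero of `φ` in `(0, 1]` puts `r • w` on the Nehari manifold. At `1` the sign is the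
  -- hypothesis; near `0` the linear part of `f` is at most `μ / 2`, hence absorbed by half of `Q`.
  set φ : ℝ → ℝ := fun r => W.nemytskii hq0 h2 hp hf.intermediate (r • w) w - r * Q with hφ
  have hφc : Continuous φ := by
    have h1 : Continuous fun r : ℝ => r • w := continuous_id.smul continuous_const
    have h3 := (W.continuous_nemytskii hq0 h2 hp hf.intermediate).comp h1
    exact (h3.clm_apply continuous_const).sub (continuous_id.mul continuous_const)
  obtain ⟨r₀, hr₀, hr₀1, hφr₀⟩ : ∃ r₀ : ℝ, 0 < r₀ ∧ r₀ ≤ 1 ∧ φ r₀ ≤ 0 := by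
    obtain ⟨C, hC, hb⟩ := hf.intermediate.bound hq0.le (η := μ / 2) (by linarith)
    set P : ℝ := ∫ x, |w.fn x| ^ (q + 1) with hP
    have h1 : Tendsto (fun r : ℝ => C * P * r ^ (q - 1)) (𝓝 0) (𝓝 (C * P * 0 ^ (q - 1))) :=
      ((continuousAt_rpow_const 0 (q - 1) (Or.inr (by linarith))).tendsto).const_mul _
    rw [zero_rpow (by linarith), mul_zero] at h1
    obtain ⟨δ, hδ, h3⟩ := Metric.eventually_nhds_iff.mp
      (h1.eventually_lt_const (u := Q / 2) (by linarith))
    set r := min (δ / 2) 1 with hr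
    have hr0 : 0 < r := by positivity
    have hrδ : r < δ := (min_le_left _ _).trans_lt (by linarith)
    have h4 := h3 (y := r) (by rw [Real.dist_eq, sub_zero, abs_of_pos hr0]; exact hrδ)
    refine ⟨r, hr0, min_le_right _ _, ?_⟩
    have h5 : ∫ x, f ((r • w).fn x) * w.fn x ≤
        ∫ x, (μ / 2 * r * w.fn x ^ 2 + C * r ^ q * |w.fn x| ^ (q + 1)) := by
      refine integral_mono_ae (W.integrable_nemytskii hq0 h2 hp hf.intermediate _ _)
        ((w.integrable_fn_sq.const_mul _).add ((hp.integrable w).const_mul _)) ?_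
      filter_upwards [W.fn_smul r w] with x hx
      simp only [hx]
      have h6 := mul_le_mul_of_nonneg_right (hb (r * w.fn x)) (abs_nonneg (w.fn x))
      have h7 : f (r * w.fn x) * w.fn x ≤ |f (r * w.fn x)| * |w.fn x| := by
        rw [← abs_mul]; exact le_abs_self _
      rw [rpow_one, abs_mul, abs_of_pos hr0, mul_rpow hr0.le (abs_nonneg _)] at h6
      rw [rpow_add_of_nonneg (abs_nonneg _) hq0.le zero_le_one, rpow_one, ← sq_abs]
      refine h7.trans (h6.trans_eq ?_)
      ring
    rw [integral_add (w.integrable_fn_sq.const_mul _) ((hp.integrable w).const_mul _),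
      integral_const_mul, integral_const_mul] at h5
    have h8 : r ^ q = r * r ^ (q - 1) := by
      rw [← rpow_one_add' hr0.le (by linarith)]; congr 1; ring
    rw [h8] at h5
    have h9 := mul_le_mul_of_nonneg_left h4.le hr0.le
    have h10 := mul_le_mul_of_nonneg_left hQS hr0.le
    rw [hφ]
    simp only [W.nemytskii_apply]
    linarith
  have hφ1 : 0 ≤ φ 1 := by
    simp only [hφ, one_smul, W.nemytskii_apply, one_mul]
    linarith
  obtain ⟨r, ⟨hr1, hr2⟩, hr⟩ := intermediate_value_Icc hr₀1 hφc.continuousOn ⟨hφr₀, hφ1⟩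
  have hr0 : 0 < r := hr₀.trans_le hr1
  have hfr : ∫ x, f ((r • w).fn x) * (r • w).fn x = r ^ 2 * Q := by
    have h1 : ∫ x, f ((r • w).fn x) * (r • w).fn x = r * ∫ x, f ((r • w).fn x) * w.fn x := by
      rw [← integral_const_mul]
      refine integral_congr_ae ?_
      filter_upwards [W.fn_smul r w] with x hx
      rw [hx]
      ring
    have h3 : (∫ x, f ((r • w).fn x) * w.fn x) - r * Q = 0 := hr
    rw [h1]
    linear_combination r * h3
  have hmem : W.toHs (r • w) ∈ limitNehari N s f μ := by
    refine ⟨W.toHs_ne_zero (smul_ne_zero hr0.ne' hw), ?_⟩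
    change _ + μ * (∫ x, (r • w).fn x ^ 2) = ∫ x, f ((r • w).fn x) * (r • w).fn x
    rw [hfr, ← L2.norm_sq, W.norm_fracLap_smul, W.integral_sq_smul]
    ring
  refine (iInf₂_le (W.toHs (r • w)) hmem).trans (EReal.coe_le_coe_iff.mpr ?_)
  -- On the Nehari manifold the energy takes this form, which is nondecreasing in `r`, so that `r ≤
  -- 1` gives the claim.
  have h1 : limitEnergy f μ (W.toHs (r • w)) =
      1 / 4 * (r ^ 2 * Q) + ∫ x, gap f ((r • w).fn x) := by
    rw [W.integral_gap hq0 h2 hp hf, hfr]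
    change 1 / 2 * (∫ x, fracLap s (W.toHs (r • w)) x ^ 2) +
      μ / 2 * (∫ x, (r • w).fn x ^ 2) - (∫ x, primitive f ((r • w).fn x)) = _
    rw [← L2.norm_sq, W.norm_fracLap_smul, W.integral_sq_smul]
    ring
  rw [h1]
  have hG := W.integrable_of_intermediate h2 hp hq0 (hf.intermediate_gap hq0.le)
  refine add_le_add ?_ (integral_mono_ae (hG _) (hG _) ?_)
  · have : r ^ 2 ≤ 1 := pow_le_one₀ hr0.le hr2
    nlinarith
  · filter_upwards [W.fn_smul r w] with x hx
    rw [hx]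
    exact hf.gap_mul_le hr0 hr2 _

/-- The price of dilating by `1 + t`, uniformly on bounded sets: the increment `t * u` has powers at
most `t` times those of `u`, as `t ≤ 1` and the exponents are at least one. -/
theorem W.exists_integral_gap_smul_le (hq : 1 < q) (h2 : SobolevBound s V ε 2)
    (hp : SobolevBound s V ε (q + 1)) (hf : IsAdmissible f q) (hM : 0 ≤ M) {d : ℝ} (hd : 0 < d) :
    ∃ δ : ℝ, 0 < δ ∧ ∀ t : ℝ, 0 ≤ t → t ≤ δ → t ≤ 1 → ∀ u : W s V ε, ‖u‖ ≤ M →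
      ∫ x, gap f (((1 + t) • u).fn x) ≤ (∫ x, gap f (u.fn x)) + d := by
  have hq0 : 0 < q := by linarith
  have hG := hf.intermediate_gap hq0.le
  have hGi := W.integrable_of_intermediate h2 hp hq0 hG
  obtain ⟨C, hC, hCb⟩ := h2
  obtain ⟨D, hD, hDb⟩ := hp
  set A : ℝ := C * M ^ (2 : ℝ) + D * M ^ (q + 1) with hA
  have hA0 : 0 ≤ A := by positivity
  obtain ⟨η, hη, hηA⟩ := exists_pos_mul_le hA0 (half_pos hd)
  obtain ⟨B, hB, hinc⟩ := hG.increment zero_le_two (by linarith) hη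
  obtain ⟨δ, hδ, hδB⟩ := exists_pos_mul_le (mul_nonneg hB hA0) (half_pos hd)
  refine ⟨δ, hδ, fun t ht htδ ht1 u hu => ?_⟩
  have hi : Integrable (fun x => |u.fn x| ^ (2 : ℝ) + |u.fn x| ^ (q + 1)) volume :=
    (hCb u).1.add (hDb u).1
  have h1 : ∫ x, (|u.fn x| ^ (2 : ℝ) + |u.fn x| ^ (q + 1)) ≤ A := by
    rw [integral_add (hCb u).1 (hDb u).1]
    refine add_le_add ((hCb u).2.trans ?_) ((hDb u).2.trans ?_) <;> gcongr
  have h3 : (∫ x, gap f (((1 + t) • u).fn x)) - (∫ x, gap f (u.fn x)) ≤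
      (η + B * t) * ∫ x, (|u.fn x| ^ (2 : ℝ) + |u.fn x| ^ (q + 1)) := by
    rw [← integral_sub (hGi _) (hGi _), ← integral_const_mul]
    refine integral_mono_ae ((hGi _).sub (hGi _)) (hi.const_mul _) ?_
    filter_upwards [W.fn_smul (1 + t) u] with x hx
    simp only [hx]
    have h4 := hinc (u.fn x) (t * u.fn x)
    have h5 : (1 + t) * u.fn x = u.fn x + t * u.fn x := by ring
    rw [h5]
    refine (le_abs_self _).trans (h4.trans ?_)
    rw [abs_mul, abs_of_nonneg ht, mul_rpow ht (abs_nonneg _), mul_rpow ht (abs_nonneg _)]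
    have h6 : ∀ a : ℝ, 1 ≤ a → t ^ a ≤ t := fun a ha => by
      rcases ht.eq_or_lt with rfl | ht
      · rw [zero_rpow (by linarith)]
      · calc t ^ a ≤ t ^ (1 : ℝ) := rpow_le_rpow_of_exponent_ge ht ht1 ha
          _ = t := rpow_one t
    have h7 := mul_le_mul_of_nonneg_right (h6 2 one_le_two)
      (rpow_nonneg (abs_nonneg (u.fn x)) 2)
    have h8 := mul_le_mul_of_nonneg_right (h6 (q + 1) (by linarith))
      (rpow_nonneg (abs_nonneg (u.fn x)) (q + 1))
    have h9 := mul_le_mul_of_nonneg_left (add_le_add h7 h8) hB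
    linarith
  have h4 : (η + B * t) * (∫ x, (|u.fn x| ^ (2 : ℝ) + |u.fn x| ^ (q + 1))) ≤ (η + B * t) * A :=
    mul_le_mul_of_nonneg_left h1 (by positivity)
  have h5 : t * (B * A) ≤ δ * (B * A) := mul_le_mul_of_nonneg_right htδ (mul_nonneg hB hA0)
  linarith

/-- A bounded, locally null sequence of asymptotic solutions of energy at most `c`, where `c` is
below the ground level of the limit problem, tends to zero. -/
theorem W.tendsto_zero_of_lt_limitGroundLevel (hq : 1 < q) (h2 : SobolevBound s V ε 2)
    (hp : SobolevBound s V ε (q + 1)) (hf : IsAdmissible f q) (hμ : 0 < μ)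
    (hM : ∀ n, ‖v n‖ ≤ M) {c : ℝ} (hc : (c : EReal) < limitGroundLevel N s f μ)
    (hder : ∀ η > 0, ∀ᶠ n in atTop, ‖v n‖ ^ 2 ≤ (∫ x, f ((v n).fn x) * (v n).fn x) + η)
    (hval : ∀ η > 0, ∀ᶠ n in atTop, 1 / 4 * ‖v n‖ ^ 2 + (∫ x, gap f ((v n).fn x)) ≤ c + η)
    (hpot : ∀ η > 0, ∀ᶠ n in atTop,
      μ * (∫ x, (v n).fn x ^ 2) ≤ (∫ x, V (ε • x) * (v n).fn x ^ 2) + η) :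
    Tendsto v atTop (𝓝 0) := by
  have hq0 : 0 < q := by linarith
  have hM0 : 0 ≤ M := (norm_nonneg _).trans (hM 0)
  by_contra hcon
  have hcon' : ∃ ρ > 0, ∃ᶠ n in atTop, ρ ≤ ‖v n‖ := by
    by_contra h
    push Not at h
    refine hcon (tendsto_zero_iff_norm_tendsto_zero.mpr
      (tendsto_zero_of_forall_eventually_abs_le fun η hη => ?_))
    filter_upwards [h η hη] with n hn
    rw [abs_of_nonneg (norm_nonneg _)]
    exact hn.le
  obtain ⟨ρ, hρ, hfreq⟩ := hcon'
  obtain ⟨c', hcc', hc'⟩ := EReal.lt_iff_exists_real_btwn.mp hc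
  have hcc : c < c' := EReal.coe_lt_coe_iff.mp hcc'
  set e : ℝ := c' - c with he
  have he0 : 0 < e := by linarith
  obtain ⟨δ, hδ, hscale⟩ := W.exists_integral_gap_smul_le hq h2 hp hf hM0 (d := e / 4) (by linarith)
  obtain ⟨δ', hδ', hδM⟩ := exists_pos_mul_le (A := M ^ 2) (c := e / 4) (by positivity)
    (by linarith)
  set τ : ℝ := min δ (min δ' 1) with hτ
  have hτ0 : 0 < τ := lt_min hδ (lt_min hδ' one_pos)
  have hτδ : τ ≤ δ := min_le_left _ _
  have hτδ' : τ ≤ δ' := (min_le_right _ _).trans (min_le_left _ _)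
  have hτ1 : τ ≤ 1 := (min_le_right _ _).trans (min_le_right _ _)
  -- The three bounds keep, in order, the final value below `c'`, the dilated function on or inside
  -- the Nehari manifold, and `X` at least `ρ ^ 2 / 2`.
  set η : ℝ := min (e / 16) (min (τ * ρ ^ 2 / 2) (ρ ^ 2 / 2)) with hη
  have hη0 : 0 < η := by positivity
  have hη1 : η ≤ e / 16 := min_le_left _ _
  have hη2 : η ≤ τ * ρ ^ 2 / 2 := (min_le_right _ _).trans (min_le_left _ _)
  have hη3 : η ≤ ρ ^ 2 / 2 := (min_le_right _ _).trans (min_le_right _ _)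
  obtain ⟨n, hn, h3, h4, h5⟩ := (hfreq.and_eventually
    ((hder η hη0).and ((hval η hη0).and (hpot η hη0)))).exists
  set u := v n with hu
  set X : ℝ := ∫ x, f (u.fn x) * u.fn x with hX
  have hu0 : u ≠ 0 := norm_pos_iff.mp (hρ.trans_le hn)
  have hρu : ρ ^ 2 ≤ ‖u‖ ^ 2 := pow_le_pow_left₀ hρ.le hn 2
  have hXρ : ρ ^ 2 / 2 ≤ X := by linarith
  have hnorm := W.norm_sq u
  set Q : ℝ := ‖fracLap s (W.toHs u)‖ ^ 2 + μ * (∫ x, u.fn x ^ 2) with hQ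
  have hQu : Q ≤ ‖u‖ ^ 2 + η := by linarith
  have ht0 : 0 < 1 + τ := by linarith
  have hQt : ‖fracLap s (W.toHs ((1 + τ) • u))‖ ^ 2 +
      μ * (∫ x, ((1 + τ) • u).fn x ^ 2) = (1 + τ) ^ 2 * Q := by
    rw [W.norm_fracLap_smul, W.integral_sq_smul]; ring
  have hXt : (1 + τ) ^ 4 * X ≤ ∫ x, f (((1 + τ) • u).fn x) * ((1 + τ) • u).fn x := by
    rw [hX, ← integral_const_mul]
    refine integral_mono_ae ((W.integrable_nemytskii hq0 h2 hp hf.intermediate u u).const_mul _)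
      (W.integrable_nemytskii hq0 h2 hp hf.intermediate _ _) ?_
    filter_upwards [W.fn_smul (1 + τ) u] with x hx
    simp only [hx]
    exact hf.mul_four_le (by linarith) _
  -- Indeed `Q ≤ X + 2η ≤ X + τρ² ≤ X + 2τX ≤ (1 + τ)² X`.
  have hneh : (1 + τ) ^ 2 * Q ≤ (1 + τ) ^ 4 * X := by
    have h6 : Q ≤ (1 + τ) ^ 2 * X := by
      have h7 : τ * (ρ ^ 2 / 2) ≤ τ * X := mul_le_mul_of_nonneg_left hXρ hτ0.le
      have h8 : 0 ≤ τ ^ 2 * X := mul_nonneg (sq_nonneg τ) (le_trans (by positivity) hXρ)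
      have h9 : (1 + τ) ^ 2 * X = X + 2 * (τ * X) + τ ^ 2 * X := by ring
      rw [h9]
      linarith
    calc (1 + τ) ^ 2 * Q ≤ (1 + τ) ^ 2 * ((1 + τ) ^ 2 * X) :=
          mul_le_mul_of_nonneg_left h6 (by positivity)
      _ = _ := by ring
  have hfinal := W.limitGroundLevel_le hq h2 hp hf hμ (w := (1 + τ) • u)
    (smul_ne_zero ht0.ne' hu0) (by rw [hQt]; exact hneh.trans hXt)
  rw [hQt] at hfinal
  have hlt := EReal.coe_lt_coe_iff.mp (hc'.trans_le hfinal)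
  have hsc := hscale τ hτ0.le hτδ hτ1 u (hM n)
  have h6 : (1 + τ) ^ 2 * Q ≤ (1 + τ) ^ 2 * (‖u‖ ^ 2 + η) :=
    mul_le_mul_of_nonneg_left hQu (by positivity)
  have h7 : (1 + τ) ^ 2 ≤ 1 + 3 * τ := by nlinarith
  have h8 : (1 + τ) ^ 2 * (‖u‖ ^ 2 + η) ≤ (1 + 3 * τ) * (‖u‖ ^ 2 + η) :=
    mul_le_mul_of_nonneg_right h7 (by positivity)
  have h9 : τ * ‖u‖ ^ 2 ≤ e / 4 := by
    refine le_trans ?_ hδM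
    have : ‖u‖ ^ 2 ≤ M ^ 2 := pow_le_pow_left₀ (norm_nonneg _) (hM n) 2
    exact mul_le_mul hτδ' this (by positivity) hδ'.le
  have h10 : τ * η ≤ η := mul_le_of_le_one_left hη0.le hτ1
  have h11 : (1 + 3 * τ) * (‖u‖ ^ 2 + η) = ‖u‖ ^ 2 + η + 3 * (τ * ‖u‖ ^ 2) + 3 * (τ * η) := by ring
  linarith

/-! ### Reduction of the Palais–Smale condition to null sequences. -/

/-- The weight exceeds `a` outside the ball of radius `R / ε`; the mass left inside a fixed ball
vanishes along locally null sequences. -/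
theorem W.exists_potential_bound (hε : 0 < ε) {a : ℝ}
    (hV : ∀ᶠ x in Bornology.cobounded (RN N), a < V x) :
    ∃ R, ∀ u : W s V ε, a * (∫ x, u.fn x ^ 2) ≤
      (∫ x, V (ε • x) * u.fn x ^ 2) + a * ∫ x in Metric.ball 0 R, u.fn x ^ 2 := by
  obtain ⟨R, -, hR⟩ := (Metric.hasBasis_cobounded_compl_ball (0 : RN N)).mem_iff.mp hV
  refine ⟨R / ε, fun u => ?_⟩
  have hS := measurableSet_ball (x := (0 : RN N)) (ε := R / ε)
  have h1 : a * (∫ x in (Metric.ball 0 (R / ε))ᶜ, u.fn x ^ 2) ≤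
      ∫ x in (Metric.ball 0 (R / ε))ᶜ, V (ε • x) * u.fn x ^ 2 := by
    rw [← integral_const_mul]
    refine setIntegral_mono_on (u.integrable_fn_sq.const_mul a).integrableOn
      u.integrable_sq.integrableOn hS.compl fun x hx => ?_
    refine mul_le_mul_of_nonneg_right (le_of_lt (hR ?_)) (sq_nonneg _)
    have h3 : R / ε ≤ ‖x‖ := by simpa using hx
    rw [div_le_iff₀ hε] at h3
    simp only [mem_compl_iff, Metric.mem_ball, dist_zero_right, not_lt, norm_smul,
      Real.norm_of_nonneg hε.le]
    linarith
  have h3 : ∫ x in (Metric.ball 0 (R / ε))ᶜ, V (ε • x) * u.fn x ^ 2 ≤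
      ∫ x, V (ε • x) * u.fn x ^ 2 :=
    setIntegral_le_integral u.integrable_sq
      (Eventually.of_forall fun x => mul_nonneg (V.pos _).le (sq_nonneg _))
  rw [← integral_add_compl hS u.integrable_fn_sq]
  linarith

/-- The reduction of the Palais–Smale condition to bounded, locally null sequences. -/
theorem W.palaisSmaleAt_of_null [CompleteSpace (W s V ε)] (hN : 0 < N) (hs : 0 < s) {V₀ : ℝ}
    (hV₀ : 0 < V₀) (hV : ∀ x, V₀ ≤ V x) (hε : 0 < ε) (hα : 0 < α) (hαN : α < N) (hq : 3 < q)
    {r' : ℝ} (hr' : q + 1 < r') (h2 : SobolevBound s V ε 2) (h4 : SobolevBound s V ε 4)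
    (hp : SobolevBound s V ε (q + 1)) (hSr' : SobolevBound s V ε r') (hf : IsAdmissible f q)
    {c : ℝ}
    (H : ∀ (v : ℕ → W s V ε) (M : ℝ), (∀ n, ‖v n‖ ≤ M) →
      (∀ R, Tendsto (fun n => ∫ x in Metric.ball 0 R, (v n).fn x ^ 2) atTop (𝓝 0)) →
      (∀ η > 0, ∀ᶠ n in atTop, ‖v n‖ ^ 2 ≤ (∫ x, f ((v n).fn x) * (v n).fn x) + η) →
      (∀ η > 0, ∀ᶠ n in atTop, 1 / 4 * ‖v n‖ ^ 2 + (∫ x, gap f ((v n).fn x)) ≤ c + η) →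
      Tendsto v atTop (𝓝 0)) :
    PalaisSmaleAt (energy α θ f : W s V ε → ℝ) c := by
  have hq0 : 0 < q := by linarith
  have hq1 : 1 < q := by linarith
  have h2' : SobolevBound s V ε (2 : ℕ) := by exact_mod_cast h2
  have h4' : SobolevBound s V ε (4 : ℕ) := by exact_mod_cast h4
  obtain ⟨T, hT⟩ := W.exists_tensor (s := s) (V := V) (ε := ε) hN hα hαN h2' h4'
  refine ⟨W.contDiff_energy hq0 h2 hp hf hT, fun u hJ hJ' => ?_⟩
  have hJn : Tendsto (fun n => ‖fderiv ℝ (energy α θ f : W s V ε → ℝ) (u n)‖) atTop (𝓝 0) :=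
    tendsto_zero_iff_norm_tendsto_zero.mp hJ'
  -- The bounds hold only from `n₀` on, so the sequence is shifted before a subsequence is
  -- extracted.
  obtain ⟨n₀, hn₀⟩ := ((hJ.eventually_lt_const (lt_add_one c)).and
    (hJn.eventually_lt_const one_pos)).exists_forall_of_atTop
  set A : ℝ := |c + 1| with hA
  have hbd : ∀ n, ‖u (n + n₀)‖ ≤ 4 * A + 1 := fun n =>
    W.norm_le_of_energy_le (θ := θ) hq0 h2 hp hf hT (abs_nonneg _)
      ((hn₀ (n + n₀) (Nat.le_add_left _ _)).1.le.trans (le_abs_self _))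
      (hn₀ (n + n₀) (Nat.le_add_left _ _)).2.le
  set B : ℝ := 4 * A + 1 with hB
  have hB0 : 0 ≤ B := by positivity
  obtain ⟨w, k, hk, hwk⟩ := exists_weaklyTendsto_subseq (fun n => u (n + n₀)) hbd
  have hk' : StrictMono fun n => k n + n₀ := fun a b hab => Nat.add_lt_add_right (hk hab) _
  refine ⟨w, fun n => k n + n₀, hk', ?_⟩
  set y : ℕ → W s V ε := fun n => u (k n + n₀) with hy
  have hyB : ∀ n, ‖y n‖ ≤ B := fun n => hbd (k n)
  set v : ℕ → W s V ε := fun n => y n - w with hv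
  have hyv : ∀ n, y n = v n + w := fun n => (sub_add_cancel _ _).symm
  set M : ℝ := B + ‖w‖ with hM
  have hM0 : 0 ≤ M := by positivity
  have hvM : ∀ n, ‖v n‖ ≤ M := fun n =>
    (norm_sub_le _ _).trans (add_le_add_left (hyB n) _)
  have hv0 : WeaklyTendsto v 0 := fun ℓ => by
    have h1 := (hwk ℓ).sub_const (ℓ w)
    rw [sub_self] at h1
    rw [map_zero]
    refine h1.congr fun n => ?_
    exact (map_sub ℓ (y n) w).symm
  have hloc := fun R => W.tendsto_setIntegral_ball_sq hs hV₀ hV hvM hv0 R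
  have hwv : Tendsto (fun n => inner ℝ w (v n)) atTop (𝓝 0) := by
    have h1 := hv0 (innerSL ℝ w)
    rw [map_zero] at h1
    exact h1
  have hJy : Tendsto (fun n => energy α θ f (y n)) atTop (𝓝 c) := hJ.comp hk'.tendsto_atTop
  have hJny : Tendsto (fun n => ‖fderiv ℝ (energy α θ f : W s V ε → ℝ) (y n)‖) atTop (𝓝 0) :=
    hJn.comp hk'.tendsto_atTop
  have hJpair : ∀ z : ℕ → W s V ε, ∀ K, (∀ n, ‖z n‖ ≤ K) →
      Tendsto (fun n => fderiv ℝ (energy α θ f : W s V ε → ℝ) (y n) (z n)) atTop (𝓝 0) :=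
    fun z K hz => by
      have h1 := hJny.mul_const K
      rw [zero_mul] at h1
      refine squeeze_zero_norm (fun n => ?_) h1
      exact ((fderiv ℝ (energy α θ f : W s V ε → ℝ) (y n)).le_opNorm (z n)).trans
        (mul_le_mul_of_nonneg_left (hz n) (norm_nonneg _))
  have hder : ∀ η > 0, ∀ᶠ n in atTop,
      ‖v n‖ ^ 2 ≤ (∫ x, f ((v n).fn x) * (v n).fn x) + η := fun η hη => by
    have h1 := hJpair v M hvM
    have h3 := W.tendsto_inner_tensor hN hα hαN (by linarith) h2' h4' hSr' hT hvM hloc w hyB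
    have h5 := W.tendsto_integral_nemytskii_sub hq1 hr' h2 hp hSr' hf.intermediate hvM hloc w
    have h6 := ((h1.sub hwv).sub (h3.const_mul (ε ^ (α - θ)))).add h5
    rw [mul_zero, sub_zero, sub_zero, add_zero] at h6
    filter_upwards [h6.eventually_lt_const hη] with n hn
    rw [W.fderiv_energy_apply hq0 h2 hp hf hT, ← hyv n] at hn
    have h7 : inner ℝ (y n) (v n) = ‖v n‖ ^ 2 + inner ℝ w (v n) := by
      conv_lhs => rw [hyv n]
      rw [inner_add_left, real_inner_self_eq_norm_sq]
    -- Splitting only the second argument of `T` isolates a square, dropped by its sign, and a mixed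
    -- term with the fixed `w`.
    have h8 : inner ℝ (T (y n) (y n)) (T (y n) (v n)) =
        ‖T (y n) (v n)‖ ^ 2 + inner ℝ (T (y n) w) (T (y n) (v n)) := by
      have : T (y n) (y n) = T (y n) (v n) + T (y n) w := by rw [← map_add, ← hyv n]
      rw [this, inner_add_left, real_inner_self_eq_norm_sq]
    rw [h7, h8] at hn
    have h9 : 0 ≤ ε ^ (α - θ) * ‖T (y n) (v n)‖ ^ 2 := by positivity
    linarith
  have hval : ∀ η > 0, ∀ᶠ n in atTop,
      1 / 4 * ‖v n‖ ^ 2 + (∫ x, gap f ((v n).fn x)) ≤ c + η := fun η hη => by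
    have h1 := hJy.sub ((hJpair y B hyB).const_mul (1 / 4))
    rw [mul_zero, sub_zero] at h1
    have h3 := h1.sub (hwv.const_mul (1 / 2))
    rw [mul_zero, sub_zero] at h3
    filter_upwards [h3.eventually_lt_const (show c < c + η / 2 by linarith),
      W.eventually_integral_gap_le hq1 hr' h2 hp hSr' hf hvM hloc w (half_pos hη)] with n hn hn'
    rw [W.energy_sub_fderiv hq0 h2 hp hf hT] at hn
    rw [← hyv n] at hn'
    -- The cross term vanishes by weak convergence, and `‖w‖²` is discarded as nonnegative.
    have h7 : ‖y n‖ ^ 2 = ‖v n‖ ^ 2 + 2 * inner ℝ w (v n) + ‖w‖ ^ 2 := by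
      conv_lhs => rw [hyv n]
      rw [norm_add_sq_real, real_inner_comm]
    rw [h7] at hn
    have := sq_nonneg ‖w‖
    linarith
  have hfin := H v M hvM hloc hder hval
  have h10 := hfin.add_const w
  rw [zero_add] at h10
  exact h10.congr fun n => (hyv n).symm

end WSpace

end FracSchrodingerPoisson

/-! ### The two cases of the statement. -/

theorem proposition3p4 (N : ℕ) (s α θ ε : ℝ)
    (hs : s ∈ Ioo (0 : ℝ) 1) (hα : α ∈ Ioo (0 : ℝ) N) (hθ : θ ∈ Ioo (0 : ℝ) α)
    (hN : (N : ℝ) ∈ Ioo (2 * s) (2 * s + α)) (hε : 0 < ε)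
    (V : FracSchrodingerPoisson.Potential N)
    (V₀ : ℝ) (hV₀ : IsLeast (range V) V₀) (V_inf : EReal)
    (hV_inf : V_inf =
      liminf (fun x => ((V x : ℝ) : EReal)) (Bornology.cobounded (FracSchrodingerPoisson.RN N)))
    (hV : (V₀ : EReal) < V_inf)
    (f : ℝ → ℝ) (hf1 : ContDiff ℝ 1 f) (hf1' : ∀ t ≤ 0, f t = 0)
    (hf2 : Tendsto (fun t => f t / t) (𝓝[≠] 0) (𝓝 0))
    (hf3 : ∃ q₀ ∈ Ioo (2 : ℝ) (2 * N / (N - 2 * s) - 1),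
      Tendsto (fun t : ℝ => f t / t ^ q₀) atTop (𝓝 0))
    (hf4 : ∃ K > (4 : ℝ), ∀ t > 0, 0 < K * FracSchrodingerPoisson.primitive f t ∧
      K * FracSchrodingerPoisson.primitive f t ≤ t * f t)
    (hf5 : StrictMonoOn (fun t => f t / t ^ 3) (Ioi 0)) :
    (∀ μ : ℝ, V_inf = (μ : EReal) → ∀ c : ℝ,
      (c : EReal) < FracSchrodingerPoisson.limitGroundLevel N s f μ →
      FracSchrodingerPoisson.PalaisSmaleAt
        (FracSchrodingerPoisson.energy α θ f : FracSchrodingerPoisson.W s V ε → ℝ) c) ∧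
    (V_inf = ⊤ → ∀ c : ℝ,
      FracSchrodingerPoisson.PalaisSmaleAt
        (FracSchrodingerPoisson.energy α θ f : FracSchrodingerPoisson.W s V ε → ℝ) c) := by
  obtain ⟨q, hq, hfq⟩ := hf3
  obtain ⟨hf, hq3⟩ :=
    FracSchrodingerPoisson.isAdmissible_of_hypotheses hf1 hf1' hf2 hfq hf4 hf5
  have hN0 : 0 < N := by
    have h1 : (0 : ℝ) < N := by linarith [hN.1, hs.1]
    exact_mod_cast h1
  have hVle : ∀ x, V₀ ≤ V x := fun x => hV₀.2 (mem_range_self x)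
  have hV₀pos : 0 < V₀ := by
    obtain ⟨x, hx⟩ := hV₀.1
    rw [← hx]
    exact V.pos x
  have hemb : ∀ r : ℝ, 2 ≤ r → r < 2 * N / (N - 2 * s) →
      FracSchrodingerPoisson.SobolevBound s V ε r := fun r h2 hr =>
    FracSchrodingerPoisson.W.exists_sobolev_bound hN0 hs.1 hN.1 hV₀pos hVle h2 hr
  have hq2 : q + 1 < 2 * N / (N - 2 * s) := by linarith [hq.2]
  -- Subcriticality is strict, which leaves the spare exponent for the interpolation.
  obtain ⟨r', hr', hr'2⟩ := exists_between hq2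
  have h2 := hemb 2 le_rfl (by linarith)
  have h4 := hemb 4 (by norm_num) (by linarith)
  have hp := hemb (q + 1) (by linarith) hq2
  have hSr' := hemb r' (by linarith) hr'2
  have hcomplete := FracSchrodingerPoisson.W.completeSpace (s := s) (ε := ε) hV₀pos hVle
  have hlim : ∀ a : ℝ, (a : EReal) < V_inf →
      ∀ᶠ x in Bornology.cobounded (FracSchrodingerPoisson.RN N), a < V x := fun a ha => by
    rw [hV_inf] at ha
    filter_upwards [eventually_lt_of_lt_liminf ha] with x hx
    exact EReal.coe_lt_coe_iff.mp hx
  refine ⟨fun μ hμ c hc => ?_, fun htop c => ?_⟩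
  · have hμV : V₀ < μ := by
      rw [hμ] at hV
      exact EReal.coe_lt_coe_iff.mp hV
    have hμ0 : 0 < μ := hV₀pos.trans hμV
    refine FracSchrodingerPoisson.W.palaisSmaleAt_of_null hN0 hs.1 hV₀pos hVle hε hα.1 hα.2 hq3
      hr' h2 h4 hp hSr' hf fun v M hM hloc hder hval => ?_
    refine FracSchrodingerPoisson.W.tendsto_zero_of_lt_limitGroundLevel (by linarith) h2 hp hf hμ0
      hM hc hder hval fun η hη => ?_
    obtain ⟨K, hK, hKb⟩ := h2.exists_bound zero_le_two hM
    simp only [rpow_two, sq_abs] at hKb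
    obtain ⟨δ, hδ, hδK⟩ := FracSchrodingerPoisson.exists_pos_mul_le hK (half_pos hη)
    -- Near infinity `V` exceeds only levels below `μ`; the deficit costs `d * ∫ (v n)² ≤ δ * K ≤ η
    -- / 2`.
    set d := min δ μ with hd
    have hd0 : 0 < d := lt_min hδ hμ0
    obtain ⟨R, hR⟩ := FracSchrodingerPoisson.W.exists_potential_bound (s := s) hε
      (hlim (μ - d) (by rw [hμ]; exact EReal.coe_lt_coe_iff.mpr (by linarith)))
    have h5 := (hloc R).const_mul (μ - d)
    rw [mul_zero] at h5
    filter_upwards [h5.eventually_lt_const (half_pos hη)] with n hn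
    have h6 := hR (v n)
    have h7 : d * (∫ x, (v n).fn x ^ 2) ≤ δ * K :=
      mul_le_mul (min_le_left _ _) (hKb n) (integral_nonneg fun x => sq_nonneg _) hδ.le
    linarith
  · refine FracSchrodingerPoisson.W.palaisSmaleAt_of_null hN0 hs.1 hV₀pos hVle hε hα.1 hα.2 hq3
      hr' h2 h4 hp hSr' hf fun v M hM hloc hder _ => ?_
    have hL2 : Tendsto (fun n => ∫ x in univ, (v n).fn x ^ 2) atTop (𝓝 0) := by
      refine FracSchrodingerPoisson.tendsto_zero_of_forall_eventually_abs_le fun η hη => ?_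
      obtain ⟨δ, hδ, hδM⟩ := FracSchrodingerPoisson.exists_pos_mul_le (sq_nonneg M) (half_pos hη)
      -- The level `δ⁻¹` is arbitrarily high here, so the mass outside the ball is at most `δ * M ^
      -- 2`.
      obtain ⟨R, hR⟩ := FracSchrodingerPoisson.W.exists_potential_bound (s := s) hε
        (hlim δ⁻¹ (by rw [htop]; exact EReal.coe_lt_top _))
      filter_upwards [(hloc R).eventually_lt_const (half_pos hη)] with n hn
      rw [setIntegral_univ, abs_of_nonneg (integral_nonneg fun x => sq_nonneg _)]
      have h6 := hR (v n)
      have h7 := FracSchrodingerPoisson.W.norm_sq (v n)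
      have h8 : ‖v n‖ ^ 2 ≤ M ^ 2 := pow_le_pow_left₀ (norm_nonneg _) (hM n) 2
      have h9 : δ⁻¹ * (∫ x, (v n).fn x ^ 2) ≤
          M ^ 2 + δ⁻¹ * ∫ x in Metric.ball 0 R, (v n).fn x ^ 2 := by
        have := sq_nonneg ‖FracSchrodingerPoisson.fracLap s
          (FracSchrodingerPoisson.W.toHs (v n))‖
        linarith
      have h10 := mul_le_mul_of_nonneg_left h9 hδ.le
      rw [mul_add, mul_inv_cancel_left₀ hδ.ne', mul_inv_cancel_left₀ hδ.ne'] at h10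
      linarith
    have hfv := FracSchrodingerPoisson.W.tendsto_setIntegral_intermediate (by linarith) hr' hp
      hSr' hM (hf.intermediate_mul (by linarith)) hL2
    simp only [setIntegral_univ] at hfv
    rw [tendsto_zero_iff_norm_tendsto_zero]
    have hsq : Tendsto (fun n => ‖v n‖ ^ 2) atTop (𝓝 0) := by
      refine FracSchrodingerPoisson.tendsto_zero_of_forall_eventually_abs_le fun η hη => ?_
      filter_upwards [hder (η / 2) (half_pos hη), hfv.eventually_lt_const (half_pos hη)]
        with n hn hn'
      rw [abs_of_nonneg (sq_nonneg _)]
      linarith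
    have h11 := hsq.sqrt
    rw [sqrt_zero] at h11
    exact h11.congr fun n => sqrt_sq (norm_nonneg _)
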